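/- **Setting.** Let $H$ be a real or complex Hilbert space (write $\langle\cdot,\cdot\rangle$ for the real part of its scalar product) and let $A$ be a self-adjoint nonnegative unbounded operator on $H$ with compact resolvent and $|Au|\ge\omega|u|$ on $D(A)$ for some $\omega>0$. For $k\in\mathbb N$ let $H_k=D(A^{k/2})$ ($H_0=H$), and $|u|_k=|A^{k/2}u|$ for $k\in\mathbb Z$. For a pair $W=(w,w')$ put $e_k(W)=\tfrac12\big(|A^{k/2}w|^2+|A^{(k-1)/2}w'|^2\big)$. Let $n\ge 2$, $p\ge 1$, and let $C_{ij}$ be bounded operators on $H$. Consider the mixed cascade system $$\begin{cases}u_1''+Au_1=0,\\ u_i''+Au_i+C_{i\,i-1}u_{i-1}=0, & 2\le i\le n,\\ u_i''+Au_i+\sum_{k=n-1}^{i-1}C_{ik}u_k=0, & n+1\le i\le n+p,\end{cases}\tag{1}$$ and write $U_i=(u_i,u_i')$. Solutions are understood with values in the energy space: $u_i\in C^0([0,T];H_1)\cap C^1([0,T];H)$. **Hypotheses.** (a) For $2\le i\le n$: $C_{i\,i-1}^*\in\mathcal L(H_k)$ for $0\le k\le n-i+1$; $|C_{i\,i-1}w|^2\le\|C_{i\,i-1}\|\langle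 C_{i\,i-1}w,w\rangle$ for all $w\in H$; and there are $\Pi_i\in\mathcal L(H)$, $\alpha_i>0$ with $\alpha_i|\Pi_iw|^2\le\langle C_{i\,i-1}w,w\rangle$ for all $w\in H$. Moreover there is $T_0>0$ such that for every $T>T_0$ there is $\gamma>0$ with $\int_0^T|\Pi_iw'|^2dt\ge\gamma\,e_1(W)(0)$ for all solutions of $w''+Aw=0$. (b) For $n+1\le i\le n+p$ and $n-1\le j\le i-1$: $C_{ij}$ and $C_{ij}^*$ belong to $\mathcal L(H_k)$, $k=0,1$. (c) For $0\le j\le p$, $G_{n+j}$ is a Hilbert space and $\mathbf B^*_{n+j}\in\mathcal L(H_2\times H;G_{n+j})$ is such that: * (admissibility) for every $T>0$ there is $D>0$ such that all solutions of $w''+Aw=f\in L^2(0,T;H)$ satisfy $$\int_0^T\|\mathbf B^*_{n+j}W\|^2dt\le D\Big(e_1(W)(0)+e_1(W)(T)+\int_0^Te_1(W)(t)\,dt+\int_0^T|f|^2dt\Big);$$ * (observability) there is $T_{0}>0$ such that for every $T>T_0$ there is $R>0$ with $\int_0^T\|\mathbf B^*_{n+j}W\|^2dt\ge R\,e_1(W)(0)$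 for all solutions of $w''+Aw=0$. These two inequalities are required for strong solutions ($w\in C^0([0,T];D(A))\cap C^2([0,T];H)$); by admissibility $\mathbf B^*_{n+j}W\in L^2(0,T;G_{n+j})$ is defined for every finite energy solution $W$ with source in $L^2(0,T;H)$ through extension by density. **Conclusion.** For every $T>0$ the observations $\mathbf B^*_{n+j}U_{n+j}\in L^2(0,T;G_{n+j})$ of every solution of (1) are well defined (they exist and are unique almost everywhere), and: (i) For every $T>0$ there is $C(T)>0$ such that all solutions of (1) satisfy $$\sum_{j=0}^p\int_0^T\|\mathbf B^*_{n+j}U_{n+j}\|^2_{G_{n+j}}dt\le C(T)\Big(\sum_{i=1}^ne_{1+i-n}(U_i)(0)+\sum_{j=1}^pe_1(U_{n+j})(0)\Big).$$ (ii) There are $T^*_{n+p}>0$ and, for $T>T_{n+p}^*$, constants $d_{i,n}(T)>0$ ($1\le i\le n$) and $\rho_{n,k}(T)>0$ ($1\le k\le p$) such that, for all $T>T^*_{n+p}$, all solutions of (1) satisfy $$e_{1+i-n}(U_i)(0)\le d_{i,n}(T)\int_0^T\|\mathbf B_n^*U_n\|^2_{G_n}dt,\qquad 1\le i\le n,$$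 $$e_1(U_{n+k})(0)\le\rho_{n,k}(T)\sum_{l=0}^k\int_0^T\|\mathbf B_{n+l}^*U_{n+l}\|^2_{G_{n+l}}dt,\qquad 1\le k\le p;$$ moreover, with some $K$ independent of $T$, $d_{i,n}(T)\le K/T^3$ for $1\le i\le n-1$ and $d_{n,n}(T)\le K/T$ for all $T>T^*_{n+p}$. -/

import Mathlib

open Set Filter Topology MeasureTheory

noncomputable section

namespace Cascade

variable {𝕜 : Type*} [RCLike 𝕜] {H : Type*} [NormedAddCommGroup H] [InnerProductSpace 𝕜 H]
  [CompleteSpace H]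

/-! ### The operator `A` and the scale of spaces `H_k = D(A^{k/2})` -/

/-- `A` is an unbounded self-adjoint, nonnegative operator with `|A u| ≥ ω |u|` for some `ω > 0`
and with a compact resolvent: for some scalar `z` the operator `A - z` has an everywhere defined
compact inverse. -/
structure IsCoerciveSelfAdjoint (A : H →ₗ.[𝕜] H) : Prop where
  selfAdjoint : IsSelfAdjoint A
  nonneg : ∀ u : A.domain, 0 ≤ RCLike.re (inner 𝕜 (A u) (u : H))
  lower_bound : ∃ ω : ℝ, 0 < ω ∧ ∀ u : A.domain, ω * ‖(u : H)‖ ≤ ‖A u‖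
  compact_resolvent : ∃ (z : 𝕜) (R : H →L[𝕜] H), IsCompactOperator R ∧
    (∀ x : H, ∃ hx : R x ∈ A.domain, A ⟨R x, hx⟩ - z • R x = x) ∧
    ∀ u : A.domain, R (A u - z • (u : H)) = u

open Classical in
/-- `A^{-1/2}`: the positive bounded operator `S` with `S² = A⁻¹`, that is `A S² = id`. (For
`A` as in `IsCoerciveSelfAdjoint` there is exactly one.) -/
def invSqrt (A : H →ₗ.[𝕜] H) : H →L[𝕜] H :=
  if h : ∃ S : H →L[𝕜] H, S.IsPositive ∧
      ∀ x : H, ∃ hx : S (S x) ∈ A.domain, A ⟨S (S x), hx⟩ = x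
  then h.choose else 0

/-- The operator `A^{k/2}`, `k ∈ ℤ`: the (unbounded) inverse of the injective operator
`(A^{-1/2})^k` when `k ≥ 0`, and the bounded operator `(A^{-1/2})^{-k}` when `k < 0`. Its domain
is `H_k` when `k ≥ 0`. -/
def halfPow (A : H →ₗ.[𝕜] H) : ℤ → H →ₗ.[𝕜] H
  | Int.ofNat k => ((invSqrt A ^ k : H →L[𝕜] H).toLinearMap.toPMap ⊤).inverse
  | Int.negSucc k => (invSqrt A ^ (k + 1) : H →L[𝕜] H).toLinearMap.toPMap ⊤

open Classical in
/-- The norm `|u|_k = |A^{k/2} u|`. It is only used for `u ∈ D(A^{k/2})`. -/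
def hNorm (A : H →ₗ.[𝕜] H) (k : ℤ) (u : H) : ℝ :=
  if hu : u ∈ (halfPow A k).domain then ‖halfPow A k ⟨u, hu⟩‖ else 0

/-- The energy of level `k` of a pair `(u, u')`:
`e_k = 1/2 (|A^{k/2} u|² + |A^{(k-1)/2} u'|²)`. -/
def energy (A : H →ₗ.[𝕜] H) (k : ℤ) (u u' : H) : ℝ :=
  (1 / 2) * (hNorm A k u ^ 2 + hNorm A (k - 1) u' ^ 2)

/-- `C ∈ 𝓛(H_k)` for an operator `C` on `H`: it maps `H_k` into itself and is bounded for `|·|_k`. -/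
def BoundedOnScale (A : H →ₗ.[𝕜] H) (k : ℕ) (C : H →L[𝕜] H) : Prop :=
  ∃ M : ℝ, ∀ u ∈ (halfPow A k).domain,
    C u ∈ (halfPow A k).domain ∧ hNorm A k (C u) ≤ M * hNorm A k u

/-! ### The scalar equation `w'' + A w = f` on `[0, T]` -/

/-- `(w, w') = (w, v)` is a finite energy solution of `w'' + A w = f` on `[0, T]`, where `f` is
continuous: `w ∈ C⁰([0,T]; H_1) ∩ C¹([0,T]; H)`, and the equation holds tested against every
element of `D(A)`. -/
structure IsSolution [NormedSpace ℝ H] (A : H →ₗ.[𝕜] H) (T : ℝ) (w v f : ℝ → H) : Prop where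
  continuous_H1 : ∃ a : ℝ → H, ContinuousOn a (Icc 0 T) ∧
    ∀ t ∈ Icc 0 T, ∃ h : w t ∈ (halfPow A 1).domain, halfPow A 1 ⟨w t, h⟩ = a t
  hasDeriv : ∀ t ∈ Icc 0 T, HasDerivWithinAt w (v t) (Icc 0 T) t
  continuous_deriv : ContinuousOn v (Icc 0 T)
  continuous_source : ContinuousOn f (Icc 0 T)
  equation : ∀ φ : A.domain, ∀ t ∈ Icc 0 T,
    HasDerivWithinAt (fun s => inner 𝕜 (φ : H) (v s))
      (inner 𝕜 (φ : H) (f t) - inner 𝕜 (A φ) (w t)) (Icc 0 T) t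

/-- `(w, w') = (w, v)` is a strong solution of `w'' + A w = f` on `[0, T]`:
`w ∈ C⁰([0,T]; D(A)) ∩ C²([0,T]; H)`, `f ∈ C⁰([0,T]; H)`, and the equation holds in `H`. -/
structure IsStrongSolution [NormedSpace ℝ H] (A : H →ₗ.[𝕜] H) (T : ℝ) (w : ℝ → A.domain)
    (v f : ℝ → H) : Prop where
  continuous_H2 : ContinuousOn (fun t => A (w t)) (Icc 0 T)
  hasDeriv : ∀ t ∈ Icc 0 T, HasDerivWithinAt (fun s => (w s : H)) (v t) (Icc 0 T) t
  continuous_source : ContinuousOn f (Icc 0 T)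
  equation : ∀ t ∈ Icc 0 T, HasDerivWithinAt v (f t - A (w t)) (Icc 0 T) t

/-! ### Assumptions on coupling and observation operators -/

/-- `Π ∈ 𝓛(H)` observes the free equation through `Π w'` in every time beyond some `T₀`. -/
def ObservesVelocity [NormedSpace ℝ H] (A : H →ₗ.[𝕜] H) (P : H →L[𝕜] H) : Prop :=
  ∃ T₀ : ℝ, 0 < T₀ ∧ ∀ T : ℝ, T₀ < T → ∃ γ : ℝ, 0 < γ ∧
    ∀ w v : ℝ → H, IsSolution A T w v (fun _ => 0) →
      γ * energy A 1 (w 0) (v 0) ≤ ∫ t in (0 : ℝ)..T, ‖P (v t)‖ ^ 2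

/-- The assumption on the bi-diagonal coupling operator `C = C_{i i-1}` of an `n`-system, with
`m = n - i + 1`: regularity of the adjoint and partial coercivity. -/
structure IsPartiallyCoercive (A : H →ₗ.[𝕜] H) (m : ℕ) (C P : H →L[𝕜] H) : Prop where
  adjoint_bounded : ∀ k : ℕ, k ≤ m → BoundedOnScale A k (ContinuousLinearMap.adjoint C)
  upper : ∀ x : H, ‖C x‖ ^ 2 ≤ ‖C‖ * RCLike.re (inner 𝕜 (C x) x)
  lower : ∃ α : ℝ, 0 < α ∧ ∀ x : H, α * ‖P x‖ ^ 2 ≤ RCLike.re (inner 𝕜 (C x) x)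

variable {G : Type*} [NormedAddCommGroup G] [InnerProductSpace 𝕜 G]

/-- `B ∈ 𝓛(H_2 × H; G)`, and the direct inequality holds for `w'' + A w = f` in every time
`T > 0`. The inequality is required for strong solutions, for which `B(w(t), w'(t))` makes sense
at every `t`; they are dense among all the solutions with finite energy and `f ∈ L²(0,T;H)`. -/
structure IsAdmissible [NormedSpace ℝ H] (A : H →ₗ.[𝕜] H) (B : A.domain × H →ₗ[𝕜] G) : Prop where
  bounded : ∃ M : ℝ, ∀ (u : A.domain) (v : H), ‖B (u, v)‖ ≤ M * (‖A u‖ + ‖v‖)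
  direct : ∀ T : ℝ, 0 < T → ∃ D : ℝ, 0 < D ∧
    ∀ (w : ℝ → A.domain) (v f : ℝ → H), IsStrongSolution A T w v f →
      ∫ t in (0 : ℝ)..T, ‖B (w t, v t)‖ ^ 2 ≤
        D * (energy A 1 (w 0) (v 0) + energy A 1 (w T) (v T)
          + (∫ t in (0 : ℝ)..T, energy A 1 (w t) (v t)) + ∫ t in (0 : ℝ)..T, ‖f t‖ ^ 2)

/-- `B` observes the free equation `w'' + A w = 0` in every time beyond some `T₀`. -/
def IsObserving [NormedSpace ℝ H] (A : H →ₗ.[𝕜] H) (B : A.domain × H →ₗ[𝕜] G) : Prop :=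
  ∃ T₀ : ℝ, 0 < T₀ ∧ ∀ T : ℝ, T₀ < T → ∃ R : ℝ, 0 < R ∧
    ∀ (w : ℝ → A.domain) (v : ℝ → H), IsStrongSolution A T w v (fun _ => 0) →
      R * energy A 1 (w 0) (v 0) ≤ ∫ t in (0 : ℝ)..T, ‖B (w t, v t)‖ ^ 2

/-- `g ∈ L²(0,T;G)` is the observation `B(w, w')` of the finite energy solution `(w, w') = (w, v)`
of `w'' + A w = f`, in the sense of extension by density: it is the limit in `L²(0,T;G)` of
`B(w_m, w_m')` for strong solutions `w_m` whose data converge to those of `w` in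
`H_1 × H × L²(0,T;H)`. For an admissible `B` it exists and is unique almost everywhere. -/
def IsObservation [NormedSpace ℝ H] (A : H →ₗ.[𝕜] H) (B : A.domain × H →ₗ[𝕜] G) (T : ℝ)
    (w v f : ℝ → H) (g : ℝ → G) : Prop :=
  MemLp g 2 (volume.restrict (Icc 0 T)) ∧
  ∃ (ws : ℕ → ℝ → A.domain) (vs fs : ℕ → ℝ → H),
    (∀ m, IsStrongSolution A T (ws m) (vs m) (fs m)) ∧
    Tendsto (fun m => energy A 1 ((ws m 0 : H) - w 0) (vs m 0 - v 0)) atTop (𝓝 0) ∧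
    Tendsto (fun m => ∫ t in (0 : ℝ)..T, ‖fs m t - f t‖ ^ 2) atTop (𝓝 0) ∧
    Tendsto (fun m => ∫ t in (0 : ℝ)..T, ‖B (ws m t, vs m t) - g t‖ ^ 2) atTop (𝓝 0)

/-! ### The mixed cascade system -/

/-- The coupling term of the `i`-th equation, `i ≥ 1`: nothing for `i = 1`,
`C_{i i-1} x_{i-1}` for `2 ≤ i ≤ n`, and `∑_{k=n-1}^{i-1} C_{i k} x_k` for `i > n`. -/
def coupling (n : ℕ) (C : ℕ → ℕ → H →L[𝕜] H) (x : ℕ → H) (i : ℕ) : H :=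
  if i ≤ 1 then 0
  else if i ≤ n then C i (i - 1) (x (i - 1))
  else ∑ k ∈ Finset.Ico (n - 1) i, C i k (x k)

/-- `(u_i, u_i') = (u i, v i)`, `1 ≤ i ≤ n + p`, is a solution with values in the energy space
`H_1^{n+p} × H^{n+p}` of the mixed cascade system `u_i'' + A u_i + coupling_i(u) = 0` on
`[0, T]`. -/
def IsMixedSolution [NormedSpace ℝ H] (A : H →ₗ.[𝕜] H) (n p : ℕ) (C : ℕ → ℕ → H →L[𝕜] H)
    (T : ℝ) (u v : ℕ → ℝ → H) : Prop :=
  ∀ i ∈ Finset.Icc 1 (n + p),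
    IsSolution A T (u i) (v i) (fun t => -coupling n C (fun k => u k t) i)

/-- `g j`, `0 ≤ j ≤ p`, is the observation `B_{n+j}(u_{n+j}, u_{n+j}')` of a solution of the mixed
cascade system. -/
def IsMixedObservation [NormedSpace ℝ H] (A : H →ₗ.[𝕜] H) (n p : ℕ)
    (C : ℕ → ℕ → H →L[𝕜] H) {G : Fin (p + 1) → Type*} [∀ j, NormedAddCommGroup (G j)]
    [∀ j, InnerProductSpace 𝕜 (G j)] (B : ∀ j, A.domain × H →ₗ[𝕜] G j)
    (T : ℝ) (u v : ℕ → ℝ → H) (g : ∀ j, ℝ → G j) : Prop :=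
  ∀ j : Fin (p + 1), IsObservation A (B j) T (u (n + j)) (v (n + j))
    (fun t => -coupling n C (fun k => u k t) (n + j)) (g j)

end Cascade

end

/-! Put `S` for A^{-1/2} and replace a solution w by the pair (x, v) = (A^{1/2}w, w'). The equation
w'' + Aw = f becomes (Sx)' = v, (Sv)' = Sf - x (`RedSol`), which involves bounded operators only.
The regularisations `reg S m` commute with `S` and tend strongly to the identity. They justify the
energy identities and approximate finite energy solutions by strong ones, so observations are well
defined through the direct inequality.

Observability of the free equation passes to equations with a source by comparison with a free
solution on windows of fixed length. Summing over windows gives ∫ e_1 ≤ C(∫ |observation|² + ∫ |f|²)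
with C independent of T. Free solutions exist because A has compact resolvent: the eigenvectors have
dense span, and the set of initial data of free solutions is closed by conservation of energy.

In the cascade u_j is measured in a norm weaker by n - j levels. Taking n - j time primitives of u_j
brings every component to the natural energy space and turns the coupling D_i u_{i-1} into D_i
w_{i-1}' (`DispChain.velChain`). In such a chain, pairing two consecutive equations produces ∫ ⟨D_i
w_{i-1}', w_{i-1}'⟩, which is bounded below by α ∫ |Π_i w_{i-1}'|² and hence, by observability
through Π_i, controls the energy of w_{i-1}. Balancing the terms by powers of T gives, by induction
on the length, preceding energies of order T⁻³ ∫ e_1(W_n) and a last energy of order T⁻¹ ∫ e_1(W_n)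
(`ChainEstimate.succ`, `chainEstimate`). Since u_{n-1} is the velocity of its own first primitive,
the source D_n u_{n-1} in the last equation is absorbed for large T, and the observation of u_n
controls the whole chain (`ChainEstimate.exists_primEn_le`).

The energies of the primitives are equivalent to the weak energies of the cascade, because the
adjoints of the couplings are bounded on H_k, so the couplings are bounded for the dual norms
(`exists_weakEn_le`). The components after the n-th are recovered one by one: their sources involve
only u_{n-1}, u_n and later components already controlled (`RedObserving.exists_en_le`). The direct
inequality is forward propagation of energy combined with admissibility. -/

open scoped RealInnerProductSpace

set_option linter.unusedSectionVars false

namespace Cascade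

/-! ### Calculus on compact intervals, with one-sided derivatives at the ends. -/

section Calculus

variable {F : Type*} [NormedAddCommGroup F] [NormedSpace ℝ F]

theorem integral_eq_sub_of_hasDerivWithinAt_Icc [CompleteSpace F] {g g' : ℝ → F} {a b : ℝ}
    (hab : a ≤ b) (hg : ∀ t ∈ Icc a b, HasDerivWithinAt g (g' t) (Icc a b) t)
    (hg' : ContinuousOn g' (Icc a b)) : ∫ t in a..b, g' t = g b - g a :=
  intervalIntegral.integral_eq_sub_of_hasDerivAt_of_le hab
    (fun t ht => (hg t ht).continuousWithinAt)
    (fun t ht => (hg t (Ioo_subset_Icc_self ht)).hasDerivAt (Icc_mem_nhds ht.1 ht.2))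
    (by rw [← uIcc_of_le hab] at hg'; exact hg'.intervalIntegrable)

theorem hasDerivWithinAt_Icc_of_eq_integral [CompleteSpace F] {g g' : ℝ → F} {a b : ℝ}
    (hg' : ContinuousOn g' (Icc a b))
    (hg : ∀ t ∈ Icc a b, g t = g a + ∫ s in a..t, g' s) :
    ∀ t ∈ Icc a b, HasDerivWithinAt g (g' t) (Icc a b) t := by
  intro t ht
  have hab : a ≤ b := ht.1.trans ht.2
  -- Extended by its end values, `g'` is continuous on the whole line, so the fundamental theorem
  -- also applies at `a` and `b`.
  set k : ℝ → F := IccExtend hab ((Icc a b).domRestrict g') with hk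
  have hkc : Continuous k := (continuousOn_iff_continuous_domRestrict.1 hg').Icc_extend'
  have hkeq : ∀ s ∈ Icc a b, k s = g' s := fun s hs => by
    rw [hk, IccExtend_of_mem hab _ hs]; rfl
  have h1 : HasDerivWithinAt (fun s => g a + ∫ r in a..s, k r) (k t) (Icc a b) t :=
    ((hkc.integral_hasStrictDerivAt a t).hasDerivAt.const_add (g a)).hasDerivWithinAt
  rw [hkeq t ht] at h1
  refine h1.congr (fun s hs => ?_) ?_
  all_goals
    rw [hg _ (by assumption)]
    congr 1
    refine intervalIntegral.integral_congr fun r hr => (hkeq r ?_).symm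
    rw [uIcc_of_le (by first | exact hs.1 | exact ht.1)] at hr
  · exact ⟨hr.1, hr.2.trans hs.2⟩
  · exact ⟨hr.1, hr.2.trans ht.2⟩

theorem intervalIntegrable_of_continuousOn_Icc {g : ℝ → F} {a b s t : ℝ}
    (hg : ContinuousOn g (Icc a b)) (hs : s ∈ Icc a b) (ht : t ∈ Icc a b) :
    IntervalIntegrable g volume s t :=
  (hg.mono (ordConnected_Icc.uIcc_subset hs ht)).intervalIntegrable

/-- Monotonicity in the domain of the integral of a nonnegative continuous function. -/
theorem integral_mono_of_Icc_subset {g : ℝ → ℝ} {a b s t : ℝ} (hg : ContinuousOn g (Icc a b))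
    (h0 : ∀ r ∈ Icc a b, 0 ≤ g r) (hs : a ≤ s) (hst : s ≤ t) (ht : t ≤ b) :
    ∫ r in s..t, g r ≤ ∫ r in a..b, g r := by
  have hab : a ≤ b := hs.trans (hst.trans ht)
  refine intervalIntegral.integral_mono_interval hs hst ht ?_
    (intervalIntegrable_of_continuousOn_Icc hg (left_mem_Icc.2 hab) (right_mem_Icc.2 hab))
  refine (ae_restrict_mem measurableSet_Ioc).mono fun r hr => h0 r (Ioc_subset_Icc_self hr)

theorem integral_nonneg_Icc {g : ℝ → ℝ} {a b : ℝ} (hab : a ≤ b)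
    (h : ∀ t ∈ Icc a b, 0 ≤ g t) : 0 ≤ ∫ t in a..b, g t :=
  intervalIntegral.integral_nonneg hab h

theorem integral_mono_Icc {g h : ℝ → ℝ} {a b : ℝ} (hab : a ≤ b)
    (hg : ContinuousOn g (Icc a b)) (hh : ContinuousOn h (Icc a b))
    (hgh : ∀ t ∈ Icc a b, g t ≤ h t) : ∫ t in a..b, g t ≤ ∫ t in a..b, h t :=
  intervalIntegral.integral_mono_on hab
    (intervalIntegrable_of_continuousOn_Icc hg (left_mem_Icc.2 hab) (right_mem_Icc.2 hab))
    (intervalIntegrable_of_continuousOn_Icc hh (left_mem_Icc.2 hab) (right_mem_Icc.2 hab)) hgh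

theorem integral_add_Icc {φ ψ : ℝ → ℝ} {a b : ℝ} (hab : a ≤ b)
    (hφ : ContinuousOn φ (Icc a b)) (hψ : ContinuousOn ψ (Icc a b)) :
    ∫ t in a..b, (φ t + ψ t) = (∫ t in a..b, φ t) + ∫ t in a..b, ψ t :=
  intervalIntegral.integral_add
    (intervalIntegrable_of_continuousOn_Icc hφ (left_mem_Icc.2 hab) (right_mem_Icc.2 hab))
    (intervalIntegrable_of_continuousOn_Icc hψ (left_mem_Icc.2 hab) (right_mem_Icc.2 hab))

theorem integral_le_of_le_linear {φ ψ χ : ℝ → ℝ} {a b c d : ℝ} (hab : a ≤ b)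
    (hφ : ContinuousOn φ (Icc a b)) (hψ : ContinuousOn ψ (Icc a b)) (hχ : ContinuousOn χ (Icc a b))
    (h : ∀ t ∈ Icc a b, φ t ≤ c * ψ t + d * χ t) :
    ∫ t in a..b, φ t ≤ c * (∫ t in a..b, ψ t) + d * ∫ t in a..b, χ t := by
  have hii : ∀ {g : ℝ → ℝ}, ContinuousOn g (Icc a b) → IntervalIntegrable g volume a b := fun hg =>
    intervalIntegrable_of_continuousOn_Icc hg (left_mem_Icc.2 hab) (right_mem_Icc.2 hab)
  refine (integral_mono_Icc (h := fun t => c * ψ t + d * χ t) hab hφ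
    ((continuousOn_const.mul hψ).add (continuousOn_const.mul hχ)) h).trans_eq ?_
  rw [intervalIntegral.integral_add ((hii hψ).const_mul c) ((hii hχ).const_mul d),
    intervalIntegral.integral_const_mul, intervalIntegral.integral_const_mul]

theorem integral_le_of_le_affine {φ ψ : ℝ → ℝ} {a b c d : ℝ} (hab : a ≤ b)
    (hφ : ContinuousOn φ (Icc a b)) (hψ : ContinuousOn ψ (Icc a b))
    (h : ∀ t ∈ Icc a b, φ t ≤ c * ψ t + d) :
    ∫ t in a..b, φ t ≤ c * (∫ t in a..b, ψ t) + d * (b - a) := by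
  simpa using integral_le_of_le_linear (χ := fun _ => 1) (d := d) hab hφ hψ continuousOn_const
    (by simpa using h)

end Calculus

variable {E : Type*} [NormedAddCommGroup E] [InnerProductSpace ℝ E]

/-! ### Resolvent regularisation -/

/-- The resolvent `(S + 1/(m+1))⁻¹`. -/
noncomputable def res (S : E →L[ℝ] E) (m : ℕ) : E →L[ℝ] E :=
  Ring.inverse (S + ((1 : ℝ) / (m + 1)) • (1 : E →L[ℝ] E))

/-- The regularising contraction `S (S + 1/(m+1))⁻¹`, which tends to the identity strongly. -/
noncomputable def reg (S : E →L[ℝ] E) (m : ℕ) : E →L[ℝ] E := S * res S m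

variable [CompleteSpace E] {S : E →L[ℝ] E}

/-- Lax–Milgram: positivity of `S` makes the form of `S + ε` coercive with constant `ε`. -/
theorem isUnit_add_smul_one (hS : S.IsPositive) {ε : ℝ} (hε : 0 < ε) :
    IsUnit (S + ε • (1 : E →L[ℝ] E)) := by
  refine ContinuousLinearMap.isUnit_of_forall_le_norm_inner_map _ (c := ⟨ε, hε.le⟩) hε fun x => ?_
  have h1 : (0 : ℝ) ≤ ⟪S x, x⟫ := hS.inner_nonneg_left x
  have : ⟪(S + ε • (1 : E →L[ℝ] E)) x, x⟫ = ⟪S x, x⟫ + ε * ‖x‖ ^ 2 := by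
    simp [inner_add_left, inner_smul_left]
  rw [this, Real.norm_of_nonneg (by positivity)]
  change ‖x‖ ^ 2 * ε ≤ _
  linarith

theorem add_smul_res (hS : S.IsPositive) (m : ℕ) (x : E) :
    S (res S m x) + ((1 : ℝ) / (m + 1)) • res S m x = x := by
  have h := Ring.mul_inverse_cancel _ (isUnit_add_smul_one hS (Nat.one_div_pos_of_nat (n := m)))
  simpa [res] using congr($h x)

theorem res_add_smul (hS : S.IsPositive) (m : ℕ) (x : E) :
    res S m (S x) + ((1 : ℝ) / (m + 1)) • res S m x = x := by
  have h := Ring.inverse_mul_cancel _ (isUnit_add_smul_one hS (Nat.one_div_pos_of_nat (n := m)))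
  simpa [res] using congr($h x)

theorem res_comm (hS : S.IsPositive) (m : ℕ) (x : E) : res S m (S x) = S (res S m x) := by
  have h1 := add_smul_res hS m x
  have h2 := res_add_smul hS m x
  exact add_right_cancel (h2.trans h1.symm)

theorem reg_apply (m : ℕ) (x : E) : reg S m x = S (res S m x) := rfl

/-- With ε = 1/(m+1) and y = (S + ε)⁻¹x one has |x|² = |Sy|² + 2ε⟨Sy, y⟩ + |εy|², and every term is
nonnegative. -/
theorem norm_reg_le (hS : S.IsPositive) (m : ℕ) (x : E) : ‖reg S m x‖ ≤ ‖x‖ := by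
  rw [reg_apply]
  set y := res S m x with hy
  have h1 : (0 : ℝ) ≤ ⟪S y, y⟫ := hS.inner_nonneg_left y
  have hm : (0 : ℝ) < 1 / (m + 1) := Nat.one_div_pos_of_nat
  have h2 : ‖x‖ ^ 2 = ‖S y‖ ^ 2 + 2 * ((1 : ℝ) / (m + 1) * ⟪S y, y⟫)
      + ‖((1 : ℝ) / (m + 1)) • y‖ ^ 2 := by
    conv_lhs => rw [← add_smul_res hS m x, norm_add_sq_real]
    rw [inner_smul_right]
  refine (sq_le_sq₀ (norm_nonneg _) (norm_nonneg _)).1 ?_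
  rw [h2]
  have h3 := mul_nonneg hm.le h1
  have h4 := sq_nonneg ‖((1 : ℝ) / (m + 1)) • y‖
  linarith

/-- On the range of `S` the error is explicit, Sz - J(Sz) = εJz for the contraction J = `reg S m`
and ε = 1/(m+1). Together with density of the range this gives strong convergence in `tendsto_reg`.
-/
theorem norm_map_sub_reg_map_le (hS : S.IsPositive) (m : ℕ) (z : E) :
    ‖S z - reg S m (S z)‖ ≤ 1 / (m + 1) * ‖z‖ := by
  have h := add_smul_res hS m (S z)
  have : S z - reg S m (S z) = ((1 : ℝ) / (m + 1)) • reg S m z := by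
    rw [sub_eq_iff_eq_add, reg_apply, reg_apply, ← res_comm hS, add_comm]
    exact h.symm.trans (by rw [res_comm hS])
  rw [this, norm_smul, Real.norm_of_nonneg (by positivity)]
  gcongr
  exact norm_reg_le hS m z

/-- A vector x orthogonal to the range satisfies |Sx|² = ⟨S(Sx), x⟩ = 0. -/
theorem denseRange_of_isPositive (hS : S.IsPositive) (hinj : Function.Injective S) :
    DenseRange S := by
  have h : (LinearMap.range S.toLinearMap).topologicalClosure = ⊤ := by
    rw [Submodule.topologicalClosure_eq_top_iff, Submodule.eq_bot_iff]
    intro x hx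
    rw [Submodule.mem_orthogonal] at hx
    have h1 : S x = 0 := by
      have := hx (S (S x)) ⟨S x, rfl⟩
      rw [hS.inner_left_eq_inner_right] at this
      exact inner_self_eq_zero.1 this
    exact hinj (h1.trans (map_zero S).symm)
  intro x
  have : x ∈ closure ((LinearMap.range S.toLinearMap : Submodule ℝ E) : Set E) := by
    rw [← Submodule.topologicalClosure_coe, h]; trivial
  rwa [LinearMap.coe_range] at this

theorem tendsto_reg (hS : S.IsPositive) (hinj : Function.Injective S) (x : E) :
    Tendsto (fun m => reg S m x) atTop (𝓝 x) := by
  rw [Metric.tendsto_atTop]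
  intro ε hε
  obtain ⟨z, hz⟩ := (denseRange_of_isPositive hS hinj).exists_dist_lt x (show 0 < ε / 3 by positivity)
  have h0 : Tendsto (fun m : ℕ => (1 : ℝ) / (m + 1) * ‖z‖) atTop (𝓝 0) := by
    simpa using tendsto_one_div_add_atTop_nhds_zero_nat.mul_const ‖z‖
  obtain ⟨N, hN⟩ := (h0.eventually_lt_const (show 0 < ε / 3 by positivity)).exists_forall_of_atTop
  refine ⟨N, fun m hm => ?_⟩
  have h1 := norm_map_sub_reg_map_le hS m z
  have h2 := hN m hm
  have h3 := norm_reg_le hS m (x - S z)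
  rw [dist_eq_norm] at hz ⊢
  have : reg S m x - x = reg S m (x - S z) - (S z - reg S m (S z)) - (x - S z) := by
    simp
  rw [this]
  calc _ ≤ ‖reg S m (x - S z)‖ + ‖S z - reg S m (S z)‖ + ‖x - S z‖ :=
        (norm_sub_le _ _).trans (add_le_add_left (norm_sub_le _ _) _)
    _ < ε := by linarith

/-! ### Reduced solutions -/

/-- The energy of a pair `(A^{1/2} w, w')`. -/
noncomputable def en (x v : E) : ℝ := (1 / 2) * (‖x‖ ^ 2 + ‖v‖ ^ 2)

/-- `(x, v) = (A^{1/2} w, w')` for a finite energy solution of `w'' + A w = f` on `[a, b]`, where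
`S = A^{-1/2}`. -/
structure RedSol (S : E →L[ℝ] E) (a b : ℝ) (x v f : ℝ → E) : Prop where
  cont_x : ContinuousOn x (Icc a b)
  cont_v : ContinuousOn v (Icc a b)
  cont_f : ContinuousOn f (Icc a b)
  deriv_x : ∀ t ∈ Icc a b, HasDerivWithinAt (fun s => S (x s)) (v t) (Icc a b) t
  deriv_v : ∀ t ∈ Icc a b, HasDerivWithinAt (fun s => S (v s)) (S (f t) - x t) (Icc a b) t

theorem en_nonneg (x v : E) : 0 ≤ en x v := by unfold en; positivity

theorem norm_sq_fst_le_en (x v : E) : ‖x‖ ^ 2 ≤ 2 * en x v := by unfold en; nlinarith [sq_nonneg ‖v‖]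

theorem norm_sq_snd_le_en (x v : E) : ‖v‖ ^ 2 ≤ 2 * en x v := by unfold en; nlinarith [sq_nonneg ‖x‖]

theorem en_add_le (x v y w : E) : en (x + y) (v + w) ≤ 2 * (en x v + en y w) := by
  unfold en
  have h1 := norm_add_le x y
  have h2 := norm_add_le v w
  have h3 : ‖x + y‖ ^ 2 ≤ (‖x‖ + ‖y‖) ^ 2 := by gcongr
  have h4 : ‖v + w‖ ^ 2 ≤ (‖v‖ + ‖w‖) ^ 2 := by gcongr
  nlinarith [sq_nonneg (‖x‖ - ‖y‖), sq_nonneg (‖v‖ - ‖w‖)]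

namespace RedSol

variable {a b : ℝ} {x v f y w g : ℝ → E}

theorem cont_en (h : RedSol S a b x v f) : ContinuousOn (fun t => en (x t) (v t)) (Icc a b) := by
  unfold en
  exact continuousOn_const.mul ((h.cont_x.norm.pow 2).add (h.cont_v.norm.pow 2))

theorem cont_norm_sq_f (h : RedSol S a b x v f) :
    ContinuousOn (fun t => ‖f t‖ ^ 2) (Icc a b) :=
  h.cont_f.norm.pow 2

theorem cont_norm_sq_map (h : RedSol S a b x v f) (P : E →L[ℝ] E) :
    ContinuousOn (fun t => ‖P (v t)‖ ^ 2) (Icc a b) :=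
  (P.continuous.comp_continuousOn h.cont_v).norm.pow 2

theorem mono (h : RedSol S a b x v f) {c d : ℝ} (hc : a ≤ c) (hd : d ≤ b) :
    RedSol S c d x v f := by
  have hs : Icc c d ⊆ Icc a b := Icc_subset_Icc hc hd
  exact ⟨h.cont_x.mono hs, h.cont_v.mono hs, h.cont_f.mono hs,
    fun t ht => (h.deriv_x t (hs ht)).mono hs, fun t ht => (h.deriv_v t (hs ht)).mono hs⟩

theorem sub (h : RedSol S a b x v f) (k : RedSol S a b y w g) :
    RedSol S a b (fun t => x t - y t) (fun t => v t - w t) (fun t => f t - g t) := by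
  refine ⟨h.cont_x.sub k.cont_x, h.cont_v.sub k.cont_v, h.cont_f.sub k.cont_f, fun t ht => ?_,
    fun t ht => ?_⟩
  · simpa using (h.deriv_x t ht).fun_sub (k.deriv_x t ht)
  · have := (h.deriv_v t ht).fun_sub (k.deriv_v t ht)
    simp only [map_sub]
    convert this using 1
    abel

theorem shift (h : RedSol S a b x v f) (c : ℝ) :
    RedSol S (a - c) (b - c) (fun t => x (t + c)) (fun t => v (t + c)) (fun t => f (t + c)) := by
  have hm : MapsTo (fun t : ℝ => t + c) (Icc (a - c) (b - c)) (Icc a b) := fun t ht =>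
    ⟨by linarith [ht.1], by linarith [ht.2]⟩
  have hc : ContinuousOn (fun t : ℝ => t + c) (Icc (a - c) (b - c)) := by fun_prop
  have key : ∀ {φ : ℝ → E} {φ' : E} {t : ℝ}, t ∈ Icc (a - c) (b - c) →
      HasDerivWithinAt φ φ' (Icc a b) (t + c) →
      HasDerivWithinAt (fun s => φ (s + c)) φ' (Icc (a - c) (b - c)) t := by
    intro φ φ' t ht hφ
    have := HasDerivWithinAt.scomp t hφ ((hasDerivWithinAt_id t _).add_const c) hm
    simpa [Function.comp_def] using this
  exact ⟨h.cont_x.comp hc hm, h.cont_v.comp hc hm, h.cont_f.comp hc hm,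
    fun t ht => key ht (h.deriv_x _ (hm ht)), fun t ht => key ht (h.deriv_v _ (hm ht))⟩

/-- In a reduced solution only `S x` and `S v` are differentiable. Applying the resolvent, which
commutes with `S`, gives true derivatives of the regularised `x` and `v`. -/
theorem hasDeriv_res_x (hS : S.IsPositive) (h : RedSol S a b x v f) (m : ℕ) {t : ℝ}
    (ht : t ∈ Icc a b) :
    HasDerivWithinAt (fun s => reg S m (x s)) (res S m (v t)) (Icc a b) t := by
  have := (res S m).hasFDerivAt.comp_hasDerivWithinAt t (h.deriv_x t ht)
  simpa [Function.comp_def, res_comm hS, reg_apply] using this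

theorem hasDeriv_res_v (hS : S.IsPositive) (h : RedSol S a b x v f) (m : ℕ) {t : ℝ}
    (ht : t ∈ Icc a b) :
    HasDerivWithinAt (fun s => reg S m (v s)) (reg S m (f t) - res S m (x t)) (Icc a b) t := by
  have := (res S m).hasFDerivAt.comp_hasDerivWithinAt t (h.deriv_v t ht)
  simpa [Function.comp_def, res_comm hS, reg_apply] using this

/-- The integrated polarised energy identity. -/
theorem pairing_eq (hS : S.IsPositive) (hinj : Function.Injective S) (h : RedSol S a b x v f)
    (k : RedSol S a b y w g) {t : ℝ} (ht : t ∈ Icc a b) :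
    ⟪x t, y t⟫ + ⟪v t, w t⟫ = ⟪x a, y a⟫ + ⟪v a, w a⟫
      + ∫ s in a..t, (⟪f s, w s⟫ + ⟪v s, g s⟫) := by
  have hab : a ≤ b := ht.1.trans ht.2
  have hsub : Icc a t ⊆ Icc a b := Icc_subset_Icc le_rfl ht.2
  have hJ : ∀ {φ : ℝ → E}, ContinuousOn φ (Icc a b) → ∀ m,
      ContinuousOn (fun s => reg S m (φ s)) (Icc a b) := fun hφ m =>
    (reg S m).continuous.comp_continuousOn hφ
  -- The identity is first proved for the regularised pairs, where the product rule applies and the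
  -- terms coming from A cancel by symmetry of `S`. The passage to the limit is by dominated
  -- convergence, as `reg S m` is a contraction.
  have e1 : ∀ m, ⟪reg S m (x t), reg S m (y t)⟫ + ⟪reg S m (v t), reg S m (w t)⟫
      = ⟪reg S m (x a), reg S m (y a)⟫ + ⟪reg S m (v a), reg S m (w a)⟫
      + ∫ s in a..t, (⟪reg S m (f s), reg S m (w s)⟫ + ⟪reg S m (v s), reg S m (g s)⟫) := by
    intro m
    have := integral_eq_sub_of_hasDerivWithinAt_Icc (a := a) (b := t)
      (g := fun s => ⟪reg S m (x s), reg S m (y s)⟫ + ⟪reg S m (v s), reg S m (w s)⟫)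
      (g' := fun s => ⟪reg S m (f s), reg S m (w s)⟫ + ⟪reg S m (v s), reg S m (g s)⟫) ht.1
      (fun s hs => ?_) ?_
    · rw [this]; ring
    · have hs' := hsub hs
      have d := ((h.hasDeriv_res_x hS m hs').inner ℝ (k.hasDeriv_res_x hS m hs')).fun_add
        ((h.hasDeriv_res_v hS m hs').inner ℝ (k.hasDeriv_res_v hS m hs'))
      refine (d.mono hsub).congr_deriv ?_
      simp only [inner_sub_left, inner_sub_right, reg_apply]
      have q1 : ⟪S (res S m (x s)), res S m (w s)⟫ = ⟪res S m (x s), S (res S m (w s))⟫ :=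
        hS.inner_left_eq_inner_right _ _
      have q2 : ⟪res S m (v s), S (res S m (y s))⟫ = ⟪S (res S m (v s)), res S m (y s)⟫ :=
        (hS.inner_left_eq_inner_right _ _).symm
      rw [q1, q2]
      ring
    · exact (((hJ h.cont_f m).inner (𝕜 := ℝ) (hJ k.cont_v m)).add
        ((hJ h.cont_v m).inner (𝕜 := ℝ) (hJ k.cont_f m))).mono hsub
  have T := tendsto_reg hS hinj
  have l1 := ((T (x t)).inner (𝕜 := ℝ) (T (y t))).add ((T (v t)).inner (𝕜 := ℝ) (T (w t)))
  have l2 := ((T (x a)).inner (𝕜 := ℝ) (T (y a))).add ((T (v a)).inner (𝕜 := ℝ) (T (w a)))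
  have l3 : Tendsto (fun m => ∫ s in a..t, (⟪reg S m (f s), reg S m (w s)⟫
      + ⟪reg S m (v s), reg S m (g s)⟫)) atTop
      (𝓝 (∫ s in a..t, (⟪f s, w s⟫ + ⟪v s, g s⟫))) := by
    refine intervalIntegral.tendsto_integral_filter_of_dominated_convergence
      (fun s => ‖f s‖ * ‖w s‖ + ‖v s‖ * ‖g s‖) (Eventually.of_forall fun m => ?_)
      (Eventually.of_forall fun m => Eventually.of_forall fun s _ => ?_) ?_
      (Eventually.of_forall fun s _ => ?_)
    · exact (intervalIntegrable_of_continuousOn_Icc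
        (((hJ h.cont_f m).inner (𝕜 := ℝ) (hJ k.cont_v m)).add
        ((hJ h.cont_v m).inner (𝕜 := ℝ) (hJ k.cont_f m))) (left_mem_Icc.2 hab) ht).def'.aestronglyMeasurable
    · refine (norm_add_le _ _).trans (add_le_add ?_ ?_)
      all_goals
        refine (norm_inner_le_norm _ _).trans ?_
        gcongr <;> exact norm_reg_le hS m _
    · exact intervalIntegrable_of_continuousOn_Icc ((h.cont_f.norm.mul k.cont_v.norm).add
        (h.cont_v.norm.mul k.cont_f.norm)) (left_mem_Icc.2 hab) ht
    · exact ((T (f s)).inner (𝕜 := ℝ) (T (w s))).add ((T (v s)).inner (𝕜 := ℝ) (T (g s)))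
  refine tendsto_nhds_unique l1 ?_
  simp_rw [e1]
  exact l2.add l3

theorem hasDeriv_pairing (hS : S.IsPositive) (hinj : Function.Injective S)
    (h : RedSol S a b x v f) (k : RedSol S a b y w g) {t : ℝ} (ht : t ∈ Icc a b) :
    HasDerivWithinAt (fun t => ⟪x t, y t⟫ + ⟪v t, w t⟫) (⟪f t, w t⟫ + ⟪v t, g t⟫) (Icc a b) t := by
  refine hasDerivWithinAt_Icc_of_eq_integral
    (g := fun t => ⟪x t, y t⟫ + ⟪v t, w t⟫) (g' := fun t => ⟪f t, w t⟫ + ⟪v t, g t⟫) ?_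
    (fun s hs => pairing_eq hS hinj h k hs) t ht
  exact (h.cont_f.inner (𝕜 := ℝ) k.cont_v).add (h.cont_v.inner (𝕜 := ℝ) k.cont_f)

theorem hasDeriv_en (hS : S.IsPositive) (hinj : Function.Injective S)
    (h : RedSol S a b x v f) {t : ℝ} (ht : t ∈ Icc a b) :
    HasDerivWithinAt (fun t => en (x t) (v t)) ⟪f t, v t⟫ (Icc a b) t := by
  have := (h.hasDeriv_pairing hS hinj h ht).const_mul (1 / 2)
  simp only [real_inner_self_eq_norm_sq, real_inner_comm (v t) (f t)] at this
  refine this.congr_deriv ?_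
  rw [real_inner_comm]; ring

theorem en_sub_eq (hS : S.IsPositive) (hinj : Function.Injective S)
    (h : RedSol S a b x v f) {s t : ℝ} (hs : s ∈ Icc a b) (ht : t ∈ Icc a b) :
    en (x t) (v t) - en (x s) (v s) = ∫ r in s..t, ⟪f r, v r⟫ := by
  have key : ∀ r ∈ Icc a b, ∫ q in a..r, ⟪f q, v q⟫ = en (x r) (v r) - en (x a) (v a) := by
    intro r hr
    have hsub : Icc a r ⊆ Icc a b := Icc_subset_Icc le_rfl hr.2
    exact integral_eq_sub_of_hasDerivWithinAt_Icc (g := fun t => en (x t) (v t)) hr.1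
      (fun q hq => (h.hasDeriv_en hS hinj (hsub hq)).mono hsub)
      ((h.cont_f.inner (𝕜 := ℝ) h.cont_v).mono hsub)
  have hab : a ≤ b := hs.1.trans hs.2
  have hi : ∀ r ∈ Icc a b, IntervalIntegrable (fun q => ⟪f q, v q⟫) volume a r := fun r hr =>
    intervalIntegrable_of_continuousOn_Icc (h.cont_f.inner (𝕜 := ℝ) h.cont_v) (left_mem_Icc.2 hab) hr
  rw [← intervalIntegral.integral_interval_sub_left (hi t ht) (hi s hs), key t ht, key s hs]
  ring

theorem en_eq_of_free (hS : S.IsPositive) (hinj : Function.Injective S)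
    (h : RedSol S a b x v fun _ => 0) {s t : ℝ} (hs : s ∈ Icc a b) (ht : t ∈ Icc a b) :
    en (x t) (v t) = en (x s) (v s) := by
  have := h.en_sub_eq hS hinj hs ht
  simp at this
  linarith

/-- The energy at one time controls the energy at any other time, up to the source. -/
theorem en_le (hS : S.IsPositive) (hinj : Function.Injective S)
    (h : RedSol S a b x v f) {s t : ℝ} (hs : s ∈ Icc a b) (ht : t ∈ Icc a b) :
    en (x t) (v t) ≤ 2 * en (x s) (v s) + 2 * ((b - a) * ∫ r in a..b, ‖f r‖ ^ 2) := by
  have hab : a ≤ b := hs.1.trans hs.2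
  have hf0 : 0 ≤ ∫ r in a..b, ‖f r‖ ^ 2 := integral_nonneg_Icc hab fun _ _ => by positivity
  rcases hab.eq_or_lt with rfl | hlt
  · have h1 : s = a := le_antisymm hs.2 hs.1
    have h2 : t = a := le_antisymm ht.2 ht.1
    rw [h1, h2]
    simp only [intervalIntegral.integral_same, mul_zero, add_zero]
    linarith [en_nonneg (x a) (v a)]
  -- At a time `q` of maximal energy, Young's inequality with weight L = b - a bounds the work of
  -- the source by L∫|f|² plus half the maximal energy, and that half is absorbed.
  obtain ⟨q, hq, hmax⟩ := isCompact_Icc.exists_isMaxOn ⟨s, hs⟩ h.cont_en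
  have hmax' : ∀ r ∈ Icc a b, en (x r) (v r) ≤ en (x q) (v q) := fun r hr => hmax hr
  set L := b - a with hL
  have hLpos : 0 < L := sub_pos.2 hlt
  have h1 := h.en_sub_eq hS hinj hs hq
  have hbound : ∀ r ∈ Icc a b, ‖⟪f r, v r⟫‖ ≤ L * ‖f r‖ ^ 2 + en (x q) (v q) / (2 * L) := by
    intro r hr
    have e1 : ‖⟪f r, v r⟫‖ ≤ ‖f r‖ * ‖v r‖ := norm_inner_le_norm _ _
    have e2 := norm_sq_snd_le_en (x r) (v r)
    have e3 := hmax' r hr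
    have e4 : ‖f r‖ * ‖v r‖ ≤ L * ‖f r‖ ^ 2 + ‖v r‖ ^ 2 / (4 * L) := by
      have := sq_nonneg (2 * L * ‖f r‖ - ‖v r‖)
      rw [← sub_nonneg]
      have e5 : L * ‖f r‖ ^ 2 + ‖v r‖ ^ 2 / (4 * L) - ‖f r‖ * ‖v r‖
        = (2 * L * ‖f r‖ - ‖v r‖) ^ 2 / (4 * L) := by field_simp; ring
      rw [e5]; positivity
    have e6 : ‖v r‖ ^ 2 / (4 * L) ≤ en (x q) (v q) / (2 * L) := by
      rw [div_le_div_iff₀ (by positivity) (by positivity)]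
      nlinarith
    linarith
  have hcf : ContinuousOn (fun r => L * ‖f r‖ ^ 2 + en (x q) (v q) / (2 * L)) (Icc a b) :=
    (continuousOn_const.mul (h.cont_f.norm.pow 2)).add continuousOn_const
  have h2 : ∫ r in s..q, ⟪f r, v r⟫ ≤ ∫ r in a..b, (L * ‖f r‖ ^ 2 + en (x q) (v q) / (2 * L)) := by
    refine (le_abs_self _).trans ?_
    have h3 : |∫ r in s..q, ⟪f r, v r⟫| ≤ ∫ r in (min s q)..(max s q), ‖⟪f r, v r⟫‖ := by
      rw [← Real.norm_eq_abs]
      refine (intervalIntegral.norm_integral_le_integral_norm_uIoc).trans ?_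
      rw [intervalIntegral.integral_of_le min_le_max]; rfl
    refine h3.trans ((integral_mono_of_Icc_subset (h.cont_f.inner (𝕜 := ℝ) h.cont_v).norm
      (fun _ _ => norm_nonneg _) (le_min hs.1 hq.1) min_le_max (max_le hs.2 hq.2)).trans ?_)
    exact integral_mono_Icc hab (h.cont_f.inner (𝕜 := ℝ) h.cont_v).norm hcf hbound
  have h4 : ∫ r in a..b, (L * ‖f r‖ ^ 2 + en (x q) (v q) / (2 * L))
      = L * (∫ r in a..b, ‖f r‖ ^ 2) + en (x q) (v q) / 2 := by
    rw [intervalIntegral.integral_add, intervalIntegral.integral_const_mul,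
      intervalIntegral.integral_const]
    · rw [smul_eq_mul, ← hL]; field_simp
    · exact (intervalIntegrable_of_continuousOn_Icc (h.cont_f.norm.pow 2)
        (left_mem_Icc.2 hab) (right_mem_Icc.2 hab)).const_mul _
    · simp
  have h5 := hmax' t ht
  linarith

end RedSol

end Cascade

namespace Cascade

variable {E : Type*} [NormedAddCommGroup E] [InnerProductSpace ℝ E] [CompleteSpace E]
  {S : E →L[ℝ] E}

/-! ### Existence of free solutions -/

/-- A free solution in reduced form, for all times. -/
structure FreeSol (S : E →L[ℝ] E) (x v : ℝ → E) : Prop where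
  cont_x : Continuous x
  cont_v : Continuous v
  deriv_x : ∀ t, HasDerivAt (fun s => S (x s)) (v t) t
  deriv_v : ∀ t, HasDerivAt (fun s => S (v s)) (-x t) t

namespace FreeSol

variable {x v y w : ℝ → E}

theorem redSol (h : FreeSol S x v) (a b : ℝ) : RedSol S a b x v fun _ => 0 :=
  ⟨h.cont_x.continuousOn, h.cont_v.continuousOn, continuousOn_const,
    fun t _ => (h.deriv_x t).hasDerivWithinAt,
    fun t _ => by simpa using (h.deriv_v t).hasDerivWithinAt⟩

theorem add (h : FreeSol S x v) (k : FreeSol S y w) :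
    FreeSol S (fun t => x t + y t) (fun t => v t + w t) := by
  refine ⟨h.cont_x.add k.cont_x, h.cont_v.add k.cont_v, fun t => ?_, fun t => ?_⟩
  · simpa using (h.deriv_x t).fun_add (k.deriv_x t)
  · have := (h.deriv_v t).fun_add (k.deriv_v t)
    simp only [map_add]
    convert this using 1
    abel

theorem smul (c : ℝ) (h : FreeSol S x v) : FreeSol S (fun t => c • x t) (fun t => c • v t) := by
  refine ⟨h.cont_x.const_smul c, h.cont_v.const_smul c, fun t => ?_, fun t => ?_⟩
  · simpa using (h.deriv_x t).fun_const_smul c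
  · simpa using (h.deriv_v t).fun_const_smul c

theorem sub (h : FreeSol S x v) (k : FreeSol S y w) :
    FreeSol S (fun t => x t - y t) (fun t => v t - w t) := by
  simpa [sub_eq_add_neg] using h.add (k.smul (-1))

theorem en_eq (hS : S.IsPositive) (hinj : Function.Injective S) (h : FreeSol S x v) (t : ℝ) :
    en (x t) (v t) = en (x 0) (v 0) :=
  (h.redSol (min 0 t) (max 0 t)).en_eq_of_free hS hinj ⟨min_le_left _ _, le_max_left _ _⟩
    ⟨min_le_right _ _, le_max_right _ _⟩

end FreeSol

/-- The initial data of free solutions. -/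
def freeData (S : E →L[ℝ] E) : Submodule ℝ (E × E) where
  carrier := {z | ∃ x v, FreeSol S x v ∧ x 0 = z.1 ∧ v 0 = z.2}
  zero_mem' := ⟨fun _ => 0, fun _ => 0, ⟨continuous_const, continuous_const,
    fun t => by simpa using hasDerivAt_const t (0 : E),
    fun t => by simpa using hasDerivAt_const t (0 : E)⟩, rfl, rfl⟩
  add_mem' := by
    rintro z z' ⟨x, v, h, hx, hv⟩ ⟨y, w, k, hy, hw⟩
    exact ⟨_, _, h.add k, by simp [hx, hy], by simp [hv, hw]⟩
  smul_mem' := by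
    rintro c z ⟨x, v, h, hx, hv⟩
    exact ⟨_, _, h.smul c, by simp [hx], by simp [hv]⟩

/-- Conservation of energy bounds differences of solutions at all times by differences of their
data. Convergent data thus give uniformly convergent solutions, and the derivatives of `S x` and `S
v` converge uniformly as well. -/
theorem isClosed_freeData (hS : S.IsPositive) (hinj : Function.Injective S) :
    IsClosed (freeData S : Set (E × E)) := by
  refine IsSeqClosed.isClosed fun z z₀ hz hlim => ?_
  choose x v hsol hx hv using hz
  have hc : CauchySeq z := hlim.cauchySeq
  have hnorm : ∀ k l t, ‖x k t - x l t‖ ≤ 2 * ‖z k - z l‖ ∧ ‖v k t - v l t‖ ≤ 2 * ‖z k - z l‖ := by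
    intro k l t
    have h1 := ((hsol k).sub (hsol l)).en_eq hS hinj t
    simp only [hx, hv] at h1
    have h2 : ‖(z k).1 - (z l).1‖ ≤ ‖z k - z l‖ := norm_fst_le (z k - z l)
    have h3 : ‖(z k).2 - (z l).2‖ ≤ ‖z k - z l‖ := norm_snd_le (z k - z l)
    have h4 : en ((z k).1 - (z l).1) ((z k).2 - (z l).2) ≤ ‖z k - z l‖ ^ 2 := by
      unfold en
      have := pow_le_pow_left₀ (norm_nonneg _) h2 2
      have := pow_le_pow_left₀ (norm_nonneg _) h3 2
      linarith
    have h5 := norm_sq_fst_le_en (x k t - x l t) (v k t - v l t)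
    have h6 := norm_sq_snd_le_en (x k t - x l t) (v k t - v l t)
    constructor
    · refine (sq_le_sq₀ (norm_nonneg _) (by positivity)).1 ?_
      nlinarith [sq_nonneg ‖z k - z l‖]
    · refine (sq_le_sq₀ (norm_nonneg _) (by positivity)).1 ?_
      nlinarith [sq_nonneg ‖z k - z l‖]
  have hunif : ∀ {φ : ℕ → ℝ → E}, (∀ k l t, ‖φ k t - φ l t‖ ≤ 2 * ‖z k - z l‖) →
      ∃ ψ, TendstoUniformly φ ψ atTop := by
    intro φ hφ
    have hu : UniformCauchySeqOn φ atTop univ := by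
      rw [Metric.uniformCauchySeqOn_iff]
      intro ε hε
      obtain ⟨N, hN⟩ := Metric.cauchySeq_iff.1 hc (ε / 2) (by positivity)
      refine ⟨N, fun m hm n hn t _ => ?_⟩
      have h1 := hφ m n t
      have h2 := hN m hm n hn
      rw [dist_eq_norm] at h2 ⊢
      linarith
    have hp : ∀ t, ∃ y, Tendsto (fun k => φ k t) atTop (𝓝 y) := fun t =>
      cauchySeq_tendsto_of_complete (hu.cauchySeq (mem_univ t))
    choose ψ hψ using hp
    exact ⟨ψ, tendstoUniformlyOn_univ.1 (hu.tendstoUniformlyOn_of_tendsto fun t _ => hψ t)⟩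
  obtain ⟨X, hX⟩ := hunif fun k l t => (hnorm k l t).1
  obtain ⟨V, hV⟩ := hunif fun k l t => (hnorm k l t).2
  have hX' : TendstoUniformly (fun k t => -x k t) (fun t => -X t) atTop := hX.neg
  refine ⟨X, V, ⟨hX.continuous (.of_forall fun k => (hsol k).cont_x),
    hV.continuous (.of_forall fun k => (hsol k).cont_v), ?_, ?_⟩, ?_, ?_⟩
  · exact hasDerivAt_of_tendstoUniformly hV (.of_forall fun k t => (hsol k).deriv_x t)
      fun t => (S.continuous.tendsto _).comp (hX.tendsto_at t)
  · exact hasDerivAt_of_tendstoUniformly hX' (.of_forall fun k t => (hsol k).deriv_v t)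
      fun t => (S.continuous.tendsto _).comp (hV.tendsto_at t)
  · refine tendsto_nhds_unique (hX.tendsto_at 0) ?_
    simp only [hx]
    exact (continuous_fst.tendsto _).comp hlim
  · refine tendsto_nhds_unique (hV.tendsto_at 0) ?_
    simp only [hv]
    exact (continuous_snd.tendsto _).comp hlim

/-- On an eigenvector of `S` with eigenvalue s the frequency is 1/s, and the solutions are explicit
sines and cosines. -/
theorem mem_freeData_of_eigenvector {e : E} {s : ℝ} (hs : s ≠ 0) (he : S e = s • e) :
    (e, (0 : E)) ∈ freeData S ∧ ((0 : E), e) ∈ freeData S := by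
  have hcos : ∀ t : ℝ, HasDerivAt (fun r : ℝ => Real.cos (r / s)) (-Real.sin (t / s) * (1 / s)) t :=
    fun t => ((hasDerivAt_id t).div_const s).cos
  have hsin : ∀ t : ℝ, HasDerivAt (fun r : ℝ => Real.sin (r / s)) (Real.cos (t / s) * (1 / s)) t :=
    fun t => ((hasDerivAt_id t).div_const s).sin
  constructor
  · refine ⟨fun t => Real.cos (t / s) • e, fun t => (-Real.sin (t / s)) • e,
      ⟨by fun_prop, by fun_prop, fun t => ?_, fun t => ?_⟩, by simp, by simp⟩
    · have := (hcos t).smul_const (s • e)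
      simp only [map_smul, he]
      refine this.congr_deriv ?_
      rw [smul_smul]; congr 1; field_simp
    · have := (hsin t).neg.smul_const (s • e)
      simp only [map_smul, he]
      refine this.congr_deriv ?_
      rw [smul_smul, ← neg_smul]; congr 1; field_simp
  · refine ⟨fun t => Real.sin (t / s) • e, fun t => Real.cos (t / s) • e,
      ⟨by fun_prop, by fun_prop, fun t => ?_, fun t => ?_⟩, by simp, by simp⟩
    · have := (hsin t).smul_const (s • e)
      simp only [map_smul, he]
      refine this.congr_deriv ?_
      rw [smul_smul]; congr 1; field_simp
    · have := (hcos t).smul_const (s • e)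
      simp only [map_smul, he]
      refine this.congr_deriv ?_
      rw [smul_smul, ← neg_smul]; congr 1; field_simp

/-- An eigenvector of `S²` is an eigenvector of the positive injective operator `S`. -/
theorem exists_eigenvalue_of_sq (hS : S.IsPositive) (hinj : Function.Injective S) {e : E} {μ : ℝ}
    (he : S (S e) = μ • e) (h0 : e ≠ 0) : ∃ s : ℝ, s ≠ 0 ∧ S e = s • e := by
  have hμ : 0 < μ := by
    have h1 : ⟪S (S e), e⟫ = ‖S e‖ ^ 2 := by
      rw [hS.inner_left_eq_inner_right, real_inner_self_eq_norm_sq]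
    rw [he, inner_smul_left, real_inner_self_eq_norm_sq] at h1
    have h2 : 0 < ‖S e‖ := norm_pos_iff.2 fun h => h0 (hinj (h.trans (map_zero S).symm))
    have h3 : 0 < ‖e‖ := norm_pos_iff.2 h0
    simp only [conj_trivial] at h1
    by_contra hneg
    nlinarith [mul_nonneg (not_lt.1 hneg |> neg_nonneg.2) (sq_nonneg ‖e‖), pow_pos h2 2]
  refine ⟨√μ, (Real.sqrt_pos.2 hμ).ne', ?_⟩
  -- (S + √μ)d = (S² - μ)e = 0, and S + √μ is injective because `S` is nonnegative and √μ is
  -- positive.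
  set d := S e - √μ • e with hd
  have h1 : S d + √μ • d = 0 := by
    simp only [hd, map_sub, map_smul, he, smul_sub, smul_smul, Real.mul_self_sqrt hμ.le]
    abel
  have h2 : ⟪S d, d⟫ + √μ * ‖d‖ ^ 2 = 0 := by
    have := congr(⟪$h1, d⟫)
    rwa [inner_add_left, inner_smul_left, real_inner_self_eq_norm_sq, inner_zero_left] at this
  have h3 : (0 : ℝ) ≤ ⟪S d, d⟫ := hS.inner_nonneg_left d
  have h4 : ‖d‖ ^ 2 = 0 := by
    have := Real.sqrt_pos.2 hμ
    by_contra hne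
    have : 0 < ‖d‖ ^ 2 := lt_of_le_of_ne (by positivity) (Ne.symm hne)
    nlinarith [mul_pos ‹0 < √μ› this]
  exact sub_eq_zero.1 (norm_eq_zero.1 (pow_eq_zero_iff two_ne_zero |>.1 h4))

/-- By the spectral theorem the eigenvectors of the compact self-adjoint operator S² have dense
span. They are eigenvectors of `S`, so they lie in the closed space of data of free solutions, which
is therefore everything. -/
theorem exists_freeSol (hS : S.IsPositive) (hinj : Function.Injective S)
    (hK : IsCompactOperator (S * S : E →L[ℝ] E)) (x₀ v₀ : E) :
    ∃ x v, FreeSol S x v ∧ x 0 = x₀ ∧ v 0 = v₀ := by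
  have hsymm : (S * S : E →L[ℝ] E).IsSymmetric := fun x y => by
    change ⟪S (S x), y⟫ = ⟪x, S (S y)⟫
    rw [hS.inner_left_eq_inner_right, hS.inner_left_eq_inner_right]
  have hbot := ContinuousLinearMap.orthogonalComplement_iSup_eigenspaces_eq_bot hK hsymm
  have hfull : ∀ (N : Submodule ℝ E), IsClosed (N : Set E) →
      (∀ (e : E) (s : ℝ), s ≠ 0 → S e = s • e → e ∈ N) → ∀ x, x ∈ N := by
    intro N hN hmem x
    have hle : (⨆ μ, Module.End.eigenspace ((S * S : E →L[ℝ] E) : Module.End ℝ E) μ) ≤ N := by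
      refine iSup_le fun μ e he => ?_
      rw [Module.End.mem_eigenspace_iff] at he
      by_cases h0 : e = 0
      · rw [h0]; exact N.zero_mem
      · obtain ⟨s, hs, hse⟩ := exists_eigenvalue_of_sq hS hinj (show S (S e) = μ • e from he) h0
        exact hmem e s hs hse
    have htop : N.topologicalClosure = ⊤ := by
      rw [Submodule.topologicalClosure_eq_top_iff, eq_bot_iff, ← hbot]
      exact Submodule.orthogonal_le hle
    rw [hN.submodule_topologicalClosure_eq] at htop
    rw [htop]; trivial
  have hcl := isClosed_freeData hS hinj
  have h1 : (x₀, (0 : E)) ∈ freeData S :=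
    hfull ((freeData S).comap (LinearMap.inl ℝ E E))
      (hcl.preimage (by fun_prop : Continuous fun x : E => (x, (0 : E))))
      (fun e s hs he => (mem_freeData_of_eigenvector hs he).1) x₀
  have h2 : ((0 : E), v₀) ∈ freeData S :=
    hfull ((freeData S).comap (LinearMap.inr ℝ E E))
      (hcl.preimage (by fun_prop : Continuous fun x : E => ((0 : E), x)))
      (fun e s hs he => (mem_freeData_of_eigenvector hs he).2) v₀
  obtain ⟨x, v, h, hx, hv⟩ := (freeData S).add_mem h1 h2
  exact ⟨x, v, h, by simpa using hx, by simpa using hv⟩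

/-! ### From local to global observability -/

/-- Cutting [0, T] into ⌊T/τ⌋ equal pieces gives pieces of length between τ and 2τ. Summing the
local estimates over them yields a constant independent of T. -/
theorem integral_le_of_local {τ C T : ℝ} (hτ : 0 < τ) (hT : τ ≤ T) {e q : ℝ → ℝ}
    (he : ContinuousOn e (Icc 0 T)) (hq : ContinuousOn q (Icc 0 T))
    (hloc : ∀ a b, 0 ≤ a → b ≤ T → τ ≤ b - a → b - a ≤ 2 * τ → ∀ t ∈ Icc a b,
      e t ≤ C * ∫ s in a..b, q s)
    (h0 : ∀ a b, 0 ≤ a → a ≤ b → b ≤ T → 0 ≤ C * ∫ s in a..b, q s) :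
    ∫ t in (0 : ℝ)..T, e t ≤ 2 * τ * C * ∫ t in (0 : ℝ)..T, q t := by
  have hT0 : 0 < T := hτ.trans_le hT
  set N := ⌊T / τ⌋₊ with hN
  have hN1 : 1 ≤ N := Nat.le_floor (by simpa using (one_le_div hτ).2 hT)
  have hN1' : (1 : ℝ) ≤ N := by exact_mod_cast hN1
  have hNle : (N : ℝ) ≤ T / τ := Nat.floor_le (by positivity)
  have hNlt : T / τ < N + 1 := Nat.lt_floor_add_one _
  rw [le_div_iff₀ hτ] at hNle
  rw [div_lt_iff₀ hτ] at hNlt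
  set h := T / N with hh
  have hNpos : (0 : ℝ) < N := by linarith
  have hNh : N * h = T := by rw [hh]; field_simp
  have hτh : τ ≤ h := by rw [hh, le_div_iff₀ hNpos]; linarith
  have hh2 : h ≤ 2 * τ := by rw [hh, div_le_iff₀ hNpos]; nlinarith
  have hmem : ∀ k : ℕ, k ≤ N → (k : ℝ) * h ∈ Icc 0 T := fun k hk => by
    have : (k : ℝ) ≤ N := by exact_mod_cast hk
    exact ⟨by positivity, by rw [← hNh]; gcongr⟩
  have hii : ∀ {φ : ℝ → ℝ}, ContinuousOn φ (Icc 0 T) → ∀ k < N,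
      IntervalIntegrable φ volume (k * h) ((k + 1 : ℕ) * h) := fun hφ k hk =>
    intervalIntegrable_of_continuousOn_Icc hφ (hmem k hk.le) (hmem (k + 1) hk)
  have s1 := intervalIntegral.sum_integral_adjacent_intervals (a := fun k : ℕ => (k : ℝ) * h)
    (hii he)
  have s2 := intervalIntegral.sum_integral_adjacent_intervals (a := fun k : ℕ => (k : ℝ) * h)
    (hii hq)
  simp only [Nat.cast_zero, zero_mul, hNh] at s1 s2
  rw [← s1, ← s2, Finset.mul_sum]
  refine Finset.sum_le_sum fun k hk => ?_
  have hk' := Finset.mem_range.1 hk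
  have m1 := hmem k hk'.le
  have m2 := hmem (k + 1) hk'
  have hd : ((k + 1 : ℕ) : ℝ) * h - k * h = h := by push_cast; ring
  have hle : (k : ℝ) * h ≤ ((k + 1 : ℕ) : ℝ) * h := by linarith
  have hsub : Icc ((k : ℝ) * h) (((k + 1 : ℕ) : ℝ) * h) ⊆ Icc 0 T := Icc_subset_Icc m1.1 m2.2
  have l1 := integral_mono_Icc hle (he.mono hsub) continuousOn_const
    (hloc _ _ m1.1 m2.2 (by rw [hd]; exact hτh) (by rw [hd]; exact hh2))
  rw [intervalIntegral.integral_const, smul_eq_mul, hd] at l1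
  refine l1.trans ?_
  rw [mul_assoc (2 * τ)]
  exact mul_le_mul_of_nonneg_right hh2 (h0 _ _ m1.1 hle m2.2)

/-- It is enough to estimate the energy at the left end of each window: `en_le` carries it to the
other times of a window of length at most 2τ, whence the constant 2C + 4τ. -/
theorem RedSol.integral_en_le_of_local (hS : S.IsPositive) (hinj : Function.Injective S)
    {τ C T : ℝ} (hτ : 0 < τ) (hC : 0 ≤ C) (hT : τ ≤ T) {x v f : ℝ → E} {q : ℝ → ℝ}
    (h : RedSol S 0 T x v f) (hq : ContinuousOn q (Icc 0 T)) (hq0 : ∀ t, 0 ≤ q t)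
    (hloc : ∀ a, 0 ≤ a → a + τ ≤ T →
      en (x a) (v a) ≤ C * ∫ t in a..(a + τ), (q t + ‖f t‖ ^ 2)) :
    ∫ t in (0 : ℝ)..T, en (x t) (v t)
      ≤ 2 * τ * (2 * C + 4 * τ) * ∫ t in (0 : ℝ)..T, (q t + ‖f t‖ ^ 2) := by
  have hc : ContinuousOn (fun t => q t + ‖f t‖ ^ 2) (Icc 0 T) := hq.add (h.cont_f.norm.pow 2)
  have hn : ∀ t, 0 ≤ q t + ‖f t‖ ^ 2 := fun t => add_nonneg (hq0 t) (by positivity)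
  refine integral_le_of_local hτ hT h.cont_en hc (fun a b ha hb h1 h2 t ht => ?_)
    fun a b ha hab hb => mul_nonneg (by positivity) (integral_nonneg_Icc hab fun t _ => hn t)
  have hsub : Icc a b ⊆ Icc 0 T := Icc_subset_Icc ha hb
  have hab : a ≤ b := ht.1.trans ht.2
  have k1 := (h.mono ha hb).en_le hS hinj (left_mem_Icc.2 hab) ht
  have k2 := hloc a ha (by linarith)
  have k3 : ∫ t in a..(a + τ), (q t + ‖f t‖ ^ 2) ≤ ∫ t in a..b, (q t + ‖f t‖ ^ 2) :=
    integral_mono_of_Icc_subset (hc.mono hsub) (fun t _ => hn t) le_rfl (by linarith) (by linarith)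
  have k4 : ∫ t in a..b, ‖f t‖ ^ 2 ≤ ∫ t in a..b, (q t + ‖f t‖ ^ 2) :=
    integral_mono_Icc hab ((h.cont_f.norm.pow 2).mono hsub) (hc.mono hsub)
      fun t _ => by linarith [hq0 t]
  have k5 : 0 ≤ ∫ t in a..b, ‖f t‖ ^ 2 := integral_nonneg_Icc hab fun _ _ => by positivity
  have k6 : (b - a) * ∫ t in a..b, ‖f t‖ ^ 2 ≤ 2 * τ * ∫ t in a..b, (q t + ‖f t‖ ^ 2) :=
    mul_le_mul h2 k4 k5 (by positivity)
  have k7 := mul_le_mul_of_nonneg_left k3 hC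
  linarith

/-- The operator `P` observes the free equation through the velocity. -/
def RedObservesVelocity (S P : E →L[ℝ] E) : Prop :=
  ∃ T₀ : ℝ, 0 < T₀ ∧ ∀ T : ℝ, T₀ < T → ∃ γ : ℝ, 0 < γ ∧
    ∀ x v : ℝ → E, RedSol S 0 T x v (fun _ => 0) →
      γ * en (x 0) (v 0) ≤ ∫ t in (0 : ℝ)..T, ‖P (v t)‖ ^ 2

theorem norm_sq_add_le (x y : E) : ‖x + y‖ ^ 2 ≤ 2 * ‖x‖ ^ 2 + 2 * ‖y‖ ^ 2 := by
  have h1 : ‖x + y‖ ^ 2 ≤ (‖x‖ + ‖y‖) ^ 2 := by gcongr; exact norm_add_le x y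
  nlinarith [sq_nonneg (‖x‖ - ‖y‖)]

theorem norm_sq_le_opNorm {F : Type*} [NormedAddCommGroup F] [NormedSpace ℝ F] (P : E →L[ℝ] F)
    (x : E) : ‖P x‖ ^ 2 ≤ ‖P‖ ^ 2 * ‖x‖ ^ 2 := by
  rw [← mul_pow]; gcongr; exact P.le_opNorm x

/-- Velocity observability of solutions with a source, with constants that do not depend on the
length of the time interval. -/
theorem RedObservesVelocity.exists_integral_en_le (hS : S.IsPositive)
    (hinj : Function.Injective S) (hK : IsCompactOperator (S * S : E →L[ℝ] E))
    {P : E →L[ℝ] E} (hP : RedObservesVelocity S P) :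
    ∃ τ C : ℝ, 0 < τ ∧ 0 < C ∧ ∀ (a b : ℝ) (x v f : ℝ → E), τ ≤ b - a → RedSol S a b x v f →
      ∫ t in a..b, en (x t) (v t) ≤ C * ((∫ t in a..b, ‖P (v t)‖ ^ 2) + ∫ t in a..b, ‖f t‖ ^ 2) := by
  obtain ⟨T₀, hT₀, hobs⟩ := hP
  set τ := T₀ + 1 with hτ
  have hτ0 : 0 < τ := by linarith
  obtain ⟨γ, hγ, hobs⟩ := hobs τ (by linarith)
  set C₀ := (2 + 8 * ‖P‖ ^ 2 * τ ^ 2) / γ with hC₀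
  have hC₀pos : 0 < C₀ := by positivity
  refine ⟨τ, 2 * τ * (2 * C₀ + 4 * τ), hτ0, by positivity, fun a b x v f hab h => ?_⟩
  -- it is enough to treat intervals starting at `0`
  suffices H : ∀ (T : ℝ) (x v f : ℝ → E), τ ≤ T → RedSol S 0 T x v f →
      ∫ t in (0 : ℝ)..T, en (x t) (v t)
        ≤ 2 * τ * (2 * C₀ + 4 * τ) * ∫ t in (0 : ℝ)..T, (‖P (v t)‖ ^ 2 + ‖f t‖ ^ 2) by
    have hs := h.shift a
    rw [sub_self] at hs
    have := H (b - a) _ _ _ hab hs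
    rw [intervalIntegral.integral_comp_add_right (fun t => en (x t) (v t)),
      intervalIntegral.integral_comp_add_right (fun t => ‖P (v t)‖ ^ 2 + ‖f t‖ ^ 2), zero_add,
      sub_add_cancel, integral_add_Icc (by linarith) (h.cont_norm_sq_map P) h.cont_norm_sq_f] at this
    exact this
  clear h x v f hab a b
  intro T x v f hT h
  refine h.integral_en_le_of_local hS hinj hτ0 hC₀pos.le hT
    ((P.continuous.comp_continuousOn h.cont_v).norm.pow 2) (fun t => by positivity)
    fun a ha haT => ?_
  have hs := (h.mono ha haT).shift a
  rw [sub_self, add_sub_cancel_left] at hs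
  -- The free solution with the same data at time `a` obeys the observability inequality. The
  -- difference starts from zero, so its energy on the window is at most 2τ times the integral of
  -- the squared source.
  obtain ⟨y, w, hfree, hy, hw⟩ := exists_freeSol hS hinj hK (x a) (v a)
  have hyw := hfree.redSol 0 τ
  have o1 := hobs y w hyw
  rw [hy, hw] at o1
  have hd := hs.sub hyw
  simp only [sub_zero] at hd
  set F := ∫ t in (0 : ℝ)..τ, ‖f (t + a)‖ ^ 2 with hF
  have o2 : ∀ t ∈ Icc 0 τ, ‖P (w t)‖ ^ 2 ≤ 2 * ‖P (v (t + a))‖ ^ 2 + 8 * ‖P‖ ^ 2 * τ * F := by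
    intro t ht
    have e1 := hd.en_le hS hinj (left_mem_Icc.2 hτ0.le) ht
    simp only [zero_add, hy, hw, sub_self, sub_zero] at e1
    have e2 : en (0 : E) (0 : E) = 0 := by simp [en]
    rw [e2] at e1
    have e3 := norm_sq_snd_le_en (x (t + a) - y t) (v (t + a) - w t)
    have e4 := norm_sq_add_le (P (v (t + a))) (-P (v (t + a) - w t))
    have e5 : P (v (t + a)) + -P (v (t + a) - w t) = P (w t) := by simp
    rw [e5, norm_neg] at e4
    have e6 := norm_sq_le_opNorm P (v (t + a) - w t)
    have e7 : ‖v (t + a) - w t‖ ^ 2 ≤ 4 * τ * F := by linarith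
    have e8 := mul_le_mul_of_nonneg_left e7 (sq_nonneg ‖P‖)
    linarith
  have hcv : ContinuousOn (fun t => ‖P (v (t + a))‖ ^ 2) (Icc 0 τ) :=
    (P.continuous.comp_continuousOn hs.cont_v).norm.pow 2
  have hcw : ContinuousOn (fun t => ‖P (w t)‖ ^ 2) (Icc 0 τ) :=
    (P.continuous.comp_continuousOn hyw.cont_v).norm.pow 2
  have o3 := integral_le_of_le_affine hτ0.le hcw hcv o2
  rw [sub_zero] at o3
  have o4 : ∫ t in a..(a + τ), (‖P (v t)‖ ^ 2 + ‖f t‖ ^ 2)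
      = (∫ t in (0 : ℝ)..τ, ‖P (v (t + a))‖ ^ 2) + F := by
    rw [hF, ← integral_add_Icc hτ0.le hcv hs.cont_norm_sq_f,
      intervalIntegral.integral_comp_add_right (fun t => ‖P (v t)‖ ^ 2 + ‖f t‖ ^ 2), zero_add,
      add_comm τ a]
  rw [o4]
  set Q := ∫ t in (0 : ℝ)..τ, ‖P (v (t + a))‖ ^ 2 with hQ
  have hQ0 : 0 ≤ Q := integral_nonneg_Icc hτ0.le fun _ _ => by positivity
  have hF0 : 0 ≤ F := integral_nonneg_Icc hτ0.le fun _ _ => by positivity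
  rw [hC₀, div_mul_eq_mul_div, le_div_iff₀ hγ]
  have := mul_nonneg (mul_nonneg (sq_nonneg ‖P‖) (sq_nonneg τ)) hQ0
  nlinarith

end Cascade

namespace Cascade

/-! ### Square-integrable functions on [0, T], with norms written as integrals. -/

section SquareIntegrable

variable {G : Type*} [NormedAddCommGroup G] {T : ℝ} {f g h : ℝ → G}

theorem memLp_two_of_continuousOn (hf : ContinuousOn f (Icc 0 T)) :
    MemLp f 2 (volume.restrict (Icc 0 T)) := by
  obtain ⟨M, hM⟩ := isCompact_Icc.exists_bound_of_continuousOn hf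
  exact MemLp.of_bound (hf.aestronglyMeasurable_of_isCompact isCompact_Icc measurableSet_Icc) M
    ((ae_restrict_mem measurableSet_Icc).mono hM)

theorem intervalIntegrable_norm_sq (hT : 0 ≤ T) (hf : MemLp f 2 (volume.restrict (Icc 0 T))) :
    IntervalIntegrable (fun t => ‖f t‖ ^ 2) volume 0 T := by
  rw [intervalIntegrable_iff_integrableOn_Icc_of_le hT]
  exact hf.integrable_norm_pow two_ne_zero

theorem integral_norm_sq_add_le (hT : 0 ≤ T) (hf : MemLp f 2 (volume.restrict (Icc 0 T)))
    (hg : MemLp g 2 (volume.restrict (Icc 0 T))) :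
    ∫ t in (0 : ℝ)..T, ‖f t + g t‖ ^ 2
      ≤ 2 * (∫ t in (0 : ℝ)..T, ‖f t‖ ^ 2) + 2 * ∫ t in (0 : ℝ)..T, ‖g t‖ ^ 2 := by
  have i1 := intervalIntegrable_norm_sq hT hf
  have i2 := intervalIntegrable_norm_sq hT hg
  rw [← intervalIntegral.integral_const_mul, ← intervalIntegral.integral_const_mul,
    ← intervalIntegral.integral_add (i1.const_mul 2) (i2.const_mul 2)]
  refine intervalIntegral.integral_mono_on hT (intervalIntegrable_norm_sq hT (hf.add hg))
    ((i1.const_mul 2).add (i2.const_mul 2)) fun t _ => ?_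
  have h1 : ‖f t + g t‖ ^ 2 ≤ (‖f t‖ + ‖g t‖) ^ 2 := by gcongr; exact norm_add_le _ _
  nlinarith [sq_nonneg (‖f t‖ - ‖g t‖)]

theorem integral_norm_sq_sub_le (hT : 0 ≤ T) (hf : MemLp f 2 (volume.restrict (Icc 0 T)))
    (hg : MemLp g 2 (volume.restrict (Icc 0 T))) (hh : MemLp h 2 (volume.restrict (Icc 0 T))) :
    ∫ t in (0 : ℝ)..T, ‖f t - h t‖ ^ 2
      ≤ 2 * (∫ t in (0 : ℝ)..T, ‖f t - g t‖ ^ 2) + 2 * ∫ t in (0 : ℝ)..T, ‖g t - h t‖ ^ 2 := by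
  simpa using integral_norm_sq_add_le hT (hf.sub hg) (hg.sub hh)

theorem integral_norm_sq_le (hT : 0 ≤ T) (hf : MemLp f 2 (volume.restrict (Icc 0 T)))
    (hg : MemLp g 2 (volume.restrict (Icc 0 T))) :
    ∫ t in (0 : ℝ)..T, ‖g t‖ ^ 2
      ≤ 2 * (∫ t in (0 : ℝ)..T, ‖f t‖ ^ 2) + 2 * ∫ t in (0 : ℝ)..T, ‖f t - g t‖ ^ 2 := by
  simpa [norm_sub_rev] using integral_norm_sq_add_le hT hf (hg.sub hf)

theorem norm_toLp_sq (hT : 0 ≤ T) (hf : MemLp f 2 (volume.restrict (Icc 0 T))) :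
    ‖hf.toLp f‖ ^ 2 = ∫ t in (0 : ℝ)..T, ‖f t‖ ^ 2 := by
  rw [Lp.norm_toLp, hf.eLpNorm_eq_integral_rpow_norm two_ne_zero ENNReal.ofNat_ne_top,
    ENNReal.toReal_ofReal (by positivity), intervalIntegral.integral_of_le hT,
    ← integral_Icc_eq_integral_Ioc]
  simp only [ENNReal.toReal_ofNat, Real.rpow_ofNat]
  rw [← Real.rpow_natCast, ← Real.rpow_mul (by positivity)]
  norm_num

theorem exists_tendsto_integral_norm_sq [CompleteSpace G] (hT : 0 ≤ T) {F : ℕ → ℝ → G}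
    (hF : ∀ m, MemLp (F m) 2 (volume.restrict (Icc 0 T)))
    (hc : Tendsto (fun m : ℕ × ℕ => ∫ t in (0 : ℝ)..T, ‖F m.1 t - F m.2 t‖ ^ 2) atTop (𝓝 0)) :
    ∃ g, MemLp g 2 (volume.restrict (Icc 0 T)) ∧
      Tendsto (fun m => ∫ t in (0 : ℝ)..T, ‖F m t - g t‖ ^ 2) atTop (𝓝 0) := by
  have hdist : ∀ {f g : ℝ → G} (hf : MemLp f 2 (volume.restrict (Icc 0 T)))
      (hg : MemLp g 2 (volume.restrict (Icc 0 T))),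
      dist (hf.toLp f) (hg.toLp g) ^ 2 = ∫ t in (0 : ℝ)..T, ‖f t - g t‖ ^ 2 := by
    intro f g hf hg
    rw [dist_eq_norm, ← MemLp.toLp_sub]
    exact norm_toLp_sq hT (hf.sub hg)
  have hcs : CauchySeq fun m => (hF m).toLp (F m) := by
    rw [cauchySeq_iff_tendsto_dist_atTop_0]
    have h1 := (Real.continuous_sqrt.tendsto 0).comp hc
    simp only [Real.sqrt_zero, Function.comp_def] at h1
    refine h1.congr fun m => ?_
    rw [← hdist (hF m.1) (hF m.2), Real.sqrt_sq dist_nonneg]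
  obtain ⟨L, hL⟩ := cauchySeq_tendsto_of_complete hcs
  refine ⟨L, Lp.memLp L, ?_⟩
  rw [tendsto_iff_dist_tendsto_zero] at hL
  have h2 := hL.pow 2
  rw [zero_pow two_ne_zero] at h2
  refine h2.congr fun m => ?_
  have := hdist (hF m) (Lp.memLp L)
  rwa [Lp.toLp_coeFn] at this

theorem ae_eq_of_integral_norm_sq_sub (hT : 0 ≤ T) (hf : MemLp f 2 (volume.restrict (Icc 0 T)))
    (hg : MemLp g 2 (volume.restrict (Icc 0 T)))
    (h : ∫ t in (0 : ℝ)..T, ‖f t - g t‖ ^ 2 = 0) : f =ᵐ[volume.restrict (Icc 0 T)] g := by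
  have h1 := norm_toLp_sq hT (hf.sub hg)
  simp only [Pi.sub_apply, h] at h1
  have h2 := norm_eq_zero.1 (pow_eq_zero_iff two_ne_zero |>.1 h1)
  rw [MemLp.toLp_sub hf hg, sub_eq_zero, MemLp.toLp_eq_toLp_iff] at h2
  exact h2

end SquareIntegrable

variable {E : Type*} [NormedAddCommGroup E] [InnerProductSpace ℝ E] [CompleteSpace E]
  {S : E →L[ℝ] E} {G : Type*} [NormedAddCommGroup G]

/-! ### Strong solutions and admissible observations -/

/-- `(y, v) = (A w, w')` for a strong solution of `w'' + A w = f` on `[0, T]`. -/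
structure RedStrong (S : E →L[ℝ] E) (T : ℝ) (y v f : ℝ → E) : Prop where
  cont_y : ContinuousOn y (Icc 0 T)
  cont_f : ContinuousOn f (Icc 0 T)
  deriv_y : ∀ t ∈ Icc 0 T, HasDerivWithinAt (fun s => S (S (y s))) (v t) (Icc 0 T) t
  deriv_v : ∀ t ∈ Icc 0 T, HasDerivWithinAt v (f t - y t) (Icc 0 T) t

/-- The direct inequality for an additive observation `b(A w, w')`. -/
structure RedAdmissible (S : E →L[ℝ] E) (b : E × E →+ G) : Prop where
  bounded : ∃ M : ℝ, ∀ y v : E, ‖b (y, v)‖ ≤ M * (‖y‖ + ‖v‖)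
  direct : ∀ T : ℝ, 0 < T → ∃ D : ℝ, 0 < D ∧
    ∀ y v f : ℝ → E, RedStrong S T y v f →
      ∫ t in (0 : ℝ)..T, ‖b (y t, v t)‖ ^ 2 ≤
        D * (en (S (y 0)) (v 0) + en (S (y T)) (v T)
          + (∫ t in (0 : ℝ)..T, en (S (y t)) (v t)) + ∫ t in (0 : ℝ)..T, ‖f t‖ ^ 2)

/-- The observability inequality for the free equation. -/
def RedObserving (S : E →L[ℝ] E) (b : E × E →+ G) : Prop :=
  ∃ T₀ : ℝ, 0 < T₀ ∧ ∀ T : ℝ, T₀ < T → ∃ R : ℝ, 0 < R ∧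
    ∀ y v : ℝ → E, RedStrong S T y v (fun _ => 0) →
      R * en (S (y 0)) (v 0) ≤ ∫ t in (0 : ℝ)..T, ‖b (y t, v t)‖ ^ 2

/-- Strong solutions whose data converge to those of `(x, v)`, with source `f`. -/
structure RedApprox (S : E →L[ℝ] E) (T : ℝ) (x v f : ℝ → E) (ys vs fs : ℕ → ℝ → E) : Prop where
  strong : ∀ m, RedStrong S T (ys m) (vs m) (fs m)
  tendsto_en : Tendsto (fun m => en (S (ys m 0) - x 0) (vs m 0 - v 0)) atTop (𝓝 0)
  tendsto_f : Tendsto (fun m => ∫ t in (0 : ℝ)..T, ‖fs m t - f t‖ ^ 2) atTop (𝓝 0)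

/-- `g` is the observation of the finite energy solution `(x, v)` with source `f`. -/
def RedObservation (S : E →L[ℝ] E) (b : E × E →+ G) (T : ℝ) (x v f : ℝ → E) (g : ℝ → G) : Prop :=
  MemLp g 2 (volume.restrict (Icc 0 T)) ∧ ∃ ys vs fs, RedApprox S T x v f ys vs fs ∧
    Tendsto (fun m => ∫ t in (0 : ℝ)..T, ‖b (ys m t, vs m t) - g t‖ ^ 2) atTop (𝓝 0)

namespace RedStrong

variable {T : ℝ} {y v f y' v' f' : ℝ → E} {b : E × E →+ G}

theorem cont_v (h : RedStrong S T y v f) : ContinuousOn v (Icc 0 T) :=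
  fun t ht => (h.deriv_v t ht).continuousWithinAt

theorem redSol (h : RedStrong S T y v f) : RedSol S 0 T (fun t => S (y t)) v f := by
  refine ⟨S.continuous.comp_continuousOn h.cont_y, h.cont_v, h.cont_f, h.deriv_y, fun t ht => ?_⟩
  simpa [Function.comp_def] using S.hasFDerivAt.comp_hasDerivWithinAt t (h.deriv_v t ht)

theorem sub (h : RedStrong S T y v f) (k : RedStrong S T y' v' f') :
    RedStrong S T (fun t => y t - y' t) (fun t => v t - v' t) (fun t => f t - f' t) := by
  refine ⟨h.cont_y.sub k.cont_y, h.cont_f.sub k.cont_f, fun t ht => ?_, fun t ht => ?_⟩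
  · simpa using (h.deriv_y t ht).fun_sub (k.deriv_y t ht)
  · convert (h.deriv_v t ht).fun_sub (k.deriv_v t ht) using 1
    abel

theorem cont_obs (hb : RedAdmissible S b) (h : RedStrong S T y v f) :
    ContinuousOn (fun t => b (y t, v t)) (Icc 0 T) := by
  obtain ⟨M, hM⟩ := hb.bounded
  have hcb : Continuous b := by
    refine AddMonoidHomClass.continuous_of_bound b (|M| * 2) fun z => (hM z.1 z.2).trans ?_
    have h1 := norm_fst_le z
    have h2 := norm_snd_le z
    calc M * (‖z.1‖ + ‖z.2‖) ≤ |M| * (‖z.1‖ + ‖z.2‖) := by gcongr; exact le_abs_self M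
      _ ≤ |M| * (2 * ‖z‖) := by gcongr; linarith
      _ = |M| * 2 * ‖z‖ := by ring
  exact hcb.comp_continuousOn (h.cont_y.prodMk h.cont_v)

theorem memLp_obs (hb : RedAdmissible S b) (h : RedStrong S T y v f) :
    MemLp (fun t => b (y t, v t)) 2 (volume.restrict (Icc 0 T)) :=
  memLp_two_of_continuousOn (h.cont_obs hb)

end RedStrong

/-- The regularisation of a finite energy solution is strong. -/
theorem RedSol.strong_reg (hS : S.IsPositive) {T : ℝ} {x v f : ℝ → E} (h : RedSol S 0 T x v f)
    (m : ℕ) : RedStrong S T (fun t => res S m (x t)) (fun t => reg S m (v t))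
      (fun t => reg S m (f t)) := by
  refine ⟨(res S m).continuous.comp_continuousOn h.cont_x,
    (reg S m).continuous.comp_continuousOn h.cont_f, fun t ht => ?_,
    fun t ht => h.hasDeriv_res_v hS m ht⟩
  simpa [Function.comp_def, reg_apply] using
    S.hasFDerivAt.comp_hasDerivWithinAt t (h.hasDeriv_res_x hS m ht)

/-- The energies at time T and in the mean are dominated by the initial energy and the source
through `en_le`, so they can be removed from the admissibility inequality. -/
theorem RedAdmissible.exists_direct (hS : S.IsPositive) (hinj : Function.Injective S)
    {b : E × E →+ G} (hb : RedAdmissible S b) {T : ℝ} (hT : 0 < T) :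
    ∃ D : ℝ, 0 < D ∧ ∀ y v f : ℝ → E, RedStrong S T y v f →
      ∫ t in (0 : ℝ)..T, ‖b (y t, v t)‖ ^ 2
        ≤ D * (en (S (y 0)) (v 0) + ∫ t in (0 : ℝ)..T, ‖f t‖ ^ 2) := by
  obtain ⟨D, hD, hdir⟩ := hb.direct T hT
  refine ⟨D * (4 + 4 * T + 2 * T ^ 2), by positivity, fun y v f h => (hdir y v f h).trans ?_⟩
  have hsol := h.redSol
  have hF : 0 ≤ ∫ t in (0 : ℝ)..T, ‖f t‖ ^ 2 := integral_nonneg_Icc hT.le fun _ _ => by positivity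
  have h0 := en_nonneg (S (y 0)) (v 0)
  have h1 : ∀ t ∈ Icc 0 T, en (S (y t)) (v t)
      ≤ 2 * en (S (y 0)) (v 0) + 2 * (T * ∫ t in (0 : ℝ)..T, ‖f t‖ ^ 2) := fun t ht => by
    simpa using hsol.en_le hS hinj (left_mem_Icc.2 hT.le) ht
  have h2 := h1 T (right_mem_Icc.2 hT.le)
  have h3 := integral_mono_Icc hT.le hsol.cont_en continuousOn_const h1
  rw [intervalIntegral.integral_const, smul_eq_mul, sub_zero] at h3
  rw [mul_assoc]
  refine mul_le_mul_of_nonneg_left ?_ hD.le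
  nlinarith [mul_nonneg hT.le h0, mul_nonneg (mul_nonneg hT.le hT.le) h0, mul_nonneg hT.le hF]

/-! ### Observations of finite energy solutions as limits of observations of strong solutions. -/

section Approx

variable {T : ℝ} {x v f : ℝ → E} {ys vs fs ys' vs' fs' : ℕ → ℝ → E} {b : E × E →+ G}

theorem RedSol.approx_reg (hS : S.IsPositive) (hinj : Function.Injective S) (hT : 0 ≤ T)
    (h : RedSol S 0 T x v f) :
    RedApprox S T x v f (fun m t => res S m (x t)) (fun m t => reg S m (v t))
      (fun m t => reg S m (f t)) := by
  have R := tendsto_reg hS hinj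
  refine ⟨h.strong_reg hS, ?_, ?_⟩
  · have h1 := (((R (x 0)).sub_const (x 0)).norm.pow 2).add (((R (v 0)).sub_const (v 0)).norm.pow 2)
    have h2 := h1.const_mul (1 / 2)
    simp only [sub_self, norm_zero, zero_pow two_ne_zero, add_zero, mul_zero] at h2
    exact h2
  · have : Tendsto (fun m => ∫ t in (0 : ℝ)..T, ‖reg S m (f t) - f t‖ ^ 2) atTop
        (𝓝 (∫ t in (0 : ℝ)..T, (0 : ℝ))) := by
      have hl : (0 : ℝ) ∈ Icc 0 T := left_mem_Icc.2 hT
      have hr : T ∈ Icc 0 T := right_mem_Icc.2 hT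
      refine intervalIntegral.tendsto_integral_filter_of_dominated_convergence
        (fun t => 4 * ‖f t‖ ^ 2) (Eventually.of_forall fun m => ?_)
        (Eventually.of_forall fun m => Eventually.of_forall fun t _ => ?_) ?_
        (Eventually.of_forall fun t _ => ?_)
      · have hc : ContinuousOn (fun t => ‖reg S m (f t) - f t‖ ^ 2) (Icc 0 T) :=
          (((reg S m).continuous.comp_continuousOn h.cont_f).sub h.cont_f).norm.pow 2
        exact (intervalIntegrable_of_continuousOn_Icc hc hl hr).def'.aestronglyMeasurable
      · rw [Real.norm_of_nonneg (by positivity)]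
        have h1 := norm_sub_le (reg S m (f t)) (f t)
        have h2 := norm_reg_le hS m (f t)
        calc _ ≤ (2 * ‖f t‖) ^ 2 := by gcongr; linarith
          _ = _ := by ring
      · exact (intervalIntegrable_of_continuousOn_Icc h.cont_norm_sq_f hl hr).const_mul 4
      · simpa using ((R (f t)).sub_const (f t)).norm.pow 2
    simpa using this

/-- The difference of two approximating strong solutions is strong, and its initial energy and
source tend to zero, so the direct inequality applies. For a single sequence this is the Cauchy
property that yields existence of the observation. For two sequences it yields uniqueness. -/
theorem RedApprox.tendsto_obs_sub (hS : S.IsPositive) (hinj : Function.Injective S)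
    (hb : RedAdmissible S b) (hT : 0 < T) (hf : ContinuousOn f (Icc 0 T))
    (h : RedApprox S T x v f ys vs fs) (k : RedApprox S T x v f ys' vs' fs') :
    Tendsto (fun m : ℕ × ℕ =>
      ∫ t in (0 : ℝ)..T, ‖b (ys m.1 t, vs m.1 t) - b (ys' m.2 t, vs' m.2 t)‖ ^ 2) atTop (𝓝 0) := by
  obtain ⟨D, hD, hdir⟩ := hb.exists_direct hS hinj hT
  have hfst : Tendsto (Prod.fst : ℕ × ℕ → ℕ) atTop atTop := by
    rw [← prod_atTop_atTop_eq]; exact tendsto_fst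
  have hsnd : Tendsto (Prod.snd : ℕ × ℕ → ℕ) atTop atTop := by
    rw [← prod_atTop_atTop_eq]; exact tendsto_snd
  have hlim := (((h.tendsto_en.comp hfst).add (k.tendsto_en.comp hsnd)).const_mul 2).add
    (((h.tendsto_f.comp hfst).const_mul 2).add ((k.tendsto_f.comp hsnd).const_mul 2))
  have hlim' := hlim.const_mul D
  simp only [add_zero, mul_zero, Function.comp_def] at hlim'
  refine squeeze_zero (fun m => integral_nonneg_Icc hT.le fun _ _ => by positivity)
    (fun m => ?_) hlim'
  have h1 := hdir _ _ _ ((h.strong m.1).sub (k.strong m.2))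
  have h2 : ∀ t, b (ys m.1 t - ys' m.2 t, vs m.1 t - vs' m.2 t)
      = b (ys m.1 t, vs m.1 t) - b (ys' m.2 t, vs' m.2 t) := fun t => by
    rw [← map_sub b]; rfl
  simp only [h2] at h1
  refine h1.trans (mul_le_mul_of_nonneg_left (add_le_add ?_ ?_) hD.le)
  · have h3 := en_add_le (S (ys m.1 0) - x 0) (vs m.1 0 - v 0) (-(S (ys' m.2 0) - x 0))
      (-(vs' m.2 0 - v 0))
    have h4 : en (-(S (ys' m.2 0) - x 0)) (-(vs' m.2 0 - v 0))
        = en (S (ys' m.2 0) - x 0) (vs' m.2 0 - v 0) := by unfold en; rw [norm_neg, norm_neg]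
    rw [h4] at h3
    have e1 : S (ys m.1 0 - ys' m.2 0) = S (ys m.1 0) - x 0 + -(S (ys' m.2 0) - x 0) := by
      rw [map_sub]; abel
    have e2 : vs m.1 0 - vs' m.2 0 = vs m.1 0 - v 0 + -(vs' m.2 0 - v 0) := by abel
    rw [e1, e2]
    exact h3
  · have h3 := integral_norm_sq_sub_le hT.le (memLp_two_of_continuousOn (h.strong m.1).cont_f)
      (memLp_two_of_continuousOn hf) (memLp_two_of_continuousOn (k.strong m.2).cont_f)
    simpa only [norm_sub_rev (f _) (fs' m.2 _)] using h3

theorem RedApprox.exists_observation [CompleteSpace G] (hS : S.IsPositive)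
    (hinj : Function.Injective S) (hb : RedAdmissible S b) (hT : 0 < T)
    (hf : ContinuousOn f (Icc 0 T)) (h : RedApprox S T x v f ys vs fs) :
    ∃ g, RedObservation S b T x v f g := by
  obtain ⟨g, hg, hlim⟩ := exists_tendsto_integral_norm_sq hT.le
    (fun m => (h.strong m).memLp_obs hb) (h.tendsto_obs_sub hS hinj hb hT hf h)
  exact ⟨g, hg, ys, vs, fs, h, hlim⟩

theorem RedSol.exists_observation [CompleteSpace G] (hS : S.IsPositive)
    (hinj : Function.Injective S) (hb : RedAdmissible S b) (hT : 0 < T) (h : RedSol S 0 T x v f) :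
    ∃ g, RedObservation S b T x v f g :=
  (h.approx_reg hS hinj hT.le).exists_observation hS hinj hb hT h.cont_f

/-- Any approximating sequence computes the observation. Hence estimates may always be proved on the
canonical sequence of `RedSol.approx_reg`. -/
theorem RedObservation.tendsto_of_approx (hS : S.IsPositive) (hinj : Function.Injective S)
    (hb : RedAdmissible S b) (hT : 0 < T) (hf : ContinuousOn f (Icc 0 T)) {g : ℝ → G}
    (hg : RedObservation S b T x v f g) (k : RedApprox S T x v f ys vs fs) :
    Tendsto (fun m => ∫ t in (0 : ℝ)..T, ‖b (ys m t, vs m t) - g t‖ ^ 2) atTop (𝓝 0) := by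
  obtain ⟨hg2, ys', vs', fs', ha, hlim⟩ := hg
  have hdiag : Tendsto (fun m : ℕ => (m, m)) atTop atTop := tendsto_atTop_diagonal
  have h1 := (((k.tendsto_obs_sub hS hinj hb hT hf ha).comp hdiag).const_mul 2).add
    (hlim.const_mul 2)
  simp only [mul_zero, add_zero, Function.comp_def] at h1
  exact squeeze_zero (fun m => integral_nonneg_Icc hT.le fun _ _ => by positivity)
    (fun m => integral_norm_sq_sub_le hT.le ((k.strong m).memLp_obs hb)
      ((ha.strong m).memLp_obs hb) hg2) h1

theorem RedObservation.ae_eq (hS : S.IsPositive) (hinj : Function.Injective S)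
    (hb : RedAdmissible S b) (hT : 0 < T) (hf : ContinuousOn f (Icc 0 T)) {g g' : ℝ → G}
    (hg : RedObservation S b T x v f g) (hg' : RedObservation S b T x v f g') :
    g =ᵐ[volume.restrict (Icc 0 T)] g' := by
  obtain ⟨hg'2, ys, vs, fs, ha, hlim⟩ := id hg'
  have h1 := hg.tendsto_of_approx hS hinj hb hT hf ha
  refine ae_eq_of_integral_norm_sq_sub hT.le hg.1 hg'.1 (le_antisymm ?_
    (integral_nonneg_Icc hT.le fun _ _ => by positivity))
  have h2 := (h1.const_mul 2).add (hlim.const_mul 2)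
  simp only [mul_zero, add_zero] at h2
  refine ge_of_tendsto h2 (Eventually.of_forall fun m => ?_)
  have h3 := integral_norm_sq_sub_le hT.le hg.1 ((ha.strong m).memLp_obs hb) hg'.1
  simpa only [norm_sub_rev (g _) (b _)] using h3

/-- The direct inequality for observations of finite energy solutions. -/
theorem RedAdmissible.exists_integral_obs_le (hS : S.IsPositive) (hinj : Function.Injective S)
    (hb : RedAdmissible S b) (hT : 0 < T) :
    ∃ D : ℝ, 0 < D ∧ ∀ (x v f : ℝ → E) (g : ℝ → G), RedSol S 0 T x v f →
      RedObservation S b T x v f g →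
      ∫ t in (0 : ℝ)..T, ‖g t‖ ^ 2 ≤ D * (en (x 0) (v 0) + ∫ t in (0 : ℝ)..T, ‖f t‖ ^ 2) := by
  obtain ⟨D, hD, hdir⟩ := hb.exists_direct hS hinj hT
  refine ⟨2 * D, by positivity, fun x v f g h hg => ?_⟩
  have ha := h.approx_reg hS hinj hT.le
  have hlim := (hg.tendsto_of_approx hS hinj hb hT h.cont_f ha).const_mul 2
  have hlim' := hlim.const_add (2 * D * (en (x 0) (v 0) + ∫ t in (0 : ℝ)..T, ‖f t‖ ^ 2))
  rw [mul_zero, add_zero] at hlim'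
  refine ge_of_tendsto hlim' (Eventually.of_forall fun m => ?_)
  have h1 := integral_norm_sq_le hT.le ((ha.strong m).memLp_obs hb) hg.1
  have h2 := hdir _ _ _ (ha.strong m)
  have h3 : en (S (res S m (x 0))) (reg S m (v 0)) ≤ en (x 0) (v 0) := by
    unfold en
    have h4 := norm_reg_le hS m (x 0)
    have h5 := norm_reg_le hS m (v 0)
    rw [reg_apply] at h4
    gcongr
  have h4 : ∫ t in (0 : ℝ)..T, ‖reg S m (f t)‖ ^ 2 ≤ ∫ t in (0 : ℝ)..T, ‖f t‖ ^ 2 :=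
    integral_mono_Icc hT.le (ha.strong m).redSol.cont_norm_sq_f h.cont_norm_sq_f fun t _ => by
      have := norm_reg_le hS m (f t)
      gcongr
  have h5 := mul_le_mul_of_nonneg_left (add_le_add h3 h4) hD.le
  linarith

/-- Observability of finite energy solutions with a source, with constants that do not depend on
the length of the time interval. -/
theorem RedObserving.exists_integral_en_le (hS : S.IsPositive) (hinj : Function.Injective S)
    (hK : IsCompactOperator (S * S : E →L[ℝ] E)) (hb : RedAdmissible S b)
    (hobs : RedObserving S b) :
    ∃ τ C : ℝ, 0 < τ ∧ 0 < C ∧ ∀ (T : ℝ) (x v f : ℝ → E) (g : ℝ → G), τ ≤ T →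
      RedSol S 0 T x v f → RedObservation S b T x v f g →
      ∫ t in (0 : ℝ)..T, en (x t) (v t)
        ≤ C * ((∫ t in (0 : ℝ)..T, ‖g t‖ ^ 2) + ∫ t in (0 : ℝ)..T, ‖f t‖ ^ 2) := by
  obtain ⟨T₀, hT₀, hobs⟩ := hobs
  set τ := T₀ + 1 with hτ
  have hτ0 : 0 < τ := by linarith
  obtain ⟨R, hR, hobs⟩ := hobs τ (by linarith)
  obtain ⟨D, hD, hdir⟩ := hb.exists_direct hS hinj hτ0
  set C₀ := (2 + 2 * D) / R with hC₀
  have hC₀pos : 0 < C₀ := by positivity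
  set C := 2 * τ * (2 * C₀ + 4 * τ) with hC
  have hCpos : 0 < C := by positivity
  refine ⟨τ, 2 * C, hτ0, by positivity, fun T x v f g hT h hg => ?_⟩
  have hT0 : 0 < T := hτ0.trans_le hT
  have ha := h.approx_reg hS hinj hT0.le
  -- the inequality for the regularised solutions
  have key : ∀ m, ∫ t in (0 : ℝ)..T, en (reg S m (x t)) (reg S m (v t))
      ≤ C * ((∫ t in (0 : ℝ)..T, ‖b (res S m (x t), reg S m (v t))‖ ^ 2)
        + ∫ t in (0 : ℝ)..T, ‖f t‖ ^ 2) := by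
    intro m
    have hst := ha.strong m
    have hsol := hst.redSol
    have hcq : ContinuousOn (fun t => ‖b (res S m (x t), reg S m (v t))‖ ^ 2) (Icc 0 T) :=
      (hst.cont_obs hb).norm.pow 2
    have k1 := hsol.integral_en_le_of_local hS hinj hτ0 hC₀pos.le hT hcq
      (fun t => by positivity) fun a ha' haT => ?_
    · refine k1.trans (mul_le_mul_of_nonneg_left ?_ hCpos.le)
      rw [integral_add_Icc hT0.le hcq hsol.cont_norm_sq_f]
      refine add_le_add le_rfl (integral_mono_Icc hT0.le hsol.cont_norm_sq_f h.cont_norm_sq_f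
        fun t _ => ?_)
      have := norm_reg_le hS m (f t)
      gcongr
    · have hs := (h.mono ha' haT).shift a
      rw [sub_self, add_sub_cancel_left] at hs
      -- `b` acts only on strong solutions, so the free comparison solution is regularised by the
      -- same `reg S m`. The difference still starts from zero, and the direct inequality on a
      -- window of length τ bounds its observation by the regularised source.
      obtain ⟨y, w, hfree, hy, hw⟩ := exists_freeSol hS hinj hK (x a) (v a)
      have hyw := hfree.redSol 0 τ
      have hyws := hyw.strong_reg hS m
      simp only [map_zero] at hyws
      have o1 := hobs _ _ hyws
      simp only [hy, hw] at o1
      have hss := hs.strong_reg hS m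
      have o2 := hdir _ _ _ (hss.sub hyws)
      simp only [sub_zero, zero_add, hy, hw, sub_self, map_zero] at o2
      have e2 : en (0 : E) (0 : E) = 0 := by simp [en]
      rw [e2, zero_add] at o2
      have h2 : ∀ t, b (res S m (x (t + a)) - res S m (y t), reg S m (v (t + a)) - reg S m (w t))
          = b (res S m (x (t + a)), reg S m (v (t + a))) - b (res S m (y t), reg S m (w t)) :=
        fun t => by rw [← map_sub b]; rfl
      simp only [h2] at o2
      have o3 := integral_norm_sq_le hτ0.le (hss.memLp_obs hb) (hyws.memLp_obs hb)
      have hcq' : ContinuousOn (fun t => ‖b (res S m (x (t + a)), reg S m (v (t + a)))‖ ^ 2)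
        (Icc 0 τ) := (hss.cont_obs hb).norm.pow 2
      have o4 : ∫ t in a..(a + τ), (‖b (res S m (x t), reg S m (v t))‖ ^ 2 + ‖reg S m (f t)‖ ^ 2)
          = (∫ t in (0 : ℝ)..τ, ‖b (res S m (x (t + a)), reg S m (v (t + a)))‖ ^ 2)
            + ∫ t in (0 : ℝ)..τ, ‖reg S m (f (t + a))‖ ^ 2 := by
        rw [← integral_add_Icc hτ0.le hcq' hss.redSol.cont_norm_sq_f,
          intervalIntegral.integral_comp_add_right
          (fun t => ‖b (res S m (x t), reg S m (v t))‖ ^ 2 + ‖reg S m (f t)‖ ^ 2), zero_add,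
          add_comm τ a]
      rw [o4, hC₀, div_mul_eq_mul_div, le_div_iff₀ hR]
      have hQ0 : 0 ≤ ∫ t in (0 : ℝ)..τ, ‖b (res S m (x (t + a)), reg S m (v (t + a)))‖ ^ 2 :=
        integral_nonneg_Icc hτ0.le fun _ _ => by positivity
      have hF0 : 0 ≤ ∫ t in (0 : ℝ)..τ, ‖reg S m (f (t + a))‖ ^ 2 :=
        integral_nonneg_Icc hτ0.le fun _ _ => by positivity
      have := mul_nonneg hD.le hQ0
      rw [mul_comm]
      refine o1.trans (o3.trans ?_)
      nlinarith
  have hl : (0 : ℝ) ∈ Icc 0 T := left_mem_Icc.2 hT0.le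
  have hr : T ∈ Icc 0 T := right_mem_Icc.2 hT0.le
  have hlimE : Tendsto (fun m => ∫ t in (0 : ℝ)..T, en (reg S m (x t)) (reg S m (v t))) atTop
      (𝓝 (∫ t in (0 : ℝ)..T, en (x t) (v t))) := by
    refine intervalIntegral.tendsto_integral_filter_of_dominated_convergence
      (fun t => en (x t) (v t)) (Eventually.of_forall fun m => ?_)
      (Eventually.of_forall fun m => Eventually.of_forall fun t _ => ?_)
      (intervalIntegrable_of_continuousOn_Icc h.cont_en hl hr)
      (Eventually.of_forall fun t _ => ?_)
    · exact (intervalIntegrable_of_continuousOn_Icc (ha.strong m).redSol.cont_en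
        hl hr).def'.aestronglyMeasurable
    · rw [Real.norm_of_nonneg (en_nonneg _ _)]
      unfold en
      have h4 := norm_reg_le hS m (x t)
      have h5 := norm_reg_le hS m (v t)
      gcongr
    · unfold en
      exact ((((tendsto_reg hS hinj (x t)).norm.pow 2).add
        ((tendsto_reg hS hinj (v t)).norm.pow 2)).const_mul _)
  have hlim := (hg.tendsto_of_approx hS hinj hb hT0 h.cont_f ha).const_mul (2 * C)
  have hlim' := hlim.const_add (2 * C * ((∫ t in (0 : ℝ)..T, ‖g t‖ ^ 2)
    + ∫ t in (0 : ℝ)..T, ‖f t‖ ^ 2))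
  rw [mul_zero, add_zero] at hlim'
  refine le_of_tendsto_of_tendsto' hlimE hlim' fun m => (key m).trans ?_
  have hm := (ha.strong m).memLp_obs hb
  have h1 := integral_norm_sq_le hT0.le hg.1 hm
  simp only [norm_sub_rev (g _) (b _)] at h1
  have hF0 : 0 ≤ ∫ t in (0 : ℝ)..T, ‖f t‖ ^ 2 := integral_nonneg_Icc hT0.le fun _ _ => by positivity
  have h2 := mul_le_mul_of_nonneg_left h1 hCpos.le
  have h3 := mul_nonneg hCpos.le hF0
  linarith

end Approx

end Cascade

namespace Cascade

variable {E : Type*} [NormedAddCommGroup E] [InnerProductSpace ℝ E] [CompleteSpace E]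
  {S : E →L[ℝ] E}

/-! ### Chains of equations coupled through velocities -/

/-- The multiplier estimate: the work of the coupling term `-f` on the velocity `w` over the middle
third of the interval. -/
theorem RedSol.integral_coupling_le (hS : S.IsPositive) (hinj : Function.Injective S)
    {a b k₁ k₂ : ℝ} (hab : a < b) {x v f y w g : ℝ → E} (h : RedSol S a b x v f)
    (k : RedSol S a b y w g) (hq : ∀ t ∈ Icc a b, 0 ≤ -⟪f t, w t⟫)
    (hk : ∀ t ∈ Icc a b, (‖x t‖ * ‖y t‖ + ‖v t‖ * ‖w t‖) / (b - a) + ‖v t‖ * ‖g t‖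
      ≤ k₁ * en (x t) (v t) + k₂) :
    2 / 9 * ∫ t in (a + (b - a) / 3)..(b - (b - a) / 3), -⟪f t, w t⟫
      ≤ k₁ * (∫ t in a..b, en (x t) (v t)) + k₂ * (b - a) := by
  have hL : 0 < b - a := sub_pos.2 hab
  -- This weight vanishes at both ends, so integrating the derivative of θ(⟨x, y⟩ + ⟨v, w⟩) leaves
  -- no boundary term. Moreover 0 ≤ θ ≤ 1 and |θ'| ≤ 1/(b - a) on the interval, and θ ≥ 2/9 on its
  -- middle third.
  set θ : ℝ → ℝ := fun t => (t - a) * (b - t) / (b - a) ^ 2 with hθ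
  set θ' : ℝ → ℝ := fun t => ((b - t) - (t - a)) / (b - a) ^ 2 with hθ'
  have hdθ : ∀ t, HasDerivAt θ (θ' t) t := by
    intro t
    have := (((hasDerivAt_id t).sub_const a).fun_mul ((hasDerivAt_id t).const_sub b)).div_const
      ((b - a) ^ 2)
    refine this.congr_deriv ?_
    simp only [hθ', id]
    ring
  have hθc : Continuous θ := by fun_prop
  have hθ'c : Continuous θ' := by fun_prop
  have cq : ContinuousOn (fun t => -⟪f t, w t⟫) (Icc a b) := (h.cont_f.inner (𝕜 := ℝ) k.cont_v).neg
  have cM : ContinuousOn (fun t => ⟪x t, y t⟫ + ⟪v t, w t⟫) (Icc a b) :=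
    (h.cont_x.inner (𝕜 := ℝ) k.cont_x).add (h.cont_v.inner (𝕜 := ℝ) k.cont_v)
  have cM' : ContinuousOn (fun t => ⟪f t, w t⟫ + ⟪v t, g t⟫) (Icc a b) :=
    (h.cont_f.inner (𝕜 := ℝ) k.cont_v).add (h.cont_v.inner (𝕜 := ℝ) k.cont_f)
  have cR : ContinuousOn (fun t => θ' t * (⟪x t, y t⟫ + ⟪v t, w t⟫) + θ t * ⟪v t, g t⟫)
      (Icc a b) :=
    (hθ'c.continuousOn.mul cM).add (hθc.continuousOn.mul (h.cont_v.inner (𝕜 := ℝ) k.cont_f))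
  have hzero := integral_eq_sub_of_hasDerivWithinAt_Icc hab.le
    (g := fun t => θ t * (⟪x t, y t⟫ + ⟪v t, w t⟫))
    (g' := fun t => θ' t * (⟪x t, y t⟫ + ⟪v t, w t⟫) + θ t * (⟪f t, w t⟫ + ⟪v t, g t⟫))
    (fun t ht => ((hdθ t).hasDerivWithinAt).fun_mul (h.hasDeriv_pairing hS hinj k ht))
    ((hθ'c.continuousOn.mul cM).add (hθc.continuousOn.mul cM'))
  have hθa : θ a = 0 := by simp [hθ]
  have hθb : θ b = 0 := by simp [hθ]
  rw [hθa, hθb, zero_mul, zero_mul, sub_zero] at hzero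
  have hid : ∫ t in a..b, θ t * -⟪f t, w t⟫
      = ∫ t in a..b, (θ' t * (⟪x t, y t⟫ + ⟪v t, w t⟫) + θ t * ⟪v t, g t⟫) := by
    have h1 := integral_add_Icc hab.le cR (hθc.continuousOn.mul cq.neg)
    have h2 : ∫ t in a..b, θ t * - -⟪f t, w t⟫ = - ∫ t in a..b, θ t * -⟪f t, w t⟫ := by
      rw [← intervalIntegral.integral_neg]
      congr 1; ext t; ring
    have h3 : ∫ t in a..b, (θ' t * (⟪x t, y t⟫ + ⟪v t, w t⟫) + θ t * ⟪v t, g t⟫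
        + θ t * - -⟪f t, w t⟫) = 0 := by
      rw [← hzero]; congr 1; ext t; ring
    have h1' : ∫ t in a..b, (θ' t * (⟪x t, y t⟫ + ⟪v t, w t⟫) + θ t * ⟪v t, g t⟫
        + θ t * - -⟪f t, w t⟫) = (∫ t in a..b, (θ' t * (⟪x t, y t⟫ + ⟪v t, w t⟫)
        + θ t * ⟪v t, g t⟫)) + ∫ t in a..b, θ t * - -⟪f t, w t⟫ := h1
    linarith
  have hθ0 : ∀ t ∈ Icc a b, 0 ≤ θ t := fun t ht =>
    div_nonneg (mul_nonneg (sub_nonneg.2 ht.1) (sub_nonneg.2 ht.2)) (by positivity)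
  have hθ1 : ∀ t ∈ Icc a b, θ t ≤ 1 := fun t ht => by
    simp only [hθ]
    rw [div_le_one (by positivity)]
    nlinarith [ht.1, ht.2]
  have hθ'1 : ∀ t ∈ Icc a b, |θ' t| ≤ 1 / (b - a) := fun t ht => by
    simp only [hθ']
    rw [abs_div, abs_of_pos (by positivity : (0 : ℝ) < (b - a) ^ 2),
      div_le_div_iff₀ (by positivity) hL]
    have : |b - t - (t - a)| ≤ b - a := abs_le.2 ⟨by linarith [ht.2], by linarith [ht.1]⟩
    nlinarith
  set a' := a + (b - a) / 3 with ha'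
  set b' := b - (b - a) / 3 with hb'
  have haa' : a ≤ a' := by linarith
  have hbb' : b' ≤ b := by linarith
  have hab' : a' ≤ b' := by linarith
  have hθm : ∀ t ∈ Icc a' b', 2 / 9 ≤ θ t := fun t ht => by
    simp only [hθ]
    rw [le_div_iff₀ (by positivity)]
    have h1 : 0 ≤ t - a - (b - a) / 3 := by linarith [ht.1]
    have h2 : 0 ≤ b - t - (b - a) / 3 := by linarith [ht.2]
    nlinarith [mul_nonneg h1 h2]
  have s1 : 2 / 9 * ∫ t in a'..b', -⟪f t, w t⟫ ≤ ∫ t in a'..b', θ t * -⟪f t, w t⟫ := by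
    rw [← intervalIntegral.integral_const_mul]
    have hsub : Icc a' b' ⊆ Icc a b := Icc_subset_Icc haa' hbb'
    exact integral_mono_Icc hab' (continuousOn_const.mul (cq.mono hsub))
      (hθc.continuousOn.mul (cq.mono hsub))
      fun t ht => mul_le_mul_of_nonneg_right (hθm t ht) (hq t (hsub ht))
  have s2 : ∫ t in a'..b', θ t * -⟪f t, w t⟫ ≤ ∫ t in a..b, θ t * -⟪f t, w t⟫ :=
    integral_mono_of_Icc_subset (hθc.continuousOn.mul cq)
      (fun t ht => mul_nonneg (hθ0 t ht) (hq t ht)) haa' hab' hbb'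
  have s3 := integral_le_of_le_affine hab.le cR h.cont_en fun t ht => by
    refine le_trans ?_ (hk t ht)
    have e1 : |⟪x t, y t⟫ + ⟪v t, w t⟫| ≤ ‖x t‖ * ‖y t‖ + ‖v t‖ * ‖w t‖ :=
      (abs_add_le _ _).trans (add_le_add (abs_real_inner_le_norm _ _) (abs_real_inner_le_norm _ _))
    refine add_le_add ?_ ?_
    · refine (le_abs_self _).trans ?_
      rw [abs_mul, div_eq_mul_one_div, mul_comm]
      exact mul_le_mul e1 (hθ'1 t ht) (abs_nonneg _) (by positivity)
    · refine (le_abs_self _).trans ?_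
      rw [abs_mul, abs_of_nonneg (hθ0 t ht)]
      calc θ t * |⟪v t, g t⟫| ≤ 1 * (‖v t‖ * ‖g t‖) :=
            mul_le_mul (hθ1 t ht) (abs_real_inner_le_norm _ _) (abs_nonneg _) zero_le_one
        _ = _ := one_mul _
  linarith

/-- `(x i, v i)`, `1 ≤ i ≤ n`, solve `w_i'' + A w_i + D_i w_{i-1}' = 0` in reduced form, with
`w_0 = 0`. -/
structure VelChain (S : E →L[ℝ] E) (D : ℕ → E →L[ℝ] E) (n : ℕ) (T : ℝ) (x v : ℕ → ℝ → E) :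
    Prop where
  x_zero : ∀ t, x 0 t = 0
  v_zero : ∀ t, v 0 t = 0
  sol : ∀ i < n, RedSol S 0 T (x (i + 1)) (v (i + 1)) (fun t => -D (i + 1) (v i t))

theorem mul_le_weighted {x y μ : ℝ} (hμ : 0 < μ) : x * y ≤ μ / 2 * y ^ 2 + 1 / (2 * μ) * x ^ 2 := by
  have : μ / 2 * y ^ 2 + 1 / (2 * μ) * x ^ 2 - x * y = (μ * y - x) ^ 2 / (2 * μ) := by
    field_simp; ring
  rw [← sub_nonneg, this]
  positivity

/-- The last energy of a chain controls the preceding energies, on any subinterval that is not too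
short. -/
def ChainEstimate (S : E →L[ℝ] E) (D : ℕ → E →L[ℝ] E) (n : ℕ) : Prop :=
  ∀ l : ℝ, 0 < l → ∃ c T₁ : ℝ, 0 < c ∧ 0 < T₁ ∧ ∀ (T : ℝ) (x v : ℕ → ℝ → E), T₁ ≤ T →
    VelChain S D n T x v → ∀ a b : ℝ, 0 ≤ a → b ≤ T → l * T ≤ b - a →
      (∀ j < n, ∀ t ∈ Icc 0 T, en (x j t) (v j t) ≤ c / T ^ 3 * ∫ s in a..b, en (x n s) (v n s)) ∧
      ∀ t ∈ Icc 0 T, en (x n t) (v n t) ≤ c / T * ∫ s in a..b, en (x n s) (v n s)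

/-- A chain of length one is a free solution of constant energy, so the integral over [a, b] is b -
a ≥ lT times that energy. -/
theorem chainEstimate_one (hS : S.IsPositive) (hinj : Function.Injective S)
    (D : ℕ → E →L[ℝ] E) : ChainEstimate S D 1 := by
  intro l hl
  refine ⟨1 / l, 1, by positivity, one_pos, fun T x v hT h a b ha hb hab => ?_⟩
  have hT0 : 0 < T := by linarith
  have hlT : 0 < l * T := by positivity
  have hfree : RedSol S 0 T (x 1) (v 1) (fun _ => 0) := by
    simpa [h.v_zero] using h.sol 0 one_pos
  have hZ : ∀ t ∈ Icc 0 T, ∫ s in a..b, en (x 1 s) (v 1 s) = (b - a) * en (x 1 t) (v 1 t) := by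
    intro t ht
    rw [← smul_eq_mul, ← intervalIntegral.integral_const]
    refine intervalIntegral.integral_congr fun s hs => ?_
    rw [uIcc_of_le (by linarith)] at hs
    exact hfree.en_eq_of_free hS hinj ht ⟨ha.trans hs.1, hs.2.trans hb⟩
  constructor
  · intro j hj t ht
    obtain rfl : j = 0 := by omega
    rw [h.x_zero, h.v_zero, hZ t ht]
    have := en_nonneg (x 1 t) (v 1 t)
    have : 0 ≤ b - a := by linarith
    have : en (0 : E) (0 : E) = 0 := by simp [en]
    rw [this]
    positivity
  · intro t ht
    have h0 := en_nonneg (x 1 t) (v 1 t)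
    rw [hZ t ht, ← mul_assoc]
    refine le_mul_of_one_le_left h0 ?_
    rw [div_div, one_div, inv_mul_eq_div, one_le_div hlT]
    exact hab

/-- Let (X, V) be the new last component and (y, w) the one before it. The multiplier estimate
bounds ∫⟨Dw, w⟩ over the middle third of [a, b], and velocity observability through `P` turns this
into a bound for the energy Y of (y, w) there. The induction hypothesis, applied on that third,
controls the remaining terms by Y; this is why the estimate is required on subintervals of length lT
for every l. Young's inequality absorbs Y and leaves Y ≤ κT⁻²Z, with Z the integrated energy of (X,
V). The factor T⁻² lowers the order of (y, w) from T⁻¹ to T⁻³. -/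
theorem ChainEstimate.succ (hS : S.IsPositive) (hinj : Function.Injective S)
    (hK : IsCompactOperator (S * S : E →L[ℝ] E)) {D : ℕ → E →L[ℝ] E} {m : ℕ} {P : E →L[ℝ] E}
    {α : ℝ} (hα : 0 < α) (hD : ∀ x, α * ‖P x‖ ^ 2 ≤ ⟪D (m + 2) x, x⟫)
    (hP : RedObservesVelocity S P) (hm : ChainEstimate S D (m + 1)) :
    ChainEstimate S D (m + 2) := by
  intro l hl
  obtain ⟨c, T₁, hc, hT₁, hIH⟩ := hm (l / 3) (by positivity)
  obtain ⟨τ, Q, hτ, hQ, hobs⟩ := hP.exists_integral_en_le hS hinj hK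
  set d := ‖D (m + 1)‖ with hd
  set d' := ‖D (m + 2)‖ with hd'
  -- In the multiplier estimate the products with the energy norms of y, w are split with Young
  -- weight ηT and the product with the source of (y, w) with weight ηT². Then ηcs/T is the
  -- coefficient of Y and k/T² that of the energy of (X, V). The value of `η` makes the Y-term equal
  -- to Y/2 after multiplication by 9Q/α, and `κ` is what then remains in front of Z/T².
  set s := 1 / l + d ^ 2 with hs
  have hspos : 0 < s := by positivity
  set η := α / (18 * Q * c * s) with hη
  have hηpos : 0 < η := by positivity
  set k := (1 / l + 1) / η with hk
  have hkpos : 0 < k := by positivity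
  set κ := 18 * Q * k / α with hκ
  have hκpos : 0 < κ := by positivity
  -- cκ serves the preceding components, 2/l comes from averaging the last energy over [a, b], and
  -- 4d'²cκ from its source. The thresholds allow the induction hypothesis, the comparison of powers
  -- of T, a middle third of length at least τ, and the absorption of the source of (y, w) in Y/2.
  refine ⟨c * κ + 2 / l + 4 * d' ^ 2 * c * κ, max T₁ (max 1 (max (3 * τ / l) (4 * Q * d ^ 2 * c))),
    by positivity, by positivity, fun T x v hT h a b ha hb hab => ?_⟩
  simp only [max_le_iff] at hT
  obtain ⟨hTT₁, hT1, hTτ, hTQ⟩ := hT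
  have hT0 : 0 < T := by linarith
  have hlT : 0 < l * T := by positivity
  have hab0 : a < b := by linarith
  set X := x (m + 2) with hX
  set V := v (m + 2) with hV
  set y := x (m + 1) with hy
  set w := v (m + 1) with hw
  have hXV : RedSol S 0 T X V (fun t => -D (m + 2) (w t)) := h.sol (m + 1) (by omega)
  have hyw : RedSol S 0 T y w (fun t => -D (m + 1) (v m t)) := h.sol m (by omega)
  have hchain : VelChain S D (m + 1) T x v := ⟨h.x_zero, h.v_zero, fun i hi => h.sol i (by omega)⟩
  set a' := a + (b - a) / 3 with ha'
  set b' := b - (b - a) / 3 with hb'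
  have hba' : b' - a' = (b - a) / 3 := by rw [ha', hb']; ring
  obtain ⟨ih1, ih2⟩ := hIH T x v hTT₁ hchain a' b' (by linarith) (by linarith)
    (by rw [hba']; linarith)
  set Y := ∫ t in a'..b', en (y t) (w t) with hY
  set Z := ∫ t in a..b, en (X t) (V t) with hZ
  have hY0 : 0 ≤ Y := integral_nonneg_Icc (by linarith) fun _ _ => en_nonneg _ _
  have hZ0 : 0 ≤ Z := integral_nonneg_Icc hab0.le fun _ _ => en_nonneg _ _
  have hm' : ∀ t ∈ Icc 0 T, ‖D (m + 1) (v m t)‖ ^ 2 ≤ 2 * d ^ 2 * (c / T ^ 3 * Y) := by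
    intro t ht
    have e1 := norm_sq_le_opNorm (D (m + 1)) (v m t)
    have e2 := norm_sq_snd_le_en (x m t) (v m t)
    have e3 := ih1 m (by omega) t ht
    have e4 := mul_le_mul_of_nonneg_left (e2.trans (mul_le_mul_of_nonneg_left e3 zero_le_two))
      (sq_nonneg d)
    linarith
  -- the observed quantity controls `Y`
  have hYcoer : Y ≤ 2 * Q / α * ∫ t in a'..b', ⟪D (m + 2) (w t), w t⟫ := by
    have hsub := hyw.mono (show (0 : ℝ) ≤ a' by linarith) (show b' ≤ T by linarith)
    have hsubI : Icc a' b' ⊆ Icc 0 T := Icc_subset_Icc (by linarith) (by linarith)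
    have o1 := hobs a' b' y w _ (by rw [hba']; rw [div_le_iff₀ hl] at hTτ; linarith) hsub
    simp only [norm_neg] at o1
    have hcD : ContinuousOn (fun t => ‖D (m + 1) (v m t)‖ ^ 2) (Icc a' b') := by
      simpa only [norm_neg] using hsub.cont_norm_sq_f
    have o2 := integral_mono_Icc (by linarith) hcD continuousOn_const
      fun t ht => hm' t (hsubI ht)
    rw [intervalIntegral.integral_const, smul_eq_mul] at o2
    have o3 : (b' - a') * (2 * d ^ 2 * (c / T ^ 3 * Y)) ≤ 2 * d ^ 2 * c / T * Y := by
      calc (b' - a') * (2 * d ^ 2 * (c / T ^ 3 * Y))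
          ≤ T * (2 * d ^ 2 * (c / T ^ 3 * Y)) := by gcongr; linarith
        _ = 2 * d ^ 2 * c / T * Y * (1 / T) := by field_simp
        _ ≤ 2 * d ^ 2 * c / T * Y * 1 := by
            gcongr; rw [div_le_one hT0]; exact hT1
        _ = _ := mul_one _
    have o4 : Q * (2 * d ^ 2 * c / T * Y) ≤ Y / 2 := by
      have : Q * (2 * d ^ 2 * c / T * Y) = (4 * Q * d ^ 2 * c) / T * (Y / 2) := by ring
      rw [this]
      exact mul_le_of_le_one_left (by positivity) ((div_le_one hT0).2 hTQ)
    have hcq : ContinuousOn (fun t => ⟪D (m + 2) (w t), w t⟫) (Icc a' b') :=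
      ((D (m + 2)).continuous.comp_continuousOn hsub.cont_v).inner (𝕜 := ℝ) hsub.cont_v
    have o5 : ∫ t in a'..b', ‖P (w t)‖ ^ 2 ≤ 1 / α * ∫ t in a'..b', ⟪D (m + 2) (w t), w t⟫ := by
      rw [← intervalIntegral.integral_const_mul]
      refine integral_mono_Icc (by linarith) (hsub.cont_norm_sq_map P) (continuousOn_const.mul hcq)
        fun t _ => ?_
      rw [one_div, inv_mul_eq_div, le_div_iff₀ hα, mul_comm]
      exact hD (w t)
    have o6 := mul_le_mul_of_nonneg_left o5 hQ.le
    have o7 := mul_le_mul_of_nonneg_left (o2.trans o3) hQ.le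
    have e : 2 * Q / α * ∫ t in a'..b', ⟪D (m + 2) (w t), w t⟫
        = 2 * (Q * (1 / α * ∫ t in a'..b', ⟪D (m + 2) (w t), w t⟫)) := by ring
    rw [e]
    linarith
  have hcoer := (hXV.mono ha hb).integral_coupling_le hS hinj hab0 (hyw.mono ha hb)
    (k₁ := k / T ^ 2) (k₂ := η * c * s / T * Y)
    (fun t _ => by
      rw [inner_neg_left, neg_neg]
      exact (mul_nonneg hα.le (sq_nonneg _)).trans (hD (w t)))
    (fun t ht => by
      have ht' : t ∈ Icc 0 T := ⟨ha.trans ht.1, ht.2.trans hb⟩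
      have e1 : ‖X t‖ * ‖y t‖ + ‖V t‖ * ‖w t‖ ≤ η * T * en (y t) (w t)
          + 1 / (η * T) * en (X t) (V t) := by
        have f1 := mul_le_weighted (x := ‖X t‖) (y := ‖y t‖) (mul_pos hηpos hT0)
        have f2 := mul_le_weighted (x := ‖V t‖) (y := ‖w t‖) (mul_pos hηpos hT0)
        unfold en
        have f3 : 1 / (2 * (η * T)) = 1 / (η * T) * (1 / 2) := by field_simp
        rw [f3] at f1 f2
        linarith
      have e2 : ‖V t‖ * ‖D (m + 1) (v m t)‖ ≤ η * T ^ 2 / 2 * (2 * d ^ 2 * (c / T ^ 3 * Y))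
          + 1 / (η * T ^ 2) * en (X t) (V t) := by
        have f1 := mul_le_weighted (x := ‖V t‖) (y := ‖D (m + 1) (v m t)‖)
          (show 0 < η * T ^ 2 by positivity)
        have f2 := mul_le_mul_of_nonneg_left (hm' t ht') (show 0 ≤ η * T ^ 2 / 2 by positivity)
        have f3 := mul_le_mul_of_nonneg_left (norm_sq_snd_le_en (X t) (V t))
          (show 0 ≤ 1 / (2 * (η * T ^ 2)) by positivity)
        have f4 : 1 / (2 * (η * T ^ 2)) * (2 * en (X t) (V t))
          = 1 / (η * T ^ 2) * en (X t) (V t) := by field_simp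
        linarith
      have e3 : (‖X t‖ * ‖y t‖ + ‖V t‖ * ‖w t‖) / (b - a)
          ≤ (η * T * (c / T * Y) + 1 / (η * T) * en (X t) (V t)) / (l * T) := by
        refine div_le_div₀ ?_ (e1.trans ?_) hlT hab
        · have := en_nonneg (X t) (V t); positivity
        · have := mul_le_mul_of_nonneg_left (ih2 t ht') (show 0 ≤ η * T by positivity)
          linarith
      rw [norm_neg]
      refine (add_le_add e3 e2).trans_eq ?_
      rw [hk, hs]
      field_simp
      ring)
  simp only [inner_neg_left, neg_neg] at hcoer
  rw [← ha', ← hb', ← hZ] at hcoer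
  have hYZ : Y ≤ κ / T ^ 2 * Z := by
    set q := ∫ t in a'..b', ⟪D (m + 2) (w t), w t⟫ with hq
    have e1 : η * c * s / T * Y * (b - a) ≤ η * c * s * Y := by
      calc η * c * s / T * Y * (b - a) ≤ η * c * s / T * Y * T := by gcongr; linarith
        _ = _ := by field_simp
    have e2 : 9 * Q / α * (η * c * s * Y) = Y / 2 := by
      rw [hη]; field_simp; ring
    have e3 : 2 * Q / α * q = 9 * Q / α * (2 / 9 * q) := by ring
    have e4 := mul_le_mul_of_nonneg_left (hcoer.trans (add_le_add le_rfl e1))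
      (show 0 ≤ 9 * Q / α by positivity)
    rw [mul_add, e2] at e4
    have e5 : 9 * Q / α * (k / T ^ 2 * Z) = κ / T ^ 2 * Z / 2 := by rw [hκ]; ring
    rw [e5] at e4
    linarith
  have hmid : ∀ t ∈ Icc 0 T, en (y t) (w t) ≤ c * κ / T ^ 3 * Z := fun t ht => by
    refine (ih2 t ht).trans ((mul_le_mul_of_nonneg_left hYZ (by positivity)).trans_eq ?_)
    field_simp
  have hrest : 0 ≤ 2 / l + 4 * d' ^ 2 * c * κ := by positivity
  have hfin : c * κ / T ^ 3 * Z ≤ (c * κ + 2 / l + 4 * d' ^ 2 * c * κ) / T ^ 3 * Z := by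
    gcongr; linarith
  constructor
  · intro j hj t ht
    rcases Nat.lt_succ_iff_lt_or_eq.1 hj with hj | rfl
    · refine (ih1 j hj t ht).trans (le_trans ?_ hfin)
      have e1 : Y ≤ κ * Z := hYZ.trans (by
        gcongr
        exact div_le_self hκpos.le (one_le_pow₀ hT1))
      refine (mul_le_mul_of_nonneg_left e1 (by positivity)).trans_eq ?_
      ring
    · exact (hmid t ht).trans hfin
  · intro t ht
    have hF : ∫ r in (0 : ℝ)..T, ‖-D (m + 2) (w r)‖ ^ 2 ≤ T * (2 * d' ^ 2 * (c * κ / T ^ 3 * Z)) := by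
      have o2 := integral_mono_Icc hT0.le hXV.cont_norm_sq_f
        (continuousOn_const (c := 2 * d' ^ 2 * (c * κ / T ^ 3 * Z))) fun r hr => by
        have e1 := norm_sq_le_opNorm (D (m + 2)) (w r)
        have e2 := norm_sq_snd_le_en (y r) (w r)
        have e4 := mul_le_mul_of_nonneg_left (e2.trans (mul_le_mul_of_nonneg_left (hmid r hr)
          zero_le_two)) (sq_nonneg d')
        rw [norm_neg]
        linarith
      rwa [intervalIntegral.integral_const, smul_eq_mul, sub_zero] at o2
    -- The energy at `t` is compared with that at every `r` in [a, b] and then averaged over `r`.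
    -- The source contributes only at order 1/T, because its squared norm is already of order Z/T³.
    have hpt : ∀ r ∈ Icc a b, en (X t) (V t) ≤ 2 * en (X r) (V r) + 4 * d' ^ 2 * c * κ / T * Z := by
      intro r hr
      have e1 := hXV.en_le hS hinj (s := r) (t := t) ⟨ha.trans hr.1, hr.2.trans hb⟩ ht
      rw [sub_zero] at e1
      have e2 := mul_le_mul_of_nonneg_left hF hT0.le
      have e3 : T * (T * (2 * d' ^ 2 * (c * κ / T ^ 3 * Z))) * 2 = 4 * d' ^ 2 * c * κ / T * Z := by
        field_simp; ring
      linarith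
    have e1 := integral_le_of_le_affine hab0.le continuousOn_const
      (hXV.mono ha hb).cont_en hpt
    rw [intervalIntegral.integral_const, smul_eq_mul, ← hZ] at e1
    have e2 : en (X t) (V t) - 4 * d' ^ 2 * c * κ / T * Z ≤ 2 * Z / (b - a) := by
      rw [le_div_iff₀ (by linarith)]; linarith
    have e3 : 2 * Z / (b - a) ≤ 2 * Z / (l * T) := by gcongr
    have e4 : 0 ≤ c * κ / T * Z := by positivity
    have e5 : (c * κ + 2 / l + 4 * d' ^ 2 * c * κ) / T * Z
        = c * κ / T * Z + 2 * Z / (l * T) + 4 * d' ^ 2 * c * κ / T * Z := by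
      field_simp
    rw [e5]
    linarith

theorem chainEstimate (hS : S.IsPositive) (hinj : Function.Injective S)
    (hK : IsCompactOperator (S * S : E →L[ℝ] E)) {D P : ℕ → E →L[ℝ] E} {n : ℕ} (hn : 1 ≤ n)
    (hD : ∀ i ∈ Finset.Icc 2 n, ∃ α : ℝ, 0 < α ∧ ∀ x, α * ‖P i x‖ ^ 2 ≤ ⟪D i x, x⟫)
    (hP : ∀ i ∈ Finset.Icc 2 n, RedObservesVelocity S (P i)) : ChainEstimate S D n := by
  induction n, hn using Nat.le_induction with
  | base => exact chainEstimate_one hS hinj D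
  | succ n hn ih =>
    obtain ⟨m, rfl⟩ : ∃ m, n = m + 1 := ⟨n - 1, by omega⟩
    have hmem : m + 1 + 1 ∈ Finset.Icc 2 (m + 1 + 1) := by simp
    obtain ⟨α, hα, hDα⟩ := hD _ hmem
    exact ChainEstimate.succ hS hinj hK hα hDα (hP _ hmem)
      (ih (fun i hi => hD i (by simp at hi ⊢; omega)) fun i hi => hP i (by simp at hi ⊢; omega))

end Cascade

namespace Cascade

variable {E : Type*} [NormedAddCommGroup E] [InnerProductSpace ℝ E] [CompleteSpace E]
  {S : E →L[ℝ] E}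

/-! ### Time primitives of a cascade -/

/-- `(x i, v i) = (A^{1/2} u_i, u_i')`, `1 ≤ i ≤ n`, for solutions of
`u_i'' + A u_i + D_i u_{i-1} = 0` with `u_0 = 0`. -/
structure DispChain (S : E →L[ℝ] E) (D : ℕ → E →L[ℝ] E) (n : ℕ) (T : ℝ) (x v : ℕ → ℝ → E) :
    Prop where
  x_zero : ∀ t, x 0 t = 0
  v_zero : ∀ t, v 0 t = 0
  sol : ∀ i < n, RedSol S 0 T (x (i + 1)) (v (i + 1)) (fun t => -D (i + 1) (S (x i t)))

/-- `prim S D x v k j` is the `(k - 1)`-st time primitive of `u_j = S x_j` (and `u_j' = v_j` for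
`k = 0`), the constants of integration being chosen such that the primitives solve the same
cascade. -/
noncomputable def prim (S : E →L[ℝ] E) (D : ℕ → E →L[ℝ] E) (x v : ℕ → E) : ℕ → ℕ → E
  | 0, j => v j
  | 1, j => S (x j)
  | _ + 2, 0 => 0
  -- The equation p'' + Ap + Dq = 0 reads p = -A⁻¹(p'' + Dq), where p'' is the primitive of order
  -- two less. So primitives are defined algebraically, without integrating.
  | k + 2, j + 1 => -S (S (prim S D x v k (j + 1) + D (j + 1) (prim S D x v (k + 2) j)))

/-- The preimage of `prim S D x v (k + 1) j` under `S`. -/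
noncomputable def primHalf (S : E →L[ℝ] E) (D : ℕ → E →L[ℝ] E) (x v : ℕ → E) : ℕ → ℕ → E
  | 0, j => x j
  | _ + 1, 0 => 0
  | k + 1, j + 1 => -S (prim S D x v k (j + 1) + D (j + 1) (prim S D x v (k + 2) j))

theorem prim_zero_left (D : ℕ → E →L[ℝ] E) (x v : ℕ → E) (j : ℕ) : prim S D x v 0 j = v j := by
  simp [prim]

theorem prim_one_left (D : ℕ → E →L[ℝ] E) (x v : ℕ → E) (j : ℕ) :
    prim S D x v 1 j = S (x j) := by
  simp [prim]

theorem primHalf_zero_left (D : ℕ → E →L[ℝ] E) (x v : ℕ → E) (j : ℕ) :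
    primHalf S D x v 0 j = x j := by
  simp [primHalf]

theorem map_primHalf (D : ℕ → E →L[ℝ] E) (x v : ℕ → E) (k j : ℕ) :
    S (primHalf S D x v k j) = prim S D x v (k + 1) j := by
  rcases k with _ | k
  · simp [primHalf, prim]
  · rcases j with _ | j <;> simp [primHalf, prim]

theorem primHalf_zero_right (D : ℕ → E →L[ℝ] E) {x v : ℕ → E} (hx : x 0 = 0) (k : ℕ) :
    primHalf S D x v k 0 = 0 := by
  rcases k with _ | k <;> simp [primHalf, hx]

theorem prim_zero_right (D : ℕ → E →L[ℝ] E) {x v : ℕ → E} (hx : x 0 = 0) (hv : v 0 = 0) (k : ℕ) :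
    prim S D x v k 0 = 0 := by
  rcases k with _ | k
  · simp [prim, hv]
  · rw [← map_primHalf, primHalf_zero_right D hx, map_zero]

theorem primHalf_succ_succ (D : ℕ → E →L[ℝ] E) (x v : ℕ → E) (k j : ℕ) :
    primHalf S D x v (k + 1) (j + 1)
      = -S (prim S D x v k (j + 1) + D (j + 1) (prim S D x v (k + 2) j)) := by
  simp [primHalf]

/-- Outer induction on the order of the primitive, inner induction on the component. The formula for
component i + 1 at the next order contains a primitive of component i, whose derivative is supplied
by the inner hypothesis at the same order; differentiating the formula then reproduces the equation.
-/
theorem DispChain.redSol_prim {D : ℕ → E →L[ℝ] E} {n : ℕ} {T : ℝ} {x v : ℕ → ℝ → E}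
    (h : DispChain S D n T x v) (k i : ℕ) (hi : i < n) :
    RedSol S 0 T (fun t => primHalf S D (fun j => x j t) (fun j => v j t) k (i + 1))
      (fun t => prim S D (fun j => x j t) (fun j => v j t) k (i + 1))
      (fun t => -D (i + 1) (prim S D (fun j => x j t) (fun j => v j t) (k + 1) i)) := by
  induction k generalizing i with
  | zero => simpa [primHalf, prim] using h.sol i hi
  | succ k ihk =>
    induction i with
    | zero =>
      have h0 : ∀ k t, prim S D (fun j => x j t) (fun j => v j t) k 0 = 0 := fun k t =>
        prim_zero_right D (h.x_zero t) (h.v_zero t) k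
      have hk := ihk 0 hi
      simp only [h0, map_zero, neg_zero] at hk ⊢
      have e1 : ∀ t, primHalf S D (fun j => x j t) (fun j => v j t) (k + 1) (0 + 1)
          = -S (prim S D (fun j => x j t) (fun j => v j t) k (0 + 1)) := fun t => by
        rw [primHalf_succ_succ, h0, map_zero, add_zero]
      have e2 : ∀ t, prim S D (fun j => x j t) (fun j => v j t) (k + 1) (0 + 1)
          = S (primHalf S D (fun j => x j t) (fun j => v j t) k (0 + 1)) := fun t =>
        (map_primHalf D _ _ k _).symm
      simp only [e1, e2]
      refine ⟨(S.continuous.comp_continuousOn hk.cont_v).neg,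
        S.continuous.comp_continuousOn hk.cont_x, continuousOn_const, fun t ht => ?_, fun t ht => ?_⟩
      · have d := (S.hasFDerivAt.comp_hasDerivWithinAt t (hk.deriv_v t ht)).fun_neg
        simpa [Function.comp_def] using d
      · have d := S.hasFDerivAt.comp_hasDerivWithinAt t (hk.deriv_x t ht)
        simpa [Function.comp_def] using d
    | succ i ihi =>
      have hk := ihk (i + 1) hi
      have hp := ihi (by omega)
      have dp := hp.deriv_x
      simp only [map_primHalf] at dp
      have cp : ContinuousOn (fun t => prim S D (fun j => x j t) (fun j => v j t) (k + 2) (i + 1))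
          (Icc 0 T) := fun t ht => (dp t ht).continuousWithinAt
      have e2 : ∀ t, prim S D (fun j => x j t) (fun j => v j t) (k + 1) (i + 1 + 1)
          = S (primHalf S D (fun j => x j t) (fun j => v j t) k (i + 1 + 1)) := fun t =>
        (map_primHalf D _ _ k _).symm
      simp only [primHalf_succ_succ D _ _ k (i + 1), e2]
      refine ⟨(S.continuous.comp_continuousOn (hk.cont_v.add
        ((D (i + 1 + 1)).continuous.comp_continuousOn cp))).neg,
        S.continuous.comp_continuousOn hk.cont_x,
        ((D (i + 1 + 1)).continuous.comp_continuousOn cp).neg, fun t ht => ?_, fun t ht => ?_⟩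
      · have d1 := (S.comp S).hasFDerivAt.comp_hasDerivWithinAt t
          ((D (i + 1 + 1)).hasFDerivAt.comp_hasDerivWithinAt t (dp t ht))
        have d2 := S.hasFDerivAt.comp_hasDerivWithinAt t (hk.deriv_v t ht)
        have d3 := (d2.fun_add d1).fun_neg
        simp only [Function.comp_def, ContinuousLinearMap.comp_apply] at d3
        simp only [map_neg, map_add]
        refine d3.congr_deriv ?_
        simp only [map_neg, map_sub]
        abel
      · have d := S.hasFDerivAt.comp_hasDerivWithinAt t (hk.deriv_x t ht)
        refine d.congr_deriv ?_
        simp only [map_neg, map_add]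
        abel

/-- Taking `n - j` primitives of `u_j` turns a cascade into a chain coupled through velocities. -/
theorem DispChain.velChain {D : ℕ → E →L[ℝ] E} {n : ℕ} {T : ℝ} {x v : ℕ → ℝ → E}
    (h : DispChain S D n T x v) :
    VelChain S D n T
      (fun j t => primHalf S D (fun i => x i t) (fun i => v i t) (n - j) j)
      (fun j t => prim S D (fun i => x i t) (fun i => v i t) (n - j) j) := by
  refine ⟨fun t => primHalf_zero_right D (h.x_zero t) _,
    fun t => prim_zero_right D (h.x_zero t) (h.v_zero t) _, fun i hi => ?_⟩
  -- The source involves component `i` at order n - (i + 1) + 1 = n - i, which is the velocity slot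
  -- of the preceding member: the coupling is now through the velocity.
  have := h.redSol_prim (n - (i + 1)) i hi
  rwa [show n - (i + 1) + 1 = n - i by omega] at this

/-! ### Comparison of the energies of a cascade and of its primitives -/

/-- The norms `‖S^{r-1} prim (n-j-(r-1)) j‖`, which interpolate between the energy of the primitives
and the weakened energy of the cascade. -/
noncomputable def levelNorm (S : E →L[ℝ] E) (D : ℕ → E →L[ℝ] E) (x v : ℕ → E) (n j : ℕ) : ℕ → ℝ
  | 0 => ‖primHalf S D x v (n - j) j‖
  | r + 1 => ‖(S ^ r) (prim S D x v (n - j - r) j)‖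

theorem levelNorm_nonneg (D : ℕ → E →L[ℝ] E) (x v : ℕ → E) (n j r : ℕ) :
    0 ≤ levelNorm S D x v n j r := by
  rcases r with _ | r <;> exact norm_nonneg _

theorem levelNorm_zero (D : ℕ → E →L[ℝ] E) {x v : ℕ → E} (hx : x 0 = 0) (hv : v 0 = 0) (n r : ℕ) :
    levelNorm S D x v n 0 r = 0 := by
  rcases r with _ | r
  · simp [levelNorm, primHalf_zero_right D hx]
  · simp [levelNorm, prim_zero_right D hx hv]

/-- After applying powers of `S`, the recursive formula for the primitives says that the quantities
at levels r and r + 2 are opposite up to a term S^{r+1}D applied to the preceding component, which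
is bounded in the weak norm |S^{r+1}·|. Levels of equal parity are thus comparable. -/
theorem abs_levelNorm_sub_le {D : ℕ → E →L[ℝ] E} {n : ℕ} {K : ℝ} (hK : 0 ≤ K)
    (hD : ∀ i < n, ∀ r ≤ n - (i + 1), ∀ z, ‖(S ^ r) (D (i + 1) z)‖ ≤ K * ‖(S ^ r) z‖)
    (x v : ℕ → E) {i r : ℕ} (hi : i < n) (hr : r + 1 ≤ n - (i + 1)) :
    |levelNorm S D x v n (i + 1) (r + 2) - levelNorm S D x v n (i + 1) r|
      ≤ K * ‖S‖ * levelNorm S D x v n i (r + 1) := by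
  set m := n - (i + 1) with hm
  obtain ⟨k, hk⟩ : ∃ k, m = k + (r + 1) := ⟨m - (r + 1), by omega⟩
  have hni : n - i = m + 1 := by omega
  have e1 : (S ^ (r + 1)) (prim S D x v (k + 2) i)
      = S ((S ^ r) (prim S D x v (n - i - r) i)) := by
    rw [show n - i - r = k + 2 by omega, pow_succ', mul_apply_eq_comp]
  have e2 : ‖(S ^ (r + 1)) (D (i + 1) (prim S D x v (k + 2) i))‖
      ≤ K * ‖S‖ * levelNorm S D x v n i (r + 1) := by
    refine (hD i hi (r + 1) hr _).trans ?_
    rw [e1, mul_assoc]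
    exact mul_le_mul_of_nonneg_left (S.le_opNorm _) hK
  refine le_trans ?_ e2
  have key : ∀ y z w : E, y + z = -w → |‖y‖ - ‖z‖| ≤ ‖w‖ := fun y z w hyz => by
    have := abs_norm_sub_norm_le y (-z)
    rwa [norm_neg, sub_neg_eq_add, hyz, norm_neg] at this
  rcases r with _ | r
  · refine key _ _ _ ?_
    rw [← hm, hk]
    rw [show k + (0 + 1) - (0 + 1) = k by omega, show k + (0 + 1) = k + 1 from rfl,
      primHalf_succ_succ]
    simp
  · refine key _ _ _ ?_
    rw [← hm, hk]
    rw [show k + (r + 1 + 1) - (r + 1 + 1) = k by omega,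
      show k + (r + 1 + 1) - r = (k + 1) + 1 by omega, ← map_primHalf, primHalf_succ_succ]
    have e3 : ∀ z, (S ^ (r + 1 + 1)) z = (S ^ r) (S (S z)) := fun z => by
      rw [pow_succ, pow_succ]; rfl
    simp only [e3, map_neg, map_add]
    abel

/-- A discrete Gronwall argument on the table `N`. In each row two starting values are known, and at
most n + 1 steps of size two are made, each costing K times a bound for the preceding row. -/
theorem le_pow_mul_of_step {n : ℕ} {K M : ℝ} (hK : 0 ≤ K) (hM : 0 ≤ M) {N : ℕ → ℕ → ℝ} {J : ℕ}
    (hJ : J ≤ n) (h0 : ∀ r, N 0 r = 0)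
    (hstep : ∀ i < n, ∀ r, r + 1 ≤ n - (i + 1) → ∃ r' ≤ n - i + 1,
      N (i + 1) (r + 2) ≤ N (i + 1) r + K * N i r')
    (hM0 : ∀ i ≤ J, N i 0 ≤ M) (hM1 : ∀ i ≤ J, N i 1 ≤ M) :
    ∀ j ≤ J, ∀ r ≤ n - j + 1, N j r ≤ (1 + (n + 1) * K) ^ j * M := by
  intro j
  induction j with
  | zero => intro _ r _; simpa [h0] using hM
  | succ j ih =>
    intro hj
    have hjn : j < n := by omega
    have ih' := ih (by omega)
    set c := (1 + (n + 1) * K) ^ j with hc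
    have hc1 : 1 ≤ c := one_le_pow₀ (by nlinarith [(by positivity : (0 : ℝ) ≤ (n + 1) * K)])
    have hKcM : 0 ≤ K * (c * M) := by positivity
    have key : ∀ r, r ≤ n - (j + 1) + 1 → N (j + 1) r ≤ M + r * (K * (c * M)) := by
      intro r
      induction r using Nat.twoStepInduction with
      | zero => intro _; simpa using hM0 (j + 1) hj
      | one =>
        intro _
        have := hM1 (j + 1) hj
        simp only [Nat.cast_one, one_mul]
        linarith
      | more r ihr _ =>
        intro hr
        obtain ⟨r', hr', hle⟩ := hstep j hjn r (by omega)
        have h1 := ihr (by omega)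
        have h2 := mul_le_mul_of_nonneg_left (ih' r' hr') hK
        push_cast
        linarith
    intro r hr
    have hrn : (r : ℝ) ≤ n + 1 := by exact_mod_cast (by omega : r ≤ n + 1)
    refine (key r hr).trans ?_
    have h1 : (r : ℝ) * (K * (c * M)) ≤ (n + 1) * (K * (c * M)) := by gcongr
    have h2 : M ≤ c * M := le_mul_of_one_le_left hM hc1
    rw [pow_succ, ← hc]
    nlinarith

/-- The energy of level `1 + j - n` of `(u_j, u_j')`. -/
noncomputable def weakEn (S : E →L[ℝ] E) (D : ℕ → E →L[ℝ] E) (x v : ℕ → E) (n j : ℕ) : ℝ :=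
  (1 / 2) * (levelNorm S D x v n j (n - j) ^ 2 + levelNorm S D x v n j (n - j + 1) ^ 2)

/-- The energy of the `(n - j)`-th primitive of `(u_j, u_j')`. -/
noncomputable def primEn (S : E →L[ℝ] E) (D : ℕ → E →L[ℝ] E) (x v : ℕ → E) (n j : ℕ) : ℝ :=
  en (primHalf S D x v (n - j) j) (prim S D x v (n - j) j)

theorem primEn_eq (D : ℕ → E →L[ℝ] E) (x v : ℕ → E) (n j : ℕ) :
    primEn S D x v n j
      = (1 / 2) * (levelNorm S D x v n j 0 ^ 2 + levelNorm S D x v n j 1 ^ 2) := by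
  simp [primEn, en, levelNorm]

theorem weakEn_self (D : ℕ → E →L[ℝ] E) (x v : ℕ → E) (n : ℕ) :
    weakEn S D x v n n = en (x n) (v n) := by
  simp [weakEn, en, levelNorm, primHalf, prim]

theorem primEn_self (D : ℕ → E →L[ℝ] E) (x v : ℕ → E) (n : ℕ) :
    primEn S D x v n n = en (x n) (v n) := by
  simp [primEn, primHalf, prim]

/-- The primitive energy consists of levels 0 and 1, the weak energy of the two top levels n - j and
n - j + 1, so each pair contains both parities and either determines the other along the ladder. The
cut-off `J` allows the components before the last to be treated alone, which preserves their T⁻³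
rate. -/
theorem exists_weakEn_le {D : ℕ → E →L[ℝ] E} {n : ℕ} {K : ℝ} (hK : 0 ≤ K)
    (hD : ∀ i < n, ∀ r ≤ n - (i + 1), ∀ z, ‖(S ^ r) (D (i + 1) z)‖ ≤ K * ‖(S ^ r) z‖) :
    ∃ c : ℝ, 0 < c ∧ ∀ (x v : ℕ → E), x 0 = 0 → v 0 = 0 → ∀ J ≤ n, ∀ M : ℝ, 0 ≤ M →
      ((∀ j ≤ J, primEn S D x v n j ≤ M) → ∀ j ≤ J, weakEn S D x v n j ≤ c * M) ∧
      ((∀ j ≤ J, weakEn S D x v n j ≤ M) → ∀ j ≤ J, primEn S D x v n j ≤ c * M) := by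
  set K' := K * ‖S‖ with hK'
  have hK'0 : 0 ≤ K' := by positivity
  set q := (1 + (n + 1) * K') ^ n with hq
  have hq1 : (1 : ℝ) ≤ 1 + (n + 1) * K' := by
    nlinarith [(by positivity : (0 : ℝ) ≤ (n + 1) * K')]
  refine ⟨2 * q ^ 2, by positivity, fun x v hx hv J hJ M hM => ?_⟩
  have hsplit : ∀ {y z : ℝ}, 0 ≤ y → 0 ≤ z → (1 / 2) * (y ^ 2 + z ^ 2) ≤ M →
      y ≤ √(2 * M) ∧ z ≤ √(2 * M) := fun hy hz h =>
    ⟨Real.le_sqrt_of_sq_le (by nlinarith), Real.le_sqrt_of_sq_le (by nlinarith)⟩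
  have hjoin : ∀ {y z : ℝ}, 0 ≤ y → 0 ≤ z → y ≤ q * √(2 * M) → z ≤ q * √(2 * M) →
      (1 / 2) * (y ^ 2 + z ^ 2) ≤ 2 * q ^ 2 * M := fun hy hz h1 h2 => by
    have e1 := pow_le_pow_left₀ hy h1 2
    have e2 := pow_le_pow_left₀ hz h2 2
    rw [mul_pow, Real.sq_sqrt (by positivity)] at e1 e2
    linarith
  have hpow : ∀ j ≤ J, (1 + (n + 1) * K') ^ j * √(2 * M) ≤ q * √(2 * M) := fun j hj => by
    exact mul_le_mul_of_nonneg_right (pow_le_pow_right₀ hq1 (hj.trans hJ)) (Real.sqrt_nonneg _)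
  have hn := levelNorm_nonneg (S := S) D x v n
  constructor
  · intro h j hj
    have hb : ∀ i ≤ J, levelNorm S D x v n i 0 ≤ √(2 * M) ∧ levelNorm S D x v n i 1 ≤ √(2 * M) :=
      fun i hi => hsplit (hn i 0) (hn i 1) (by rw [← primEn_eq]; exact h i hi)
    have := le_pow_mul_of_step hK'0 (Real.sqrt_nonneg (2 * M)) (N := levelNorm S D x v n) hJ
      (levelNorm_zero D hx hv n) (fun i hi r hr => ⟨r + 1, by omega, by
        have := (abs_le.1 (abs_levelNorm_sub_le hK hD x v hi hr)).2
        linarith⟩) (fun i hi => (hb i hi).1) (fun i hi => (hb i hi).2) j hj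
    exact hjoin (hn j _) (hn j _) ((this _ (by omega)).trans (hpow j hj))
      ((this _ le_rfl).trans (hpow j hj))
  -- The same ladder is descended from its top: levels are renumbered by r ↦ n - j + 1 - r.
  · intro h j hj
    have hb : ∀ i ≤ J, levelNorm S D x v n i (n - i) ≤ √(2 * M) ∧
        levelNorm S D x v n i (n - i + 1) ≤ √(2 * M) :=
      fun i hi => hsplit (hn i _) (hn i _) (h i hi)
    have := le_pow_mul_of_step hK'0 (Real.sqrt_nonneg (2 * M))
      (N := fun j r => levelNorm S D x v n j (n - j + 1 - r)) hJ
      (fun r => levelNorm_zero D hx hv n _) (fun i hi r hr => ⟨r + 2, by omega, by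
        obtain ⟨s, hs⟩ : ∃ s, n - (i + 1) = s + (r + 1) := ⟨n - (i + 1) - (r + 1), by omega⟩
        have := (abs_le.1 (abs_levelNorm_sub_le (r := s) hK hD x v hi (by omega))).1
        rw [show n - (i + 1) + 1 - (r + 2) = s by omega,
          show n - (i + 1) + 1 - r = s + 2 by omega, show n - i + 1 - (r + 2) = s + 1 by omega]
        linarith⟩) (fun i hi => by simpa using (hb i hi).2)
      (fun i hi => by simpa using (hb i hi).1) j hj
    have h1 := this (n - j) (by omega)
    have h2 := this (n - j + 1) le_rfl
    simp only [show n - j + 1 - (n - j) = 1 by omega, Nat.sub_self] at h1 h2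
    rw [primEn_eq]
    exact hjoin (hn j _) (hn j _) (h2.trans (hpow j hj)) (h1.trans (hpow j hj))

end Cascade

namespace Cascade

variable {E : Type*} [NormedAddCommGroup E] [InnerProductSpace ℝ E] [CompleteSpace E]
  {S : E →L[ℝ] E}

/-! ### The mixed cascade in reduced form -/

/-- A solution of the mixed cascade system in reduced form: a cascade of length `n`, followed by `p`
equations that are coupled to all the components from the `(n-1)`-st on. -/
structure RedMixed (S : E →L[ℝ] E) (D : ℕ → E →L[ℝ] E) (C : ℕ → ℕ → E →L[ℝ] E) (n p : ℕ) (T : ℝ)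
    (x v : ℕ → ℝ → E) : Prop where
  chain : DispChain S D n T x v
  sol : ∀ i ∈ Finset.Icc (n + 1) (n + p),
    RedSol S 0 T (x i) (v i) (fun t => -∑ k ∈ Finset.Ico (n - 1) i, C i k (S (x k t)))

theorem norm_sq_sum_map_le {ι : Type*} (s : Finset ι) (L : ι → E →L[ℝ] E) (y : ι → E) {M : ℝ}
    (hM : 0 ≤ M) (h : ∀ k ∈ s, ‖y k‖ ^ 2 ≤ M) :
    ‖∑ k ∈ s, L k (y k)‖ ^ 2 ≤ (∑ k ∈ s, ‖L k‖) ^ 2 * M := by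
  have h1 : ‖∑ k ∈ s, L k (y k)‖ ≤ (∑ k ∈ s, ‖L k‖) * √M := by
    rw [Finset.sum_mul]
    refine norm_sum_le_of_le _ fun k hk => ((L k).le_opNorm _).trans ?_
    gcongr
    exact Real.le_sqrt_of_sq_le (h k hk)
  refine (pow_le_pow_left₀ (norm_nonneg _) h1 2).trans_eq ?_
  rw [mul_pow, Real.sq_sqrt hM]

namespace RedSol

variable {T F : ℝ} {x v f : ℝ → E}

theorem integral_norm_sq_le (hT : 0 ≤ T) (h : RedSol S 0 T x v f)
    (hf : ∀ t ∈ Icc 0 T, ‖f t‖ ^ 2 ≤ F) : ∫ t in (0 : ℝ)..T, ‖f t‖ ^ 2 ≤ T * F := by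
  have := integral_mono_Icc hT h.cont_norm_sq_f continuousOn_const hf
  rwa [intervalIntegral.integral_const, smul_eq_mul, sub_zero] at this

theorem en_le_of_norm_sq_le (hS : S.IsPositive) (hinj : Function.Injective S) (hT : 0 ≤ T)
    (h : RedSol S 0 T x v f) (hf : ∀ t ∈ Icc 0 T, ‖f t‖ ^ 2 ≤ F) {s t : ℝ} (hs : s ∈ Icc 0 T)
    (ht : t ∈ Icc 0 T) : en (x t) (v t) ≤ 2 * en (x s) (v s) + 2 * T ^ 2 * F := by
  have h1 := h.en_le hS hinj hs ht
  have h2 := mul_le_mul_of_nonneg_left (h.integral_norm_sq_le hT hf) hT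
  rw [sub_zero] at h1
  linarith

/-- The initial energy is controlled by the mean energy. -/
theorem en_zero_le (hS : S.IsPositive) (hinj : Function.Injective S) (hT : 0 < T)
    (h : RedSol S 0 T x v f) :
    en (x 0) (v 0) ≤ 2 / T * (∫ t in (0 : ℝ)..T, en (x t) (v t))
      + 2 * T * ∫ t in (0 : ℝ)..T, ‖f t‖ ^ 2 := by
  have h0 : (0 : ℝ) ∈ Icc 0 T := left_mem_Icc.2 hT.le
  have h1 := integral_le_of_le_affine hT.le continuousOn_const h.cont_en
    fun t ht => h.en_le hS hinj ht h0
  rw [intervalIntegral.integral_const, smul_eq_mul, sub_zero] at h1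
  have h2 : en (x 0) (v 0) ≤ (2 * (∫ t in (0 : ℝ)..T, en (x t) (v t))
      + 2 * (T * ∫ t in (0 : ℝ)..T, ‖f t‖ ^ 2) * T) / T := by
    rw [le_div_iff₀ hT]; linarith
  refine h2.trans_eq ?_
  field_simp

end RedSol

/-- Forward propagation: the source of each equation is bounded by the energy of the preceding
component, so the bounds follow one after the other, with constants that may grow with T. -/
theorem VelChain.exists_en_le (hS : S.IsPositive) (hinj : Function.Injective S)
    (D : ℕ → E →L[ℝ] E) {T : ℝ} (hT : 0 < T) (n : ℕ) :
    ∃ c : ℝ, 0 < c ∧ ∀ x v : ℕ → ℝ → E, VelChain S D n T x v → ∀ M : ℝ, 0 ≤ M →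
      (∀ j ≤ n, en (x j 0) (v j 0) ≤ M) → ∀ j ≤ n, ∀ t ∈ Icc 0 T, en (x j t) (v j t) ≤ c * M := by
  induction n with
  | zero =>
    refine ⟨1, one_pos, fun x v h M hM _ j hj t _ => ?_⟩
    obtain rfl : j = 0 := by omega
    simpa [h.x_zero, h.v_zero, en] using hM
  | succ n ih =>
    obtain ⟨c, hc, ih⟩ := ih
    refine ⟨c + 2 + 4 * T ^ 2 * ‖D (n + 1)‖ ^ 2 * c, by positivity, fun x v h M hM h0 j hj t ht => ?_⟩
    have hprev := ih x v ⟨h.x_zero, h.v_zero, fun i hi => h.sol i (by omega)⟩ M hM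
      fun i hi => h0 i (by omega)
    have hcM : 0 ≤ c * M := by positivity
    have hTM : 0 ≤ 4 * T ^ 2 * ‖D (n + 1)‖ ^ 2 * c * M := by positivity
    rcases Nat.lt_succ_iff_lt_or_eq.1 (Nat.lt_succ_of_le hj) with hj | rfl
    · have := hprev j (by omega) t ht
      linarith
    · have h1 := (h.sol n (by omega)).en_le_of_norm_sq_le hS hinj hT.le
        (F := ‖D (n + 1)‖ ^ 2 * (2 * (c * M))) (fun r hr => by
          rw [norm_neg]
          refine (norm_sq_le_opNorm _ _).trans ?_
          gcongr
          exact (norm_sq_snd_le_en (x n r) (v n r)).trans (by linarith [hprev n le_rfl r hr]))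
        (left_mem_Icc.2 hT.le) ht
      have := h0 (n + 1) le_rfl
      linarith

/-! ### Direct and observability inequalities, component by component. -/

section Mixed

variable {D : ℕ → E →L[ℝ] E} {C : ℕ → ℕ → E →L[ℝ] E} {n p : ℕ} {T : ℝ}

/-- The two last components of a cascade are controlled by the energies of the primitives. -/
theorem DispChain.exists_norm_sq_le (hS : S.IsPositive) (hinj : Function.Injective S)
    (D : ℕ → E →L[ℝ] E) (hn : 1 ≤ n) (hT : 0 < T) :
    ∃ c : ℝ, 0 < c ∧ ∀ x v : ℕ → ℝ → E, DispChain S D n T x v → ∀ M : ℝ, 0 ≤ M →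
      (∀ j ≤ n, primEn S D (fun j => x j 0) (fun j => v j 0) n j ≤ M) →
      ∀ t ∈ Icc 0 T, ‖S (x (n - 1) t)‖ ^ 2 ≤ c * M ∧ ‖S (x n t)‖ ^ 2 ≤ c * M := by
  obtain ⟨c, hc, hgrow⟩ := VelChain.exists_en_le hS hinj D hT n
  refine ⟨(1 + ‖S‖ ^ 2) * (2 * c), by positivity, fun x v h M hM h0 t ht => ?_⟩
  have hb := hgrow _ _ h.velChain M hM h0
  have hcM : 0 ≤ 2 * (c * M) := by positivity
  have hSM : 0 ≤ ‖S‖ ^ 2 * (2 * (c * M)) := by positivity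
  constructor
  · have h1 := hb (n - 1) (by omega) t ht
    have h2 := norm_sq_snd_le_en (primHalf S D (fun i => x i t) (fun i => v i t) (n - (n - 1)) (n - 1))
      (prim S D (fun i => x i t) (fun i => v i t) (n - (n - 1)) (n - 1))
    -- The velocity of the first primitive of u_{n-1} is u_{n-1} = S x_{n-1} itself, so the energy
    -- of this primitive bounds the H-norm of u_{n-1}.
    rw [show n - (n - 1) = 1 by omega] at h1 h2
    rw [prim_one_left] at h1 h2
    linarith
  · have h1 := hb n le_rfl t ht
    simp only [Nat.sub_self, primHalf_zero_left, prim_zero_left] at h1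
    have h2 := norm_sq_le_opNorm S (x n t)
    have h3 := norm_sq_fst_le_en (x n t) (v n t)
    have h4 := mul_le_mul_of_nonneg_left (h3.trans (mul_le_mul_of_nonneg_left h1 zero_le_two))
      (sq_nonneg ‖S‖)
    linarith

theorem RedMixed.mono {q : ℕ} (hq : q ≤ p) {x v : ℕ → ℝ → E} (h : RedMixed S D C n p T x v) :
    RedMixed S D C n q T x v :=
  ⟨h.chain, fun i hi => h.sol i (by simp only [Finset.mem_Icc] at hi ⊢; omega)⟩

/-- The components from the `(n-1)`-st on are controlled by the initial energies. -/
theorem RedMixed.exists_norm_sq_le (hS : S.IsPositive) (hinj : Function.Injective S)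
    (D : ℕ → E →L[ℝ] E) (C : ℕ → ℕ → E →L[ℝ] E) (hn : 1 ≤ n) (hT : 0 < T) (p : ℕ) :
    ∃ c : ℝ, 0 < c ∧ ∀ x v : ℕ → ℝ → E, RedMixed S D C n p T x v → ∀ M : ℝ, 0 ≤ M →
      (∀ j ≤ n, primEn S D (fun j => x j 0) (fun j => v j 0) n j ≤ M) →
      (∀ j ∈ Finset.Icc 1 p, en (x (n + j) 0) (v (n + j) 0) ≤ M) →
      ∀ i ∈ Finset.Ico (n - 1) (n + p + 1), ∀ t ∈ Icc 0 T, ‖S (x i t)‖ ^ 2 ≤ c * M := by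
  induction p with
  | zero =>
    obtain ⟨c, hc, hb⟩ := DispChain.exists_norm_sq_le hS hinj D hn hT
    refine ⟨c, hc, fun x v h M hM h0 _ i hi t ht => ?_⟩
    obtain ⟨h1, h2⟩ := hb x v h.chain M hM h0 t ht
    simp only [Finset.mem_Ico] at hi
    rcases (by omega : i = n - 1 ∨ i = n) with rfl | rfl
    · exact h1
    · exact h2
  | succ p ih =>
    obtain ⟨c, hc, ih⟩ := ih
    set L := ∑ k ∈ Finset.Ico (n - 1) (n + p + 1), ‖C (n + p + 1) k‖ with hL
    refine ⟨c + ‖S‖ ^ 2 * (4 + 4 * T ^ 2 * L ^ 2 * c), by positivity,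
      fun x v h M hM h0 h1 i hi t ht => ?_⟩
    have hprev := ih x v (h.mono (Nat.le_succ p)) M hM h0
      fun j hj => h1 j (by simp only [Finset.mem_Icc] at hj ⊢; omega)
    have hcM : 0 ≤ c * M := by positivity
    have hTM : 0 ≤ ‖S‖ ^ 2 * (4 + 4 * T ^ 2 * L ^ 2 * c) * M := by positivity
    by_cases hip : i < n + p + 1
    · have := hprev i (by simp only [Finset.mem_Ico] at hi ⊢; omega) t ht
      linarith
    · obtain rfl : i = n + p + 1 := by simp only [Finset.mem_Ico] at hi; omega
      have h2 := (h.sol (n + p + 1) (by simp only [Finset.mem_Icc]; omega)).en_le_of_norm_sq_le hS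
        hinj hT.le (F := L ^ 2 * (c * M)) (fun r hr => by
          rw [norm_neg]
          exact norm_sq_sum_map_le _ _ _ hcM fun k hk => hprev k hk r hr)
        (left_mem_Icc.2 hT.le) ht
      have h3 := h1 (p + 1) (by simp)
      have h4 := norm_sq_le_opNorm S (x (n + p + 1) t)
      have h5 := norm_sq_fst_le_en (x (n + p + 1) t) (v (n + p + 1) t)
      rw [← add_assoc] at h3
      have h6 : ‖x (n + p + 1) t‖ ^ 2 ≤ (4 + 4 * T ^ 2 * L ^ 2 * c) * M := by linarith
      have h7 := mul_le_mul_of_nonneg_left h6 (sq_nonneg ‖S‖)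
      linarith

variable {G : Type*} [NormedAddCommGroup G] {b : E × E →+ G}

/-- The direct inequality for the last component of the cascade. -/
theorem DispChain.exists_integral_obs_le (hS : S.IsPositive) (hinj : Function.Injective S)
    (D : ℕ → E →L[ℝ] E) (hn : 1 ≤ n) (hb : RedAdmissible S b) (hT : 0 < T) :
    ∃ c : ℝ, 0 < c ∧ ∀ x v : ℕ → ℝ → E, DispChain S D n T x v → ∀ M : ℝ, 0 ≤ M →
      (∀ j ≤ n, primEn S D (fun j => x j 0) (fun j => v j 0) n j ≤ M) →
      ∀ g : ℝ → G, RedObservation S b T (x n) (v n) (fun t => -D n (S (x (n - 1) t))) g →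
        ∫ t in (0 : ℝ)..T, ‖g t‖ ^ 2 ≤ c * M := by
  obtain ⟨K, hK, hdir⟩ := hb.exists_integral_obs_le hS hinj hT
  obtain ⟨c, hc, hgrow⟩ := DispChain.exists_norm_sq_le hS hinj D hn hT
  refine ⟨K * (1 + T * (‖D n‖ ^ 2 * c)), by positivity, fun x v h M hM h0 g hg => ?_⟩
  have hsol := h.sol (n - 1) (by omega)
  rw [show n - 1 + 1 = n by omega] at hsol
  refine (hdir _ _ _ _ hsol hg).trans ?_
  rw [mul_assoc]
  refine mul_le_mul_of_nonneg_left ?_ hK.le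
  have h1 := hsol.integral_norm_sq_le hT.le (F := ‖D n‖ ^ 2 * (c * M)) fun t ht => by
    rw [norm_neg]
    refine (norm_sq_le_opNorm _ _).trans ?_
    gcongr
    exact (hgrow x v h M hM h0 t ht).1
  have h2 := h0 n le_rfl
  rw [primEn_self] at h2
  linarith

/-- The direct inequality for the components that follow the cascade. -/
theorem RedMixed.exists_integral_obs_le (hS : S.IsPositive) (hinj : Function.Injective S)
    (D : ℕ → E →L[ℝ] E) (C : ℕ → ℕ → E →L[ℝ] E) (hn : 1 ≤ n) (hb : RedAdmissible S b) (hT : 0 < T)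
    {i : ℕ} (hi : i ∈ Finset.Icc (n + 1) (n + p)) :
    ∃ c : ℝ, 0 < c ∧ ∀ x v : ℕ → ℝ → E, RedMixed S D C n p T x v → ∀ M : ℝ, 0 ≤ M →
      (∀ j ≤ n, primEn S D (fun j => x j 0) (fun j => v j 0) n j ≤ M) →
      (∀ j ∈ Finset.Icc 1 p, en (x (n + j) 0) (v (n + j) 0) ≤ M) →
      ∀ g : ℝ → G, RedObservation S b T (x i) (v i)
          (fun t => -∑ k ∈ Finset.Ico (n - 1) i, C i k (S (x k t))) g →
        ∫ t in (0 : ℝ)..T, ‖g t‖ ^ 2 ≤ c * M := by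
  obtain ⟨K, hK, hdir⟩ := hb.exists_integral_obs_le hS hinj hT
  obtain ⟨c, hc, hgrow⟩ := RedMixed.exists_norm_sq_le hS hinj D C hn hT p
  set L := ∑ k ∈ Finset.Ico (n - 1) i, ‖C i k‖ with hL
  simp only [Finset.mem_Icc] at hi
  refine ⟨K * (1 + T * (L ^ 2 * c)), by positivity, fun x v h M hM h0 h1 g hg => ?_⟩
  have hsol := h.sol i (by simp only [Finset.mem_Icc]; omega)
  refine (hdir _ _ _ _ hsol hg).trans ?_
  rw [mul_assoc]
  refine mul_le_mul_of_nonneg_left ?_ hK.le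
  have h2 := hsol.integral_norm_sq_le hT.le (F := L ^ 2 * (c * M)) fun t ht => by
    rw [norm_neg]
    exact norm_sq_sum_map_le _ _ _ (by positivity) fun k hk => hgrow x v h M hM h0 h1 k
      (by simp only [Finset.mem_Ico] at hk ⊢; omega) t ht
  have h3 := h1 (i - n) (by simp only [Finset.mem_Icc]; omega)
  rw [show n + (i - n) = i by omega] at h3
  linarith

/-- Observability of the cascade by its last component. -/
theorem ChainEstimate.exists_primEn_le (hS : S.IsPositive) (hinj : Function.Injective S)
    (hK : IsCompactOperator (S * S : E →L[ℝ] E)) (hn : 2 ≤ n) (hch : ChainEstimate S D n)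
    (hb : RedAdmissible S b) (hobs : RedObserving S b) :
    ∃ K T₁ : ℝ, 0 < K ∧ 0 < T₁ ∧ ∀ (T : ℝ) (x v : ℕ → ℝ → E) (g : ℝ → G), T₁ ≤ T →
      DispChain S D n T x v →
      RedObservation S b T (x n) (v n) (fun t => -D n (S (x (n - 1) t))) g →
      (∀ j < n, primEn S D (fun j => x j 0) (fun j => v j 0) n j
        ≤ K / T ^ 3 * ∫ t in (0 : ℝ)..T, ‖g t‖ ^ 2) ∧
      primEn S D (fun j => x j 0) (fun j => v j 0) n n ≤ K / T * ∫ t in (0 : ℝ)..T, ‖g t‖ ^ 2 := by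
  obtain ⟨c, T₁, hc, hT₁, hch⟩ := hch 1 one_pos
  obtain ⟨τ, Q, hτ, hQ, hobs⟩ := hobs.exists_integral_en_le hS hinj hK hb
  set d := ‖D n‖ with hd
  refine ⟨c * (2 * Q), max T₁ (max 1 (max τ (4 * Q * d ^ 2 * c))), by positivity, by positivity,
    fun T x v g hT h hg => ?_⟩
  simp only [max_le_iff] at hT
  obtain ⟨hTT₁, hT1, hTτ, hTQ⟩ := hT
  have hT0 : 0 < T := by linarith
  obtain ⟨e1, e2⟩ := hch T _ _ hTT₁ h.velChain 0 T le_rfl le_rfl (by simp)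
  have hsol := h.sol (n - 1) (by omega)
  rw [show n - 1 + 1 = n by omega] at hsol
  simp only [Nat.sub_self, primHalf_zero_left, prim_zero_left] at e1 e2
  set Z := ∫ t in (0 : ℝ)..T, en (x n t) (v n t) with hZ
  have hZ0 : 0 ≤ Z := integral_nonneg_Icc hT0.le fun _ _ => en_nonneg _ _
  have hsrc := hsol.integral_norm_sq_le hT0.le (F := d ^ 2 * (2 * (c / T ^ 3 * Z))) fun t ht => by
    rw [norm_neg]
    refine (norm_sq_le_opNorm _ _).trans ?_
    have f1 := e1 (n - 1) (by omega) t ht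
    have f2 := norm_sq_snd_le_en (primHalf S D (fun i => x i t) (fun i => v i t) (n - (n - 1)) (n - 1))
      (prim S D (fun i => x i t) (fun i => v i t) (n - (n - 1)) (n - 1))
    rw [show n - (n - 1) = 1 by omega] at f1 f2
    rw [prim_one_left] at f1 f2
    gcongr
    linarith
  have o1 := hobs T _ _ _ _ hTτ hsol hg
  -- The source D_n u_{n-1} has squared norm of order Z/T³, so its integral is of order Z/T². It is
  -- at most Z/2, after multiplication by Q, when T ≥ 1 and T ≥ 4Qd²c, and can be absorbed.
  have o2 : Q * (T * (d ^ 2 * (2 * (c / T ^ 3 * Z)))) ≤ Z / 2 := by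
    have e : Q * (T * (d ^ 2 * (2 * (c / T ^ 3 * Z)))) = (4 * Q * d ^ 2 * c) / T * (1 / T) * (Z / 2) := by
      field_simp; ring
    rw [e]
    refine mul_le_of_le_one_left (by positivity) (mul_le_one₀ ((div_le_one hT0).2 hTQ)
      (by positivity) ((div_le_one hT0).2 hT1))
  have o3 : Z ≤ 2 * Q * ∫ t in (0 : ℝ)..T, ‖g t‖ ^ 2 := by
    have := mul_le_mul_of_nonneg_left hsrc hQ.le
    linarith
  have h0 : (0 : ℝ) ∈ Icc 0 T := left_mem_Icc.2 hT0.le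
  constructor
  · intro j hj
    refine (e1 j hj 0 h0).trans ((mul_le_mul_of_nonneg_left o3 (by positivity)).trans_eq ?_)
    ring
  · rw [primEn_self]
    refine (e2 0 h0).trans ((mul_le_mul_of_nonneg_left o3 (by positivity)).trans_eq ?_)
    ring

/-- Observability of the component `n + k + 1` by its own observation and the energies of the
preceding components. -/
theorem RedObserving.exists_en_le (hS : S.IsPositive) (hinj : Function.Injective S)
    (hK : IsCompactOperator (S * S : E →L[ℝ] E)) (hn : 1 ≤ n) (D : ℕ → E →L[ℝ] E)
    (C : ℕ → ℕ → E →L[ℝ] E) (hb : RedAdmissible S b) (hobs : RedObserving S b) :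
    ∃ τ : ℝ, 0 < τ ∧ ∀ T : ℝ, τ ≤ T → ∀ k : ℕ, ∃ c : ℝ, 0 < c ∧ ∀ x v : ℕ → ℝ → E,
      RedMixed S D C n (k + 1) T x v → ∀ M : ℝ, 0 ≤ M →
      (∀ j ≤ n, primEn S D (fun j => x j 0) (fun j => v j 0) n j ≤ M) →
      (∀ j ∈ Finset.Icc 1 k, en (x (n + j) 0) (v (n + j) 0) ≤ M) →
      ∀ g : ℝ → G, RedObservation S b T (x (n + (k + 1))) (v (n + (k + 1)))
          (fun t => -∑ l ∈ Finset.Ico (n - 1) (n + (k + 1)), C (n + (k + 1)) l (S (x l t))) g →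
        (∫ t in (0 : ℝ)..T, ‖g t‖ ^ 2) ≤ M →
        en (x (n + (k + 1)) 0) (v (n + (k + 1)) 0) ≤ c * M := by
  obtain ⟨τ, Q, hτ, hQ, hobs⟩ := hobs.exists_integral_en_le hS hinj hK hb
  refine ⟨τ, hτ, fun T hT k => ?_⟩
  have hT0 : 0 < T := hτ.trans_le hT
  obtain ⟨c, hc, hgrow⟩ := RedMixed.exists_norm_sq_le hS hinj D C hn hT0 k
  set L := ∑ l ∈ Finset.Ico (n - 1) (n + (k + 1)), ‖C (n + (k + 1)) l‖ with hL
  refine ⟨2 / T * (Q * (1 + T * (L ^ 2 * c))) + 2 * T * (T * (L ^ 2 * c)), by positivity,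
    fun x v h M hM h0 h1 g hg hgM => ?_⟩
  have hsol := h.sol (n + (k + 1)) (by simp only [Finset.mem_Icc]; omega)
  have hsrc := hsol.integral_norm_sq_le hT0.le (F := L ^ 2 * (c * M)) fun t ht => by
    rw [norm_neg]
    exact norm_sq_sum_map_le _ _ _ (by positivity) fun l hl => hgrow x v (h.mono (Nat.le_succ k)) M
      hM h0 h1 l (by simp only [Finset.mem_Ico] at hl ⊢; omega) t ht
  have o1 := hobs T _ _ _ _ hT hsol hg
  -- Observability with source bounds the mean energy; `en_zero_le` returns to the initial energy at
  -- the price of one more source term.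
  have o2 := hsol.en_zero_le hS hinj hT0
  have o3 := o1.trans (mul_le_mul_of_nonneg_left (add_le_add hgM hsrc) hQ.le)
  have o4 := mul_le_mul_of_nonneg_left o3 (show 0 ≤ 2 / T by positivity)
  have o5 := mul_le_mul_of_nonneg_left hsrc (show 0 ≤ 2 * T by positivity)
  linarith

end Mixed

end Cascade

namespace Cascade

/-! ### Square roots of positive operators -/

section SquareRoot

/-- The pairs with i + j < N form a subset of the square [0, N)². -/
theorem sum_range_sum_antidiagonal_mul_le {f : ℕ → ℝ} (hf : ∀ n, 0 ≤ f n) (N : ℕ) :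
    ∑ n ∈ Finset.range N, ∑ ij ∈ Finset.HasAntidiagonal.antidiagonal n, f ij.1 * f ij.2
      ≤ (∑ n ∈ Finset.range N, f n) ^ 2 := by
  have h := Finset.sum_fiberwise_of_maps_to
    (s := (Finset.range N ×ˢ Finset.range N).filter fun ij => ij.1 + ij.2 < N)
    (t := Finset.range N) (g := fun ij => ij.1 + ij.2)
    (fun ij hij => Finset.mem_range.2 (Finset.mem_filter.1 hij).2) (fun ij => f ij.1 * f ij.2)
  have h' : ∑ n ∈ Finset.range N, ∑ ij ∈ Finset.HasAntidiagonal.antidiagonal n, f ij.1 * f ij.2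
      = ∑ ij ∈ (Finset.range N ×ˢ Finset.range N).filter (fun ij => ij.1 + ij.2 < N),
        f ij.1 * f ij.2 := by
    rw [← h]
    refine Finset.sum_congr rfl fun n hn => Finset.sum_congr ?_ fun _ _ => rfl
    ext ⟨i, j⟩
    simp only [Finset.HasAntidiagonal.mem_antidiagonal, Finset.mem_filter, Finset.mem_product, Finset.mem_range]
      at hn ⊢
    omega
  rw [h', pow_two, Finset.sum_mul_sum, ← Finset.sum_product']
  exact Finset.sum_le_sum_of_subset_of_nonneg (Finset.filter_subset _ _)
    fun ij _ _ => mul_nonneg (hf _) (hf _)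

/-- By the Catalan recursion the partial sums satisfy s_{N+1} ≤ 1 + s_N²/4, a relation that
preserves the bound 2. -/
theorem sum_range_catalan_div_pow_le (N : ℕ) :
    ∑ n ∈ Finset.range N, (catalan n : ℝ) * (1 / 4) ^ n ≤ 2 := by
  induction N with
  | zero => simp
  | succ N ih =>
    have h0 : ∀ n, 0 ≤ (catalan n : ℝ) * (1 / 4) ^ n := fun n => by positivity
    have h := sum_range_sum_antidiagonal_mul_le h0 N
    have h1 : ∀ n, (catalan (n + 1) : ℝ) * (1 / 4) ^ (n + 1) = (1 / 4) *
        ∑ ij ∈ Finset.HasAntidiagonal.antidiagonal n,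
          ((catalan ij.1 : ℝ) * (1 / 4) ^ ij.1) * ((catalan ij.2 : ℝ) * (1 / 4) ^ ij.2) := by
      intro n
      rw [catalan_succ', Nat.cast_sum, Finset.sum_mul, Finset.mul_sum]
      refine Finset.sum_congr rfl fun ij hij => ?_
      rw [← Finset.HasAntidiagonal.mem_antidiagonal.1 hij]
      push_cast
      ring
    rw [Finset.sum_range_succ', Finset.sum_congr rfl fun n _ => h1 n, ← Finset.mul_sum]
    have h2 : 0 ≤ ∑ n ∈ Finset.range N, (catalan n : ℝ) * (1 / 4) ^ n :=
      Finset.sum_nonneg fun n _ => h0 n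
    simp only [catalan_zero, pow_zero, Nat.cast_one, mul_one]
    nlinarith

variable {𝕜 : Type*} [RCLike 𝕜] {H : Type*} [NormedAddCommGroup H] [InnerProductSpace 𝕜 H]
  [CompleteSpace H]

/-- g = Σ C_n qⁿ, the Catalan generating function, converges absolutely even at ‖q‖ = 1/4. Its
functional equation gives (1 - 2qg)² = 1 - 4q, whence square roots. -/
theorem exists_catalan_fixedPoint {q : H →L[𝕜] H} (hq : ‖q‖ ≤ 1 / 4) (hsa : IsSelfAdjoint q) :
    ∃ g : H →L[𝕜] H, ‖g‖ ≤ 2 ∧ IsSelfAdjoint g ∧ Commute q g ∧ g = 1 + q * g ^ 2 := by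
  have hpow : ∀ n, ‖q ^ n‖ ≤ (1 / 4) ^ n := by
    intro n
    cases n with
    | zero => rw [pow_zero, pow_zero]; exact ContinuousLinearMap.norm_id_le
    | succ n => exact (norm_pow_le' _ n.succ_pos).trans (pow_le_pow_left₀ (norm_nonneg _) hq _)
  have hb : ∀ n, ‖catalan n • q ^ n‖ ≤ (catalan n : ℝ) * (1 / 4) ^ n := fun n =>
    (norm_nsmul_le).trans (mul_le_mul_of_nonneg_left (hpow n) (Nat.cast_nonneg _))
  have h0 : ∀ n, 0 ≤ (catalan n : ℝ) * (1 / 4) ^ n := fun n => by positivity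
  have hsr : Summable fun n => (catalan n : ℝ) * (1 / 4) ^ n :=
    summable_of_sum_range_le h0 sum_range_catalan_div_pow_le
  have hsn : Summable fun n => ‖catalan n • q ^ n‖ :=
    Summable.of_nonneg_of_le (fun _ => norm_nonneg _) hb hsr
  have hs : Summable fun n => catalan n • q ^ n := hsn.of_norm
  refine ⟨∑' n, catalan n • q ^ n, ?_, ?_, ?_, ?_⟩
  · refine (tsum_of_norm_bounded hsr.hasSum hb).trans ?_
    exact Real.tsum_le_of_sum_range_le h0 sum_range_catalan_div_pow_le
  · rw [IsSelfAdjoint, tsum_star]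
    refine tsum_congr fun n => ?_
    rw [star_nsmul, star_pow, hsa.star_eq]
  · exact Commute.tsum_right _ fun n => ((Commute.refl q).pow_right n).smul_right _
  · rw [pow_two, tsum_mul_tsum_eq_tsum_sum_antidiagonal_of_summable_norm hsn hsn]
    have h1 : ∀ n, ∑ ij ∈ Finset.HasAntidiagonal.antidiagonal n, (catalan ij.1 • q ^ ij.1) *
        (catalan ij.2 • q ^ ij.2) = catalan (n + 1) • q ^ n := by
      intro n
      rw [catalan_succ', Finset.sum_smul]
      refine Finset.sum_congr rfl fun ij hij => ?_
      rw [← Finset.HasAntidiagonal.mem_antidiagonal.1 hij, smul_mul_smul_comm, pow_add]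
    simp_rw [h1]
    rw [hs.tsum_eq_zero_add]
    have hs' : Summable fun n => catalan (n + 1) • q ^ n := by
      refine Summable.of_norm_bounded ((summable_nat_add_iff 1).2 hsr |>.mul_left 4) fun n => ?_
      refine (norm_nsmul_le).trans ?_
      calc (catalan (n + 1) : ℝ) * ‖q ^ n‖ ≤ catalan (n + 1) * (1 / 4) ^ n :=
            mul_le_mul_of_nonneg_left (hpow n) (Nat.cast_nonneg _)
        _ = 4 * (catalan (n + 1) * (1 / 4) ^ (n + 1)) := by ring
    rw [← hs'.tsum_mul_left]
    simp only [catalan_zero, pow_zero, one_smul, pow_succ', mul_smul_comm]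

/-- Positivity of ⟨K·, ·⟩ is used at x - ‖K‖⁻¹Kx. -/
theorem norm_sq_le_of_isPositive {K : H →L[𝕜] H} (hK : K.IsPositive) (x : H) :
    ‖K x‖ ^ 2 ≤ ‖K‖ * RCLike.re (inner 𝕜 (K x) x) := by
  rcases (norm_nonneg K).eq_or_lt with h | h
  · have : K = 0 := norm_eq_zero.1 h.symm
    simp [this]
  have h1 := hK.re_inner_nonneg_left (x - ((‖K‖⁻¹ : ℝ) : 𝕜) • K x)
  have h2 : RCLike.re (inner 𝕜 (K (K x)) (K x)) ≤ ‖K‖ * ‖K x‖ ^ 2 := by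
    refine (RCLike.re_le_norm _).trans ((norm_inner_le_norm _ _).trans ?_)
    have := K.le_opNorm (K x)
    nlinarith [norm_nonneg (K x)]
  have h3 : inner 𝕜 (K (K x)) x = inner 𝕜 (K x) (K x) := hK.inner_left_eq_inner_right _ _
  simp only [map_sub, map_smul, inner_sub_left, inner_sub_right, inner_smul_left, inner_smul_right,
    RCLike.conj_ofReal, h3, RCLike.re_ofReal_mul, inner_self_eq_norm_sq] at h1
  have h4 : ‖K‖⁻¹ * (‖K‖⁻¹ * RCLike.re (inner 𝕜 (K (K x)) (K x))) ≤ ‖K‖⁻¹ * ‖K x‖ ^ 2 := by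
    refine mul_le_mul_of_nonneg_left ?_ (by positivity)
    rw [inv_mul_le_iff₀ h]
    exact h2
  have h5 : ‖K‖⁻¹ * ‖K x‖ ^ 2 ≤ RCLike.re (inner 𝕜 (K x) x) := by linarith
  rwa [inv_mul_le_iff₀ h] at h5

theorem isPositive_one_sub {X : H →L[𝕜] H} (hX : IsSelfAdjoint X) (h : ‖X‖ ≤ 1) :
    (1 - X).IsPositive := by
  rw [ContinuousLinearMap.isPositive_def']
  refine ⟨(IsSelfAdjoint.one _).sub hX, fun x => ?_⟩
  rw [ContinuousLinearMap.reApplyInnerSelf_apply]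
  have h1 : RCLike.re (inner 𝕜 (X x) x) ≤ ‖x‖ ^ 2 := by
    refine (RCLike.re_le_norm _).trans ((norm_inner_le_norm _ _).trans ?_)
    have := X.le_of_opNorm_le h x
    nlinarith [norm_nonneg x]
  simp only [sub_apply, one_apply_eq_self, inner_sub_left, map_sub,
    inner_self_eq_norm_sq]
  linarith

/-- A positive operator has a positive square root. -/
theorem exists_isPositive_mul_self_eq {K : H →L[𝕜] H} (hK : K.IsPositive) :
    ∃ S : H →L[𝕜] H, S.IsPositive ∧ S * S = K := by
  set c : ℝ := ‖K‖ + 1 with hc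
  have hc0 : 0 < c := by positivity
  -- Since c > ‖K‖, K/c lies between 0 and 1 and ‖B‖ ≤ 1. With q = B/4 one has 1 - 4q = K/c, so √c(1
  -- - 2qg) squares to `K`; it is positive because ‖2qg‖ ≤ 2 · (1/4) · 2 = 1.
  set B : H →L[𝕜] H := 1 - ((c⁻¹ : ℝ) : 𝕜) • K with hB
  have hBn : ‖B‖ ≤ 1 := by
    refine ContinuousLinearMap.opNorm_le_bound _ zero_le_one fun x => ?_
    rw [one_mul]
    refine le_of_sq_le_sq ?_ (norm_nonneg _)
    have h1 := norm_sq_le_of_isPositive hK x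
    have h2 := hK.re_inner_nonneg_left x
    have h3 : RCLike.re (inner 𝕜 x (((c⁻¹ : ℝ) : 𝕜) • K x))
        = c⁻¹ * RCLike.re (inner 𝕜 (K x) x) := by
      rw [inner_smul_right, RCLike.re_ofReal_mul, inner_re_symm]
    have h4 : ‖((c⁻¹ : ℝ) : 𝕜) • K x‖ ^ 2 ≤ c⁻¹ * RCLike.re (inner 𝕜 (K x) x) := by
      rw [norm_smul, RCLike.norm_ofReal, abs_of_pos (by positivity), mul_pow, pow_two c⁻¹,
        mul_assoc]
      refine mul_le_mul_of_nonneg_left ?_ (by positivity)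
      rw [inv_mul_le_iff₀ hc0]
      nlinarith
    have h5 : 0 ≤ c⁻¹ * RCLike.re (inner 𝕜 (K x) x) := by positivity
    change ‖x - ((c⁻¹ : ℝ) : 𝕜) • K x‖ ^ 2 ≤ _
    rw [norm_sub_sq (𝕜 := 𝕜), h3]
    linarith
  have hBs : IsSelfAdjoint B := by
    refine (IsSelfAdjoint.one _).sub (IsSelfAdjoint.smul ?_ hK.isSelfAdjoint)
    rw [IsSelfAdjoint, RCLike.star_def, RCLike.conj_ofReal]
  have h4 : IsSelfAdjoint ((4 : 𝕜)⁻¹) := by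
    rw [IsSelfAdjoint, RCLike.star_def, map_inv₀, map_ofNat]
  obtain ⟨g, hg2, hgs, hqg, hg⟩ := exists_catalan_fixedPoint (q := (4 : 𝕜)⁻¹ • B)
    (by rw [norm_smul, norm_inv, RCLike.norm_ofNat]; linarith) (IsSelfAdjoint.smul h4 hBs)
  set q := (4 : 𝕜)⁻¹ • B with hq
  have hqn : ‖q‖ ≤ 1 / 4 := by rw [hq, norm_smul, norm_inv, RCLike.norm_ofNat]; linarith
  have hX : IsSelfAdjoint (2 * (q * g)) := by
    rw [two_mul]
    have : IsSelfAdjoint (q * g) := ((IsSelfAdjoint.smul h4 hBs).commute_iff hgs).1 hqg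
    exact this.add this
  have hXn : ‖2 * (q * g)‖ ≤ 1 := by
    rw [two_mul]
    have : ‖q * g‖ ≤ 1 / 4 * 2 := (norm_mul_le _ _).trans (by gcongr)
    exact (norm_add_le _ _).trans (by linarith)
  have hsq : (1 - 2 * (q * g)) * (1 - 2 * (q * g)) = 1 - 4 * q := by
    have e1 : (q * g) * (q * g) = q * (q * g ^ 2) := by
      rw [pow_two, mul_assoc, ← mul_assoc g q g, ← hqg.eq, mul_assoc]
    have e2 : q * g = q * (1 + q * g ^ 2) := by rw [← hg]
    have e3 : q * (q * g ^ 2) = q * g - q := by rw [e2, mul_add, mul_one]; abel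
    have : (1 - 2 * (q * g)) * (1 - 2 * (q * g)) = 1 - 4 * (q * g) + 4 * ((q * g) * (q * g)) := by
      noncomm_ring
    rw [this, e1, e3]
    noncomm_ring
  refine ⟨((Real.sqrt c : ℝ) : 𝕜) • (1 - 2 * (q * g)),
    (isPositive_one_sub hX hXn).smul_of_nonneg ?_, ?_⟩
  · exact RCLike.ofReal_nonneg.2 (Real.sqrt_nonneg _)
  · rw [smul_mul_smul_comm, hsq, ← RCLike.ofReal_mul, Real.mul_self_sqrt hc0.le]
    have : (4 : H →L[𝕜] H) * q = B := by
      rw [hq, mul_smul_comm]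
      ext x
      have : (4 : H →L[𝕜] H) = (4 : 𝕜) • 1 := by
        ext y; simp [ofNat_smul_eq_nsmul]
      rw [this]
      simp
    rw [this, hB, sub_sub_cancel, smul_smul, ← RCLike.ofReal_mul, mul_inv_cancel₀ hc0.ne']
    simp

end SquareRoot

end Cascade

namespace Cascade

/-! ### The operator `A^{-1/2}` -/

section InvSqrt

variable {𝕜 : Type*} [RCLike 𝕜] {H : Type*} [NormedAddCommGroup H] [InnerProductSpace 𝕜 H]
  [CompleteSpace H] {A : H →ₗ.[𝕜] H}

theorem IsCoerciveSelfAdjoint.inner_apply_left (hA : IsCoerciveSelfAdjoint A) (x y : A.domain) :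
    inner 𝕜 (A x) (y : H) = inner 𝕜 (x : H) (A y) := by
  have h := LinearPMap.adjoint_isFormalAdjoint hA.selfAdjoint.dense_domain
  rw [LinearPMap.isSelfAdjoint_def.1 hA.selfAdjoint] at h
  exact h x y

theorem IsCoerciveSelfAdjoint.eq_zero_of_apply_eq_zero (hA : IsCoerciveSelfAdjoint A)
    {x : A.domain} (h : A x = 0) : x = 0 := by
  obtain ⟨ω, hω, hl⟩ := hA.lower_bound
  have := hl x
  rw [h, norm_zero] at this
  have h2 : ‖(x : H)‖ ≤ 0 := by
    by_contra h3
    push Not at h3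
    nlinarith [mul_pos hω h3]
  exact Subtype.ext (norm_le_zero_iff.1 h2)

/-- The lower bound makes preimages of a convergent sequence Cauchy, and a self-adjoint operator has
closed graph. -/
theorem IsCoerciveSelfAdjoint.isClosed_range (hA : IsCoerciveSelfAdjoint A) :
    IsClosed (LinearMap.range A.toFun : Set H) := by
  obtain ⟨ω, hω, hl⟩ := hA.lower_bound
  refine isClosed_of_closure_subset fun y hy => ?_
  obtain ⟨ys, hys, hlim⟩ := mem_closure_iff_seq_limit.1 hy
  choose xs hxs using hys
  have hc : CauchySeq fun m => (xs m : H) := by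
    refine Metric.cauchySeq_iff.2 fun ε hε => ?_
    obtain ⟨N, hN⟩ := Metric.cauchySeq_iff.1 hlim.cauchySeq (ω * ε) (by positivity)
    refine ⟨N, fun m hm k hk => ?_⟩
    have h1 := hN m hm k hk
    have h2 := hl (xs m - xs k)
    have h3 : A (xs m - xs k) = ys m - ys k := by
      rw [A.map_sub]; exact congrArg₂ _ (hxs m) (hxs k)
    rw [h3] at h2
    rw [dist_eq_norm] at h1 ⊢
    have h4 : ω * ‖(xs m : H) - xs k‖ < ω * ε := lt_of_le_of_lt h2 h1
    exact lt_of_mul_lt_mul_left h4 hω.le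
  obtain ⟨x, hx⟩ := cauchySeq_tendsto_of_complete hc
  have hg : (x, y) ∈ A.graph := by
    refine hA.selfAdjoint.isClosed.mem_of_tendsto (hx.prodMk_nhds hlim)
      (Eventually.of_forall fun m => ?_)
    exact (LinearPMap.mem_graph_iff _).2 ⟨xs m, rfl, hxs m⟩
  obtain ⟨x', -, hx'⟩ := (LinearPMap.mem_graph_iff _).1 hg
  exact ⟨x', hx'⟩

/-- The orthogonal complement of the range is the kernel of A* = A, which is trivial by the lower
bound; the range is also closed. -/
theorem IsCoerciveSelfAdjoint.range_eq_top (hA : IsCoerciveSelfAdjoint A) :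
    LinearMap.range A.toFun = ⊤ := by
  have := hA.isClosed_range.completeSpace_coe
  rw [← Submodule.orthogonal_eq_bot_iff, Submodule.eq_bot_iff]
  intro y hy
  have h0 : ∀ x : A.domain, inner 𝕜 y (A x) = 0 := fun x =>
    Submodule.inner_left_of_mem_orthogonal (LinearMap.mem_range_self A.toFun x) hy
  have hd := hA.selfAdjoint.dense_domain
  have hy' : y ∈ A.adjoint.domain :=
    LinearPMap.mem_adjoint_domain_of_exists y ⟨0, fun x => by rw [inner_zero_left, h0 x]⟩
  have h1 : A.adjoint ⟨y, hy'⟩ = 0 :=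
    LinearPMap.adjoint_apply_eq hd _ fun x => by rw [inner_zero_left]; exact (h0 x).symm
  have h2 : ∃ hy : y ∈ A.domain, A ⟨y, hy⟩ = 0 := by
    have h3 := LinearPMap.isSelfAdjoint_def.1 hA.selfAdjoint
    have h4 : (y, (0 : H)) ∈ A.adjoint.graph := (LinearPMap.mem_graph_iff _).2 ⟨_, rfl, h1⟩
    rw [h3] at h4
    obtain ⟨x', h5, h6⟩ := (LinearPMap.mem_graph_iff _).1 h4
    dsimp only at h5 h6
    subst h5
    exact ⟨x'.2, h6⟩
  obtain ⟨hy2, h5⟩ := h2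
  exact congrArg Subtype.val (hA.eq_zero_of_apply_eq_zero h5)

theorem IsCoerciveSelfAdjoint.exists_inverse (hA : IsCoerciveSelfAdjoint A) :
    ∃ K : H →L[𝕜] H, K.IsPositive ∧ ∀ x, ∃ hx : K x ∈ A.domain, A ⟨K x, hx⟩ = x := by
  obtain ⟨ω, hω, hl⟩ := hA.lower_bound
  have hinj : Function.Injective A.toFun := by
    rw [injective_iff_map_eq_zero]
    exact fun x hx => hA.eq_zero_of_apply_eq_zero hx
  let e := LinearEquiv.ofBijective A.toFun ⟨hinj, LinearMap.range_eq_top.1 hA.range_eq_top⟩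
  have he : ∀ x, A (e.symm x) = x := fun x => e.apply_symm_apply x
  let K : H →L[𝕜] H := (A.domain.subtype ∘ₗ e.symm.toLinearMap).mkContinuous ω⁻¹ fun x => by
    have := hl (e.symm x)
    rw [he] at this
    rw [le_inv_mul_iff₀ hω]
    exact this
  have hK : ∀ x, K x = (e.symm x : H) := fun x => rfl
  refine ⟨K, ?_, fun x => ⟨(e.symm x).2, he x⟩⟩
  refine ⟨fun x y => ?_, fun x => ?_⟩
  · have := hA.inner_apply_left (e.symm x) (e.symm y)
    rw [he, he] at this
    exact this.symm
  · have h := hA.nonneg (e.symm x)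
    rw [he, ← inner_re_symm] at h
    exact h

theorem invSqrt_isPositive (A : H →ₗ.[𝕜] H) : (invSqrt A).IsPositive := by
  rw [invSqrt]
  split_ifs with h
  · exact h.choose_spec.1
  · exact ContinuousLinearMap.isPositive_zero

theorem IsCoerciveSelfAdjoint.invSqrt_spec (hA : IsCoerciveSelfAdjoint A) (x : H) :
    ∃ hx : invSqrt A (invSqrt A x) ∈ A.domain, A ⟨invSqrt A (invSqrt A x), hx⟩ = x := by
  have h : ∃ S : H →L[𝕜] H, S.IsPositive ∧
      ∀ x : H, ∃ hx : S (S x) ∈ A.domain, A ⟨S (S x), hx⟩ = x := by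
    obtain ⟨K, hK, hKA⟩ := hA.exists_inverse
    obtain ⟨S, hS, rfl⟩ := exists_isPositive_mul_self_eq hK
    exact ⟨S, hS, hKA⟩
  rw [invSqrt, dif_pos h]
  exact h.choose_spec.2 x

theorem IsCoerciveSelfAdjoint.invSqrt_injective (hA : IsCoerciveSelfAdjoint A) :
    Function.Injective (invSqrt A) := by
  rw [injective_iff_map_eq_zero]
  intro x hx
  obtain ⟨hx', h⟩ := hA.invSqrt_spec x
  rw [← h]
  have : (⟨invSqrt A (invSqrt A x), hx'⟩ : A.domain) = 0 := Subtype.ext (by simp [hx])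
  rw [this, A.map_zero]

theorem IsCoerciveSelfAdjoint.invSqrt_apply (hA : IsCoerciveSelfAdjoint A) (u : A.domain) :
    invSqrt A (invSqrt A (A u)) = u := by
  obtain ⟨hx', h⟩ := hA.invSqrt_spec (A u)
  have h2 : A (⟨_, hx'⟩ - u) = 0 := by rw [A.map_sub, h, sub_self]
  have h3 := congrArg Subtype.val (hA.eq_zero_of_apply_eq_zero h2)
  exact sub_eq_zero.1 h3

/-- Resolvent identity A⁻¹ = R(1 - zA⁻¹), with R the compact resolvent at z. -/
theorem IsCoerciveSelfAdjoint.isCompactOperator_invSqrt (hA : IsCoerciveSelfAdjoint A) :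
    IsCompactOperator (invSqrt A * invSqrt A : H →L[𝕜] H) := by
  obtain ⟨z, R, hR, -, hRA⟩ := hA.compact_resolvent
  have : (invSqrt A * invSqrt A : H →L[𝕜] H)
      = R ∘L (1 - z • (invSqrt A * invSqrt A)) := by
    ext x
    obtain ⟨hx, h⟩ := hA.invSqrt_spec x
    have h2 := hRA ⟨_, hx⟩
    rw [h] at h2
    exact h2.symm
  rw [this]
  exact hR.comp_clm _

/-- The element `A⁻¹ y` of the domain of `A`. -/
noncomputable def IsCoerciveSelfAdjoint.inv (hA : IsCoerciveSelfAdjoint A) (y : H) : A.domain :=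
  ⟨invSqrt A (invSqrt A y), (hA.invSqrt_spec y).1⟩

theorem IsCoerciveSelfAdjoint.apply_inv (hA : IsCoerciveSelfAdjoint A) (y : H) :
    A (hA.inv y) = y := (hA.invSqrt_spec y).2

theorem IsCoerciveSelfAdjoint.inv_apply (hA : IsCoerciveSelfAdjoint A) (u : A.domain) :
    hA.inv (A u) = u := Subtype.ext (hA.invSqrt_apply u)

theorem IsCoerciveSelfAdjoint.pow_injective (hA : IsCoerciveSelfAdjoint A) (k : ℕ) :
    Function.Injective (invSqrt A ^ k : H →L[𝕜] H) := by
  induction k with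
  | zero => exact fun x y h => h
  | succ k ih =>
    intro x y h
    rw [pow_succ] at h
    exact hA.invSqrt_injective (ih h)

theorem IsCoerciveSelfAdjoint.halfPow_natCast_spec (hA : IsCoerciveSelfAdjoint A) (k : ℕ)
    (y : H) : ∃ h : (invSqrt A ^ k : H →L[𝕜] H) y ∈ (halfPow A k).domain,
      halfPow A k ⟨(invSqrt A ^ k : H →L[𝕜] H) y, h⟩ = y := by
  have hker : LinearMap.ker ((invSqrt A ^ k : H →L[𝕜] H).toLinearMap.toPMap ⊤).toFun = ⊥ := by
    rw [LinearMap.ker_eq_bot]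
    intro a b h
    exact Subtype.ext (hA.pow_injective k h)
  change ∃ h : (invSqrt A ^ k : H →L[𝕜] H) y ∈
    (((invSqrt A ^ k : H →L[𝕜] H).toLinearMap.toPMap ⊤).inverse).domain,
      ((invSqrt A ^ k : H →L[𝕜] H).toLinearMap.toPMap ⊤).inverse
        ⟨(invSqrt A ^ k : H →L[𝕜] H) y, h⟩ = y
  refine ⟨?_, ?_⟩
  · rw [LinearPMap.inverse_domain]
    exact ⟨⟨y, trivial⟩, rfl⟩
  · exact LinearPMap.inverse_apply_eq hker (x := ⟨y, trivial⟩) rfl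

theorem mem_halfPow_natCast_domain {k : ℕ} {u : H} :
    u ∈ (halfPow A k).domain ↔ ∃ y, (invSqrt A ^ k : H →L[𝕜] H) y = u := by
  change u ∈ (((invSqrt A ^ k : H →L[𝕜] H).toLinearMap.toPMap ⊤).inverse).domain ↔ _
  rw [LinearPMap.inverse_domain]
  exact ⟨fun ⟨y, hy⟩ => ⟨y, hy⟩, fun ⟨y, hy⟩ => ⟨⟨y, trivial⟩, hy⟩⟩

theorem IsCoerciveSelfAdjoint.hNorm_natCast_pow_apply (hA : IsCoerciveSelfAdjoint A) (k : ℕ)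
    (y : H) : hNorm A k ((invSqrt A ^ k : H →L[𝕜] H) y) = ‖y‖ := by
  obtain ⟨h, h'⟩ := hA.halfPow_natCast_spec k y
  rw [hNorm, dif_pos h, h']

theorem IsCoerciveSelfAdjoint.hNorm_zero (hA : IsCoerciveSelfAdjoint A) (y : H) :
    hNorm A 0 y = ‖y‖ := hA.hNorm_natCast_pow_apply 0 y

theorem IsCoerciveSelfAdjoint.hNorm_one_apply (hA : IsCoerciveSelfAdjoint A) (y : H) :
    hNorm A 1 (invSqrt A y) = ‖y‖ := by
  simpa using hA.hNorm_natCast_pow_apply 1 y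

theorem IsCoerciveSelfAdjoint.hNorm_neg_natCast (hA : IsCoerciveSelfAdjoint A) (k : ℕ) (u : H) :
    hNorm A (-(k : ℤ)) u = ‖(invSqrt A ^ k : H →L[𝕜] H) u‖ := by
  cases k with
  | zero => simpa using hA.hNorm_zero u
  | succ k =>
    rw [hNorm, dif_pos]
    · rfl
    · exact Submodule.mem_top

theorem mem_halfPow_one_domain {u : H} :
    u ∈ (halfPow A 1).domain ↔ ∃ y, invSqrt A y = u := by
  simpa using mem_halfPow_natCast_domain (A := A) (k := 1) (u := u)

theorem IsCoerciveSelfAdjoint.halfPow_one_spec (hA : IsCoerciveSelfAdjoint A) (y : H) :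
    ∃ h : invSqrt A y ∈ (halfPow A 1).domain, halfPow A 1 ⟨invSqrt A y, h⟩ = y := by
  simpa using hA.halfPow_natCast_spec 1 y

theorem IsCoerciveSelfAdjoint.energy_one_apply (hA : IsCoerciveSelfAdjoint A) (x v : H) :
    energy A 1 (invSqrt A x) v = en x v := by
  rw [energy, hA.hNorm_one_apply, sub_self, hA.hNorm_zero, en]

/-- If `C^*` is bounded on `H_k` then `C` extends to a bounded operator on `H_{-k}`. -/
theorem BoundedOnScale.exists_norm_pow_apply_le (hA : IsCoerciveSelfAdjoint A) {k : ℕ}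
    {C : H →L[𝕜] H} (h : BoundedOnScale A k (ContinuousLinearMap.adjoint C)) :
    ∃ M : ℝ, 0 ≤ M ∧ ∀ y, ‖(invSqrt A ^ k : H →L[𝕜] H) (C y)‖
      ≤ M * ‖(invSqrt A ^ k : H →L[𝕜] H) y‖ := by
  obtain ⟨M, hM⟩ := h
  have hsa : IsSelfAdjoint (invSqrt A ^ k) := (invSqrt_isPositive A).isSelfAdjoint.pow k
  have hsym : ∀ a b, inner 𝕜 ((invSqrt A ^ k : H →L[𝕜] H) a) b
      = inner 𝕜 a ((invSqrt A ^ k : H →L[𝕜] H) b) := fun a b => hsa.isSymmetric a b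
  refine ⟨max M 0, le_max_right _ _, fun y => ?_⟩
  set S := (invSqrt A ^ k : H →L[𝕜] H)
  set z := S (C y)
  obtain ⟨hz, hz'⟩ := hM (S z) (mem_halfPow_natCast_domain.2 ⟨z, rfl⟩)
  obtain ⟨z', hz1⟩ := mem_halfPow_natCast_domain.1 hz
  rw [← hz1, hA.hNorm_natCast_pow_apply, hA.hNorm_natCast_pow_apply] at hz'
  -- Duality: for z = S Cy write C*Sz = Sz' (here `S` is the k-th power). Then |z|² = ⟨C*Sz, y⟩ =
  -- ⟨z', Sy⟩, and |z'| ≤ M|z| is the bound for C* on H_k.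
  have h1 : inner 𝕜 z z = inner 𝕜 z' (S y) := by
    calc inner 𝕜 z z = inner 𝕜 (S z) (C y) := (hsym _ _).symm
      _ = inner 𝕜 (ContinuousLinearMap.adjoint C (S z)) y :=
          (ContinuousLinearMap.adjoint_inner_left _ _ _).symm
      _ = inner 𝕜 (S z') y := by rw [← hz1]
      _ = _ := hsym _ _
  have h2 : ‖z‖ ^ 2 ≤ ‖z'‖ * ‖S y‖ := by
    rw [← inner_self_eq_norm_sq (𝕜 := 𝕜), h1]
    exact (RCLike.re_le_norm _).trans (norm_inner_le_norm _ _)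
  rcases (norm_nonneg z).eq_or_lt with h0 | h0
  · rw [← h0]; positivity
  · have h3 : ‖z'‖ ≤ max M 0 * ‖z‖ :=
      hz'.trans (mul_le_mul_of_nonneg_right (le_max_left _ _) h0.le)
    have h4 : ‖z‖ * ‖z‖ ≤ ‖z‖ * (max M 0 * ‖S y‖) := by
      nlinarith [norm_nonneg (S y)]
    exact le_of_mul_le_mul_left h4 h0

end InvSqrt

end Cascade

namespace Cascade

/-! ### Reduction of the equations in `H` to equations for `A^{1/2} w` -/

section Reduction

variable {E : Type*} [NormedAddCommGroup E] [InnerProductSpace ℝ E] [CompleteSpace E]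
  {S : E →L[ℝ] E}

theorem RedSol.congr_source {a b : ℝ} {x v f f' : ℝ → E} (h : RedSol S a b x v f)
    (hf : ∀ t ∈ Icc a b, f' t = f t) : RedSol S a b x v f' :=
  ⟨h.cont_x, h.cont_v, h.cont_f.congr hf, h.deriv_x, fun t ht => by
    rw [hf t ht]; exact h.deriv_v t ht⟩

/-- The source in the `i`-th reduced equation, `i ≥ n`. -/
noncomputable def redSource (S : E →L[ℝ] E) (D : ℕ → E →L[ℝ] E) (C : ℕ → ℕ → E →L[ℝ] E) (n : ℕ)
    (x : ℕ → E) (i : ℕ) : E :=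
  if i ≤ n then -D n (S (x (n - 1))) else -∑ k ∈ Finset.Ico (n - 1) i, C i k (S (x k))

theorem redSource_self (D : ℕ → E →L[ℝ] E) (C : ℕ → ℕ → E →L[ℝ] E) (n : ℕ) (x : ℕ → E) :
    redSource S D C n x n = -D n (S (x (n - 1))) :=
  if_pos le_rfl

theorem redSource_of_lt (D : ℕ → E →L[ℝ] E) (C : ℕ → ℕ → E →L[ℝ] E) {n i : ℕ} (hi : n < i)
    (x : ℕ → E) :
    redSource S D C n x i = -∑ k ∈ Finset.Ico (n - 1) i, C i k (S (x k)) :=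
  if_neg (not_le.2 hi)

variable {𝕜 : Type*} [RCLike 𝕜] {H : Type*} [NormedAddCommGroup H] [InnerProductSpace 𝕜 H]
  [CompleteSpace H] [InnerProductSpace ℝ H] [IsScalarTower ℝ 𝕜 H] {A : H →ₗ.[𝕜] H}

/-- `A^{-1/2}` as a real operator. -/
noncomputable def realInvSqrt (A : H →ₗ.[𝕜] H) : H →L[ℝ] H :=
  (invSqrt A).restrictScalars ℝ

theorem realInvSqrt_apply (x : H) : realInvSqrt A x = invSqrt A x := rfl

theorem realInvSqrt_pow_apply (k : ℕ) (x : H) :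
    (realInvSqrt A ^ k) x = (invSqrt A ^ k : H →L[𝕜] H) x := by
  induction k generalizing x with
  | zero => rfl
  | succ k ih => rw [pow_succ, pow_succ]; exact ih _

theorem realInvSqrt_isPositive (hin : ∀ x y : H, ⟪x, y⟫ = RCLike.re (inner 𝕜 x y)) :
    (realInvSqrt A).IsPositive := by
  have h := invSqrt_isPositive A
  refine ⟨fun x y => ?_, fun x => ?_⟩
  · change ⟪invSqrt A x, y⟫ = ⟪x, invSqrt A y⟫
    rw [hin, hin, h.inner_left_eq_inner_right]
  · change 0 ≤ RCLike.re ⟪invSqrt A x, x⟫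
    rw [hin]
    exact h.re_inner_nonneg_left x

theorem realInvSqrt_injective (hA : IsCoerciveSelfAdjoint A) :
    Function.Injective (realInvSqrt A) := hA.invSqrt_injective

theorem isCompactOperator_realInvSqrt (hA : IsCoerciveSelfAdjoint A) :
    IsCompactOperator (realInvSqrt A * realInvSqrt A : H →L[ℝ] H) :=
  hA.isCompactOperator_invSqrt

/-- Testing the equation with A⁻¹z for arbitrary z and integrating in time shows that `S`
annihilates Sv(t) - Sv(0) - ∫(Sf - x). As `S` is injective, the weak equation becomes an integral
equation in H, which can be differentiated. -/
theorem IsSolution.exists_redSol (hA : IsCoerciveSelfAdjoint A)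
    (hin : ∀ x y : H, ⟪x, y⟫ = RCLike.re (inner 𝕜 x y)) {T : ℝ} {w v f : ℝ → H}
    (h : IsSolution A T w v f) :
    ∃ x : ℝ → H, (∀ t ∈ Icc 0 T, w t = realInvSqrt A (x t)) ∧
      RedSol (realInvSqrt A) 0 T x v f := by
  obtain ⟨x, hxc, hx⟩ := h.continuous_H1
  have hS := realInvSqrt_isPositive (A := A) hin
  have hw : ∀ t ∈ Icc 0 T, w t = realInvSqrt A (x t) := by
    intro t ht
    obtain ⟨hd, hd'⟩ := hx t ht
    obtain ⟨y, hy⟩ := mem_halfPow_one_domain.1 hd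
    obtain ⟨hd2, hd3⟩ := hA.halfPow_one_spec y
    have : x t = y := by
      rw [← hd', ← hd3]
      congr 1
      exact Subtype.ext hy.symm
    rw [this, ← hy]; rfl
  refine ⟨x, hw, hxc, h.continuous_deriv, h.continuous_source,
    fun t ht => (h.hasDeriv t ht).congr (fun s hs => (hw s hs).symm) (hw t ht).symm, ?_⟩
  have hc' : ContinuousOn (fun t => realInvSqrt A (f t) - x t) (Icc 0 T) :=
    ((realInvSqrt A).continuous.comp_continuousOn h.continuous_source).sub hxc
  refine hasDerivWithinAt_Icc_of_eq_integral hc' fun t ht => ?_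
  have hsub : Icc 0 t ⊆ Icc 0 T := Icc_subset_Icc_right ht.2
  have key : ∀ z : H, ⟪realInvSqrt A z, realInvSqrt A (v t) - realInvSqrt A (v 0)
      - ∫ s in (0 : ℝ)..t, (realInvSqrt A (f s) - x s)⟫ = 0 := by
    intro z
    have hd : ∀ s ∈ Icc 0 t, HasDerivWithinAt (fun s => ⟪realInvSqrt A z, realInvSqrt A (v s)⟫)
        (⟪realInvSqrt A z, realInvSqrt A (f s) - x s⟫) (Icc 0 t) s := by
      intro s hs
      have h1 := (RCLike.reCLM (K := 𝕜)).hasFDerivAt.comp_hasDerivWithinAt s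
        ((h.equation (hA.inv z) s (hsub hs)).mono hsub)
      have e1 : ∀ y, RCLike.re (inner 𝕜 (hA.inv z : H) y)
          = ⟪realInvSqrt A z, realInvSqrt A y⟫ := fun y => by
        rw [← hS.inner_left_eq_inner_right, hin]; rfl
      have e2 : ∀ y, RCLike.re (inner 𝕜 z (realInvSqrt A y)) = ⟪realInvSqrt A z, y⟫ := fun y => by
        rw [← hin, ← hS.inner_left_eq_inner_right]
      refine (h1.congr_deriv ?_).congr_of_mem (fun s _ => (e1 _).symm) hs
      rw [RCLike.reCLM_apply, map_sub, e1, hA.apply_inv, hw s (hsub hs), e2, inner_sub_right]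
    have hi := integral_eq_sub_of_hasDerivWithinAt_Icc ht.1 hd
      (continuousOn_const.inner (hc'.mono hsub))
    have hii := (innerSL ℝ (realInvSqrt A z)).intervalIntegral_comp_comm
      (intervalIntegrable_of_continuousOn_Icc hc' (left_mem_Icc.2 (ht.1.trans ht.2)) ht)
    simp only [innerSL_apply_apply] at hii
    rw [inner_sub_right, inner_sub_right, ← hii, hi, sub_self]
  have h0 : realInvSqrt A (realInvSqrt A (v t) - realInvSqrt A (v 0)
      - ∫ s in (0 : ℝ)..t, (realInvSqrt A (f s) - x s)) = 0 := by
    refine ext_inner_left ℝ fun z => ?_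
    rw [inner_zero_right, ← hS.inner_left_eq_inner_right, key]
  have h1 := realInvSqrt_injective hA (h0.trans (map_zero _).symm)
  rw [sub_sub, sub_eq_zero] at h1
  exact h1

theorem RedSol.isSolution (hA : IsCoerciveSelfAdjoint A) {T : ℝ} {x v f : ℝ → H}
    (h : RedSol (realInvSqrt A) 0 T x v f) :
    IsSolution A T (fun t => realInvSqrt A (x t)) v f := by
  refine ⟨⟨x, h.cont_x, fun t _ => hA.halfPow_one_spec (x t)⟩, h.deriv_x, h.cont_v, h.cont_f,
    fun φ t ht => ?_⟩
  have hS := invSqrt_isPositive A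
  have e1 : ∀ y, inner 𝕜 (φ : H) y = inner 𝕜 (invSqrt A (A φ)) (invSqrt A y) := fun y => by
    rw [← hS.inner_left_eq_inner_right, hA.invSqrt_apply]
  have h1 := ((innerSL 𝕜 (invSqrt A (A φ))).restrictScalars ℝ).hasFDerivAt.comp_hasDerivWithinAt t
    (h.deriv_v t ht)
  refine (h1.congr_deriv ?_).congr_of_mem (fun s _ => e1 _) ht
  change inner 𝕜 (invSqrt A (A φ)) (invSqrt A (f t) - x t)
    = inner 𝕜 (φ : H) (f t) - inner 𝕜 (A φ) (invSqrt A (x t))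
  rw [inner_sub_right, e1, hS.inner_left_eq_inner_right (A φ) (x t)]

theorem isStrongSolution_iff (hA : IsCoerciveSelfAdjoint A) {T : ℝ} {w : ℝ → A.domain}
    {v f : ℝ → H} :
    IsStrongSolution A T w v f ↔ RedStrong (realInvSqrt A) T (fun t => A (w t)) v f := by
  have e : (fun s => (w s : H)) = fun s => realInvSqrt A (realInvSqrt A (A (w s))) :=
    funext fun s => (hA.invSqrt_apply (w s)).symm
  constructor
  · exact fun h => ⟨h.continuous_H2, h.continuous_source, by rw [← e]; exact h.hasDeriv, h.equation⟩
  · exact fun h => ⟨h.cont_y, by rw [e]; exact h.deriv_y, h.cont_f, h.deriv_v⟩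

theorem RedStrong.isStrongSolution (hA : IsCoerciveSelfAdjoint A) {T : ℝ} {y v f : ℝ → H}
    (h : RedStrong (realInvSqrt A) T y v f) :
    IsStrongSolution A T (fun t => hA.inv (y t)) v f := by
  rw [isStrongSolution_iff hA]
  simpa only [hA.apply_inv] using h

theorem ObservesVelocity.red (hA : IsCoerciveSelfAdjoint A) {P : H →L[𝕜] H}
    (h : ObservesVelocity A P) :
    RedObservesVelocity (realInvSqrt A) (P.restrictScalars ℝ) := by
  obtain ⟨T₀, hT₀, h⟩ := h
  refine ⟨T₀, hT₀, fun T hT => ?_⟩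
  obtain ⟨γ, hγ, h⟩ := h T hT
  refine ⟨γ, hγ, fun x v hx => ?_⟩
  have := h _ _ (hx.isSolution hA)
  rwa [realInvSqrt_apply, hA.energy_one_apply] at this

variable {G : Type*} [NormedAddCommGroup G] [InnerProductSpace 𝕜 G]

/-- The observation operator in terms of `(A w, w')`. -/
noncomputable def redObs (hA : IsCoerciveSelfAdjoint A) (B : A.domain × H →ₗ[𝕜] G) :
    H × H →+ G where
  toFun z := B (hA.inv z.1, z.2)
  map_zero' := by
    have : hA.inv (0 : H) = 0 := Subtype.ext (by simp [IsCoerciveSelfAdjoint.inv])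
    rw [Prod.fst_zero, Prod.snd_zero, this]
    exact map_zero B
  map_add' z z' := by
    have : hA.inv (z.1 + z'.1) = hA.inv z.1 + hA.inv z'.1 :=
      Subtype.ext (by simp [IsCoerciveSelfAdjoint.inv])
    rw [Prod.fst_add, Prod.snd_add, this, ← map_add]
    rfl

theorem redObs_apply (hA : IsCoerciveSelfAdjoint A) (B : A.domain × H →ₗ[𝕜] G) (y v : H) :
    redObs hA B (y, v) = B (hA.inv y, v) := rfl

theorem IsCoerciveSelfAdjoint.energy_one_inv (hA : IsCoerciveSelfAdjoint A) (y v : H) :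
    energy A 1 (hA.inv y) v = en (realInvSqrt A y) v :=
  hA.energy_one_apply _ _

theorem IsAdmissible.red (hA : IsCoerciveSelfAdjoint A) {B : A.domain × H →ₗ[𝕜] G}
    (h : IsAdmissible A B) : RedAdmissible (realInvSqrt A) (redObs hA B) := by
  obtain ⟨M, hM⟩ := h.bounded
  refine ⟨⟨M, fun y v => ?_⟩, fun T hT => ?_⟩
  · have := hM (hA.inv y) v
    rwa [hA.apply_inv] at this
  · obtain ⟨D, hD, h⟩ := h.direct T hT
    refine ⟨D, hD, fun y v f hy => ?_⟩
    have := h _ _ _ (hy.isStrongSolution hA)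
    simp only [hA.energy_one_inv] at this
    exact this

theorem IsObserving.red (hA : IsCoerciveSelfAdjoint A) {B : A.domain × H →ₗ[𝕜] G}
    (h : IsObserving A B) : RedObserving (realInvSqrt A) (redObs hA B) := by
  obtain ⟨T₀, hT₀, h⟩ := h
  refine ⟨T₀, hT₀, fun T hT => ?_⟩
  obtain ⟨R, hR, h⟩ := h T hT
  refine ⟨R, hR, fun y v hy => ?_⟩
  have := h _ _ (hy.isStrongSolution hA)
  rwa [hA.energy_one_inv] at this

theorem isObservation_iff (hA : IsCoerciveSelfAdjoint A) {B : A.domain × H →ₗ[𝕜] G} {T : ℝ}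
    (hT : 0 ≤ T) {w x v f f' : ℝ → H} {g : ℝ → G} (hw : w 0 = realInvSqrt A (x 0))
    (hf : ∀ t ∈ Icc 0 T, f t = f' t) :
    IsObservation A B T w v f g ↔ RedObservation (realInvSqrt A) (redObs hA B) T x v f' g := by
  have ef : ∀ φ : ℝ → H, ∫ t in (0 : ℝ)..T, ‖φ t - f t‖ ^ 2
      = ∫ t in (0 : ℝ)..T, ‖φ t - f' t‖ ^ 2 := fun φ =>
    intervalIntegral.integral_congr fun t ht => by
      rw [uIcc_of_le hT] at ht
      simp only [hf t ht]
  have ee : ∀ y z : H, energy A 1 ((hA.inv y : H) - w 0) z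
      = en (realInvSqrt A y - x 0) z := by
    intro y z
    have : (hA.inv y : H) - w 0 = invSqrt A (realInvSqrt A y - x 0) := by
      rw [hw, map_sub]; rfl
    rw [this, hA.energy_one_apply]
  constructor
  · rintro ⟨hg, ws, vs, fs, h1, h2, h3, h4⟩
    refine ⟨hg, fun m t => A (ws m t), vs, fs,
      ⟨fun m => (isStrongSolution_iff hA).1 (h1 m), ?_, ?_⟩, ?_⟩
    · simpa only [← ee, hA.inv_apply] using h2
    · simpa only [ef] using h3
    · simpa only [redObs_apply, hA.inv_apply] using h4
  · rintro ⟨hg, ys, vs, fs, h1, h4⟩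
    refine ⟨hg, fun m t => hA.inv (ys m t), vs, fs,
      fun m => (h1.strong m).isStrongSolution hA, ?_, ?_, ?_⟩
    · simpa only [ee] using h1.tendsto_en
    · simpa only [ef] using h1.tendsto_f
    · exact h4

/-! ### Reduction of the mixed cascade system -/

/-- The coupling operators of the bi-diagonal part, extended by `0`. -/
noncomputable def diagCoupling (C : ℕ → ℕ → H →L[𝕜] H) (i : ℕ) : H →L[ℝ] H :=
  if i ≤ 1 then 0 else (C i (i - 1)).restrictScalars ℝ

theorem IsMixedSolution.exists_redMixed (hA : IsCoerciveSelfAdjoint A)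
    (hin : ∀ x y : H, ⟪x, y⟫ = RCLike.re (inner 𝕜 x y)) {n p : ℕ} (hn : 2 ≤ n)
    {C : ℕ → ℕ → H →L[𝕜] H} {T : ℝ} {u v : ℕ → ℝ → H} (h : IsMixedSolution A n p C T u v) :
    ∃ x v' : ℕ → ℝ → H,
      RedMixed (realInvSqrt A) (diagCoupling C) (fun i k => (C i k).restrictScalars ℝ) n p T x v' ∧
      (∀ i ∈ Finset.Icc 1 (n + p), v' i = v i ∧ ∀ t ∈ Icc 0 T, u i t = realInvSqrt A (x i t)) ∧
      ∀ i ∈ Finset.Icc n (n + p), ∀ t ∈ Icc 0 T,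
        -coupling n C (fun k => u k t) i = redSource (realInvSqrt A) (diagCoupling C) (fun i k => (C i k).restrictScalars ℝ) n
          (fun k => x k t) i := by
  have h' : ∀ i, ∃ x : ℝ → H, i ∈ Finset.Icc 1 (n + p) →
      (∀ t ∈ Icc 0 T, u i t = realInvSqrt A (x t)) ∧
      RedSol (realInvSqrt A) 0 T x (v i) (fun t => -coupling n C (fun k => u k t) i) := by
    intro i
    by_cases hi : i ∈ Finset.Icc 1 (n + p)
    · obtain ⟨x, hx⟩ := (h i hi).exists_redSol hA hin
      exact ⟨x, fun _ => hx⟩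
    · exact ⟨0, fun h => absurd h hi⟩
  choose x hx using h'
  -- Component 0 carries no equation, so it is replaced by zero; together with the zero value of
  -- `diagCoupling` at 1 this gives the first equation the same form as the others.
  let x' : ℕ → ℝ → H := fun i => if i = 0 then 0 else x i
  let v' : ℕ → ℝ → H := fun i => if i = 0 then 0 else v i
  have hx' : ∀ i ≠ 0, x' i = x i := fun i hi => if_neg hi
  have hv' : ∀ i ≠ 0, v' i = v i := fun i hi => if_neg hi
  have hx0 : x' 0 = 0 := if_pos rfl
  have hu : ∀ i ∈ Finset.Icc 1 (n + p), ∀ t ∈ Icc 0 T, u i t = realInvSqrt A (x' i t) := by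
    intro i hi t ht
    rw [hx' i (by simp only [Finset.mem_Icc] at hi; omega)]
    exact (hx i hi).1 t ht
  have hsol : ∀ i ∈ Finset.Icc 1 (n + p), RedSol (realInvSqrt A) 0 T (x' i) (v' i)
      (fun t => -coupling n C (fun k => u k t) i) := by
    intro i hi
    have hi0 : i ≠ 0 := by simp only [Finset.mem_Icc] at hi; omega
    rw [hx' i hi0, hv' i hi0]
    exact (hx i hi).2
  have hcd : ∀ i < n, ∀ t ∈ Icc 0 T, coupling n C (fun k => u k t) (i + 1)
      = diagCoupling C (i + 1) (realInvSqrt A (x' i t)) := by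
    intro i hi t ht
    rcases Nat.eq_zero_or_pos i with rfl | h0
    · simp [coupling, diagCoupling]
    · rw [coupling, if_neg (by omega), if_pos (by omega), diagCoupling, if_neg (by omega),
        Nat.add_sub_cancel, hu i (by simp only [Finset.mem_Icc]; omega) t ht]
      rfl
  have hcm : ∀ i ∈ Finset.Icc (n + 1) (n + p), ∀ t ∈ Icc 0 T, coupling n C (fun k => u k t) i
      = ∑ k ∈ Finset.Ico (n - 1) i, (C i k).restrictScalars ℝ (realInvSqrt A (x' k t)) := by
    intro i hi t ht
    simp only [Finset.mem_Icc] at hi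
    rw [coupling, if_neg (by omega), if_neg (by omega)]
    refine Finset.sum_congr rfl fun k hk => ?_
    simp only [Finset.mem_Ico] at hk
    rw [hu k (by simp only [Finset.mem_Icc]; omega) t ht]
    rfl
  refine ⟨x', v', ⟨⟨fun t => by rw [hx0]; rfl, fun t => rfl, fun i hi => ?_⟩, fun i hi => ?_⟩,
    fun i hi => ⟨hv' i (by simp only [Finset.mem_Icc] at hi; omega), hu i hi⟩, fun i hi t ht => ?_⟩
  · exact (hsol (i + 1) (by simp only [Finset.mem_Icc]; omega)).congr_source fun t ht => by
      rw [hcd i hi t ht]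
  · exact (hsol i (by simp only [Finset.mem_Icc] at hi ⊢; omega)).congr_source fun t ht => by
      rw [hcm i hi t ht]
  · simp only [Finset.mem_Icc] at hi
    rw [redSource]
    split_ifs with hin'
    · obtain rfl : i = n := by omega
      have := hcd (i - 1) (by omega) t ht
      rw [Nat.sub_add_cancel (by omega)] at this
      rw [this]
    · rw [hcm i (by simp only [Finset.mem_Icc]; omega) t ht]

theorem exists_norm_pow_diagCoupling_le (hA : IsCoerciveSelfAdjoint A) {n : ℕ}
    {C : ℕ → ℕ → H →L[𝕜] H} {P : ℕ → H →L[𝕜] H}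
    (hC : ∀ i ∈ Finset.Icc 2 n, IsPartiallyCoercive A (n - i + 1) (C i (i - 1)) (P i)) :
    ∃ K : ℝ, 0 ≤ K ∧ ∀ i < n, ∀ r ≤ n - (i + 1), ∀ z,
      ‖(realInvSqrt A ^ r) (diagCoupling C (i + 1) z)‖ ≤ K * ‖(realInvSqrt A ^ r) z‖ := by
  have h : ∀ q : ℕ × ℕ, ∃ K : ℝ, 0 ≤ K ∧ (q.1 < n → q.2 ≤ n - (q.1 + 1) → ∀ z,
      ‖(realInvSqrt A ^ q.2) (diagCoupling C (q.1 + 1) z)‖ ≤ K * ‖(realInvSqrt A ^ q.2) z‖) := by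
    rintro ⟨i, r⟩
    by_cases hi : 1 ≤ i ∧ i < n ∧ r ≤ n - (i + 1)
    · obtain ⟨K, hK, h⟩ := BoundedOnScale.exists_norm_pow_apply_le hA
        ((hC (i + 1) (by simp only [Finset.mem_Icc]; omega)).adjoint_bounded r (by omega))
      refine ⟨K, hK, fun _ _ z => ?_⟩
      have := h z
      rwa [diagCoupling, if_neg (by omega), realInvSqrt_pow_apply, realInvSqrt_pow_apply]
    · refine ⟨0, le_rfl, fun h1 h2 z => ?_⟩
      obtain rfl : i = 0 := by by_contra h3; exact hi ⟨by omega, h1, h2⟩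
      simp [diagCoupling]
  choose K hK h using h
  refine ⟨∑ q ∈ Finset.range n ×ˢ Finset.range n, K q, Finset.sum_nonneg fun q _ => hK q,
    fun i hi r hr z => (h (i, r) hi hr z).trans ?_⟩
  refine mul_le_mul_of_nonneg_right ?_ (norm_nonneg _)
  exact Finset.single_le_sum (f := K) (fun q _ => hK q)
    (Finset.mem_product.2 ⟨Finset.mem_range.2 hi, Finset.mem_range.2 (by dsimp only; omega)⟩)

/-- With m = n - j the levels are 1 - m and -m. Only m = 0 involves the unbounded power A^{1/2};
otherwise both norms are those of powers of `S`, applied to u_j = Sx_j and u_j' = v_j. -/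
theorem energy_eq_weakEn (hA : IsCoerciveSelfAdjoint A) (D : ℕ → H →L[ℝ] H) (x v : ℕ → H)
    {n j : ℕ} (hj : j ≤ n) :
    energy A (1 + (j : ℤ) - n) (realInvSqrt A (x j)) (v j)
      = weakEn (realInvSqrt A) D x v n j := by
  obtain ⟨m, rfl⟩ := Nat.exists_eq_add_of_le hj
  have e2 : hNorm A (1 + (j : ℤ) - (j + m : ℕ) - 1) (v j)
      = levelNorm (realInvSqrt A) D x v (j + m) j (m + 1) := by
    rw [show (1 + (j : ℤ) - (j + m : ℕ) - 1) = -(m : ℤ) by push_cast; ring, hA.hNorm_neg_natCast,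
      levelNorm, Nat.add_sub_cancel_left, Nat.sub_self, prim_zero_left, realInvSqrt_pow_apply]
  have e1 : hNorm A (1 + (j : ℤ) - (j + m : ℕ)) (realInvSqrt A (x j))
      = levelNorm (realInvSqrt A) D x v (j + m) j m := by
    rcases m with _ | r
    · rw [show (1 + (j : ℤ) - (j + 0 : ℕ)) = 1 by push_cast; ring, levelNorm,
        Nat.add_sub_cancel_left, primHalf_zero_left]
      exact hA.hNorm_one_apply _
    · rw [show (1 + (j : ℤ) - (j + (r + 1) : ℕ)) = -(r : ℤ) by push_cast; ring,
        hA.hNorm_neg_natCast, levelNorm, Nat.add_sub_cancel_left,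
        show r + 1 - r = 1 by omega, prim_one_left, realInvSqrt_pow_apply]
  rw [energy, weakEn, e1, e2, Nat.add_sub_cancel_left]

end Reduction

end Cascade

namespace Cascade

/-! ### The inequalities for the mixed cascade system -/

section MixedCascade

variable {E : Type*} [NormedAddCommGroup E] [InnerProductSpace ℝ E] [CompleteSpace E]
  {S : E →L[ℝ] E}

theorem weakEn_zero_right (D : ℕ → E →L[ℝ] E) {x v : ℕ → E} (hx : x 0 = 0) (hv : v 0 = 0) (n : ℕ) :
    weakEn S D x v n 0 = 0 := by
  have h : ∀ r, levelNorm S D x v n 0 r = 0 := by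
    rintro (_ | r)
    · rw [levelNorm, primHalf_zero_right D hx, norm_zero]
    · rw [levelNorm, prim_zero_right D hx hv, map_zero, norm_zero]
  simp [weakEn, h]

theorem weakEn_nonneg (D : ℕ → E →L[ℝ] E) (x v : ℕ → E) (n j : ℕ) :
    0 ≤ weakEn S D x v n j := by
  unfold weakEn; positivity

variable {D : ℕ → E →L[ℝ] E} {C : ℕ → ℕ → E →L[ℝ] E} {n p : ℕ} {T : ℝ}
  {G : Fin (p + 1) → Type*} [∀ j, NormedAddCommGroup (G j)] {b : ∀ j, E × E →+ G j}

/-- `g j` is the observation of the `(n + j)`-th component. -/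
def RedMixedObservation (S : E →L[ℝ] E) (D : ℕ → E →L[ℝ] E) (C : ℕ → ℕ → E →L[ℝ] E) (n p : ℕ)
    {G : Fin (p + 1) → Type*} [∀ j, NormedAddCommGroup (G j)] (b : ∀ j, E × E →+ G j) (T : ℝ)
    (x v : ℕ → ℝ → E) (g : ∀ j, ℝ → G j) : Prop :=
  ∀ j : Fin (p + 1), RedObservation S (b j) T (x (n + j)) (v (n + j))
    (fun t => redSource S D C n (fun k => x k t) (n + j)) (g j)

theorem RedMixed.redSol_redSource (hn : 1 ≤ n) {x v : ℕ → ℝ → E} (h : RedMixed S D C n p T x v)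
    (j : Fin (p + 1)) : RedSol S 0 T (x (n + j)) (v (n + j))
      (fun t => redSource S D C n (fun k => x k t) (n + j)) := by
  rcases Nat.eq_zero_or_pos (j : ℕ) with hj | hj
  · have := h.chain.sol (n - 1) (by omega)
    rw [Nat.sub_add_cancel hn] at this
    simpa only [hj, add_zero, redSource_self] using this
  · simp only [redSource_of_lt D C (show n < n + j by omega)]
    exact h.sol (n + j) (by have := j.2; simp only [Finset.mem_Icc]; omega)

theorem RedMixedObservation.zero {x v : ℕ → ℝ → E} {g : ∀ j, ℝ → G j}
    (hg : RedMixedObservation S D C n p b T x v g) :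
    RedObservation S (b 0) T (x n) (v n) (fun t => -D n (S (x (n - 1) t))) (g 0) := by
  simpa only [Fin.val_zero, add_zero, redSource_self] using hg 0

theorem RedMixedObservation.of_pos {x v : ℕ → ℝ → E} {g : ∀ j, ℝ → G j}
    (hg : RedMixedObservation S D C n p b T x v g) {j : Fin (p + 1)} (hj : 0 < (j : ℕ)) :
    RedObservation S (b j) T (x (n + j)) (v (n + j))
      (fun t => -∑ k ∈ Finset.Ico (n - 1) (n + j), C (n + j) k (S (x k t))) (g j) := by
  simpa only [redSource_of_lt D C (show n < n + j by omega)] using hg j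

/-- The direct inequality for the mixed cascade system. -/
theorem exists_sum_integral_obs_le (hS : S.IsPositive) (hinj : Function.Injective S)
    (hn : 1 ≤ n) (hb : ∀ j, RedAdmissible S (b j)) (hT : 0 < T) {K : ℝ} (hK : 0 ≤ K)
    (hD : ∀ i < n, ∀ r ≤ n - (i + 1), ∀ z, ‖(S ^ r) (D (i + 1) z)‖ ≤ K * ‖(S ^ r) z‖) :
    ∃ c : ℝ, 0 < c ∧ ∀ (x v : ℕ → ℝ → E) (g : ∀ j, ℝ → G j), RedMixed S D C n p T x v →
      RedMixedObservation S D C n p b T x v g →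
      ∑ j, ∫ t in (0 : ℝ)..T, ‖g j t‖ ^ 2 ≤
        c * (∑ i ∈ Finset.Icc 1 n, weakEn S D (fun j => x j 0) (fun j => v j 0) n i
          + ∑ j ∈ Finset.Icc 1 p, en (x (n + j) 0) (v (n + j) 0)) := by
  have h : ∀ j : Fin (p + 1), ∃ c : ℝ, 0 < c ∧ ∀ (x v : ℕ → ℝ → E) (g : ∀ j, ℝ → G j),
      RedMixed S D C n p T x v → RedMixedObservation S D C n p b T x v g → ∀ M : ℝ, 0 ≤ M →
      (∀ i ≤ n, primEn S D (fun j => x j 0) (fun j => v j 0) n i ≤ M) →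
      (∀ i ∈ Finset.Icc 1 p, en (x (n + i) 0) (v (n + i) 0) ≤ M) →
      ∫ t in (0 : ℝ)..T, ‖g j t‖ ^ 2 ≤ c * M := by
    intro j
    rcases Nat.eq_zero_or_pos (j : ℕ) with hj | hj
    · obtain rfl : j = 0 := Fin.ext hj
      obtain ⟨c, hc, h⟩ := DispChain.exists_integral_obs_le hS hinj D hn (hb 0) hT
      exact ⟨c, hc, fun x v g hx hg M hM h1 _ => h x v hx.chain M hM h1 _ hg.zero⟩
    · obtain ⟨c, hc, h⟩ := RedMixed.exists_integral_obs_le hS hinj D C hn (hb j) hT (p := p)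
        (i := n + j) (by have := j.2; simp only [Finset.mem_Icc]; omega)
      exact ⟨c, hc, fun x v g hx hg M hM h1 h2 => h x v hx M hM h1 h2 _ (hg.of_pos hj)⟩
  choose c hc h using h
  obtain ⟨c₀, hc₀, hw⟩ := exists_weakEn_le (S := S) hK hD
  have hcs : 0 < ∑ j, c j := Finset.sum_pos (fun j _ => hc j) Finset.univ_nonempty
  refine ⟨(∑ j, c j) * (c₀ + 1), by positivity, fun x v g hx hg => ?_⟩
  set W₁ := ∑ i ∈ Finset.Icc 1 n, weakEn S D (fun j => x j 0) (fun j => v j 0) n i with hW₁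
  set W₂ := ∑ j ∈ Finset.Icc 1 p, en (x (n + j) 0) (v (n + j) 0) with hW₂
  have h1 : 0 ≤ W₁ := Finset.sum_nonneg fun i _ => weakEn_nonneg D _ _ _ _
  have h2 : 0 ≤ W₂ := Finset.sum_nonneg fun i _ => en_nonneg _ _
  have hx0 : x 0 0 = 0 := hx.chain.x_zero 0
  have hv0 : v 0 0 = 0 := hx.chain.v_zero 0
  have h3 : ∀ i ≤ n, weakEn S D (fun j => x j 0) (fun j => v j 0) n i ≤ W₁ + W₂ := by
    intro i hi
    rcases Nat.eq_zero_or_pos i with rfl | hi0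
    · rw [weakEn_zero_right D hx0 hv0]; positivity
    · have := Finset.single_le_sum
        (f := fun i => weakEn S D (fun j => x j 0) (fun j => v j 0) n i)
        (fun i _ => weakEn_nonneg D _ _ _ _) (Finset.mem_Icc.2 ⟨hi0, hi⟩)
      exact this.trans (by linarith)
  have h4 : ∀ i ∈ Finset.Icc 1 p, en (x (n + i) 0) (v (n + i) 0) ≤ W₁ + W₂ := by
    intro i hi
    have := Finset.single_le_sum (f := fun j => en (x (n + j) 0) (v (n + j) 0))
      (fun i _ => en_nonneg _ _) hi
    exact this.trans (by linarith)
  have h5 := (hw (fun j => x j 0) (fun j => v j 0) hx0 hv0 n le_rfl _ (add_nonneg h1 h2)).2 h3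
  have h6 : 0 ≤ (c₀ + 1) * (W₁ + W₂) := by positivity
  have h7 : 0 ≤ c₀ * (W₁ + W₂) := by positivity
  rw [mul_assoc, Finset.sum_mul]
  refine Finset.sum_le_sum fun j _ => h j x v g hx hg _ h6 (fun i hi => ?_) fun i hi => ?_
  · linarith [h5 i hi]
  · linarith [h4 i hi]

/-- The observability inequality for the mixed cascade system. -/
theorem exists_en_le_integral_obs (hS : S.IsPositive) (hinj : Function.Injective S)
    (hcp : IsCompactOperator (S * S : E →L[ℝ] E)) (hn : 2 ≤ n) (hch : ChainEstimate S D n)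
    (hb : ∀ j, RedAdmissible S (b j)) (hobs : ∀ j, RedObserving S (b j)) {K : ℝ} (hK : 0 ≤ K)
    (hD : ∀ i < n, ∀ r ≤ n - (i + 1), ∀ z, ‖(S ^ r) (D (i + 1) z)‖ ≤ K * ‖(S ^ r) z‖) :
    ∃ (Tstar : ℝ) (d : ℕ → ℝ → ℝ) (ρ : ℕ → ℝ → ℝ), 0 < Tstar ∧
      (∀ T : ℝ, Tstar < T → (∀ i, 0 < d i T) ∧ (∀ k, 0 < ρ k T)) ∧
      (∃ K : ℝ, ∀ T : ℝ, Tstar < T → (∀ i ∈ Finset.Icc 1 (n - 1), d i T ≤ K / T ^ 3) ∧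
        d n T ≤ K / T) ∧
      ∀ T : ℝ, Tstar < T → ∀ (x v : ℕ → ℝ → E) (g : ∀ j, ℝ → G j), RedMixed S D C n p T x v →
        RedMixedObservation S D C n p b T x v g →
        (∀ i ∈ Finset.Icc 1 n, weakEn S D (fun j => x j 0) (fun j => v j 0) n i ≤
          d i T * ∫ t in (0 : ℝ)..T, ‖g 0 t‖ ^ 2) ∧
        ∀ k : Fin (p + 1), 1 ≤ (k : ℕ) → en (x (n + k) 0) (v (n + k) 0) ≤
          ρ k T * ∑ l ∈ Finset.Iic k, ∫ t in (0 : ℝ)..T, ‖g l t‖ ^ 2 := by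
  obtain ⟨K₀, T₁, hK₀, hT₁, hprim⟩ :=
    hch.exists_primEn_le hS hinj hcp hn (hb 0) (hobs 0)
  obtain ⟨c₀, hc₀, hw⟩ := exists_weakEn_le (S := S) hK hD
  have hstep := fun j : Fin (p + 1) =>
    (hobs j).exists_en_le hS hinj hcp (show 1 ≤ n by omega) D C (hb j)
  choose τ hτ hstep using hstep
  -- The sum exceeds the observability threshold of every component at once.
  set Ts : ℝ := T₁ + ∑ j, τ j with hTs
  have hτs : 0 ≤ ∑ j, τ j := Finset.sum_nonneg fun j _ => (hτ j).le
  have hτle : ∀ j, τ j ≤ Ts := fun j => by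
    have := Finset.single_le_sum (f := τ) (fun j _ => (hτ j).le) (Finset.mem_univ j)
    linarith
  have hTs0 : 0 < Ts := by positivity
  -- Induction on `k` bounds all components up to n + k by the first k + 1 observations. The
  -- constant is produced for every `k` and `T`, arbitrarily 1 outside the relevant range, so that
  -- it can be chosen as a function.
  have hρ : ∀ (k : ℕ) (T : ℝ), ∃ c : ℝ, 0 < c ∧ (Ts < T → k ≤ p →
      ∀ (x v : ℕ → ℝ → E) (g : ∀ j, ℝ → G j), RedMixed S D C n p T x v →
      RedMixedObservation S D C n p b T x v g → ∀ M : ℝ,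
      (∀ l : Fin (p + 1), (l : ℕ) ≤ k → (∫ t in (0 : ℝ)..T, ‖g l t‖ ^ 2) ≤ M) →
      (∀ j ≤ n, primEn S D (fun j => x j 0) (fun j => v j 0) n j ≤ c * M) ∧
      ∀ j ∈ Finset.Icc 1 k, en (x (n + j) 0) (v (n + j) 0) ≤ c * M) := by
    intro k T
    by_cases hT : Ts < T
    swap
    · exact ⟨1, one_pos, fun h => absurd h hT⟩
    have hT0 : 0 < T := hTs0.trans hT
    have hM0 : ∀ (k : ℕ) (g : ∀ j, ℝ → G j) (M : ℝ),
        (∀ l : Fin (p + 1), (l : ℕ) ≤ k → (∫ t in (0 : ℝ)..T, ‖g l t‖ ^ 2) ≤ M) → 0 ≤ M :=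
      fun k g M h => (integral_nonneg_Icc hT0.le fun t _ => by positivity).trans
        (h 0 (Nat.zero_le _))
    induction k with
    | zero =>
      refine ⟨K₀ / T ^ 3 + K₀ / T, by positivity, fun _ _ x v g hx hg M h => ⟨fun j hj => ?_, ?_⟩⟩
      · have hM := hM0 0 g M h
        obtain ⟨h1, h2⟩ := hprim T x v (g 0) (by linarith) hx.chain hg.zero
        have h3 : ∀ q : ℝ, 0 ≤ q → q ≤ K₀ / T ^ 3 + K₀ / T →
            q * (∫ t in (0 : ℝ)..T, ‖g 0 t‖ ^ 2) ≤ (K₀ / T ^ 3 + K₀ / T) * M :=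
          fun q hq hq' => (mul_le_mul_of_nonneg_left (h 0 le_rfl) hq).trans
            (mul_le_mul_of_nonneg_right hq' hM)
        rcases hj.lt_or_eq with hj | rfl
        · exact (h1 j hj).trans (h3 _ (by positivity) (le_add_of_nonneg_right (by positivity)))
        · exact h2.trans (h3 _ (by positivity) (le_add_of_nonneg_left (by positivity)))
      · intro j hj
        simp at hj
    | succ k ih =>
      obtain ⟨c, hc, ih⟩ := ih
      by_cases hk : k + 1 ≤ p
      swap
      · exact ⟨1, one_pos, fun _ h => absurd h hk⟩
      obtain ⟨c', hc', hs⟩ := hstep ⟨k + 1, by omega⟩ T ((hτle _).trans hT.le) k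
      refine ⟨c + c' * (c + 1), by positivity, fun _ _ x v g hx hg M h => ?_⟩
      have hM := hM0 _ g M h
      obtain ⟨h1, h2⟩ := ih hT (by omega) x v g hx hg M fun l hl => h l (by omega)
      have h3 : 0 ≤ c * M := by positivity
      have h4 : 0 ≤ c' * ((c + 1) * M) := by positivity
      have h5 := hs x v (hx.mono hk) ((c + 1) * M) (by positivity)
        (fun j hj => (h1 j hj).trans (by linarith)) (fun j hj => (h2 j hj).trans (by linarith))
        (g ⟨k + 1, by omega⟩) (hg.of_pos (j := ⟨k + 1, by omega⟩) (Nat.succ_pos k))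
        ((h ⟨k + 1, by omega⟩ le_rfl).trans (by linarith))
      have e : (c + c' * (c + 1)) * M = c * M + c' * ((c + 1) * M) := by ring
      refine ⟨fun j hj => ?_, fun j hj => ?_⟩
      · linarith [h1 j hj]
      · rcases eq_or_ne j (k + 1) with rfl | hjk
        · linarith
        · linarith [h2 j (by simp only [Finset.mem_Icc] at hj ⊢; omega)]
  choose ρ hρ0 hρ using hρ
  refine ⟨Ts, fun i T => if i = n then K₀ / T else c₀ * (K₀ / T ^ 3), ρ, hTs0,
    fun T hT => ⟨fun i => ?_, fun k => hρ0 k T⟩, ⟨K₀ + c₀ * K₀, fun T hT => ⟨fun i hi => ?_, ?_⟩⟩,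
    fun T hT x v g hx hg => ⟨fun i hi => ?_, fun k hk => ?_⟩⟩
  · have hT0 : 0 < T := hTs0.trans hT
    dsimp only
    split_ifs <;> positivity
  · have hT0 : 0 < T := hTs0.trans hT
    simp only [Finset.mem_Icc] at hi
    dsimp only
    rw [if_neg (by omega), ← mul_div_assoc]
    gcongr
    linarith
  · have hT0 : 0 < T := hTs0.trans hT
    dsimp only
    rw [if_pos rfl]
    gcongr
    have : 0 < c₀ * K₀ := by positivity
    linarith
  · have hT0 : 0 < T := hTs0.trans hT
    simp only [Finset.mem_Icc] at hi
    obtain ⟨h1, h2⟩ := hprim T x v (g 0) (by linarith) hx.chain hg.zero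
    have hI : 0 ≤ ∫ t in (0 : ℝ)..T, ‖g 0 t‖ ^ 2 :=
      integral_nonneg_Icc hT0.le fun t _ => by positivity
    dsimp only
    split_ifs with hin
    · subst hin
      rw [primEn_self] at h2
      rwa [weakEn_self]
    -- Here J = n - 1: the last component, which decays only like 1/T, does not enter the bound for
    -- i < n.
    · rw [mul_assoc]
      exact (hw (fun j => x j 0) (fun j => v j 0) (hx.chain.x_zero 0) (hx.chain.v_zero 0)
        (n - 1) (by omega) _ (by positivity)).1 (fun j hj => h1 j (by omega)) i (by omega)
  · have hT0 : 0 < T := hTs0.trans hT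
    refine (hρ k T hT (by have := k.2; omega) x v g hx hg _ fun l hl => ?_).2 k
      (Finset.mem_Icc.2 ⟨hk, le_rfl⟩)
    exact Finset.single_le_sum (f := fun l => ∫ t in (0 : ℝ)..T, ‖g l t‖ ^ 2)
      (fun l _ => integral_nonneg_Icc hT0.le fun t _ => by positivity) (Finset.mem_Iic.2 hl)

end MixedCascade

/-! ### Return to the given scalar field and to the original operators. -/

section Transfer

variable {𝕜 : Type*} [RCLike 𝕜] {H : Type*} [NormedAddCommGroup H] [InnerProductSpace 𝕜 H]
  [CompleteSpace H]

/-- A real inner product compatible with a given real normed space structure. -/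
@[reducible]
def realInnerProductSpace (𝕜 : Type*) [RCLike 𝕜] (H : Type*) [NormedAddCommGroup H]
    [InnerProductSpace 𝕜 H] [NormedSpace ℝ H] [IsScalarTower ℝ 𝕜 H] : InnerProductSpace ℝ H where
  inner x y := RCLike.re (inner 𝕜 x y)
  norm_sq_eq_re_inner x := norm_sq_eq_re_inner (𝕜 := 𝕜) x
  conj_inner_symm x y := inner_re_symm (𝕜 := 𝕜) _ _
  add_left x y z := by simp only [inner_add_left, map_add]
  smul_left x y r := by
    rw [← algebraMap_smul 𝕜 r x, inner_smul_left, RCLike.algebraMap_eq_ofReal,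
      RCLike.conj_ofReal, RCLike.re_ofReal_mul]
    rfl

variable [InnerProductSpace ℝ H] [IsScalarTower ℝ 𝕜 H] {A : H →ₗ.[𝕜] H} {n p : ℕ}
  {C : ℕ → ℕ → H →L[𝕜] H} {P : ℕ → H →L[𝕜] H}
  {G : Fin (p + 1) → Type*} [∀ j, NormedAddCommGroup (G j)]
  [∀ j, InnerProductSpace 𝕜 (G j)] {B : ∀ j, A.domain × H →ₗ[𝕜] G j}

theorem isMixedObservation_iff (hA : IsCoerciveSelfAdjoint A) (hn : 2 ≤ n) {T : ℝ} (hT : 0 ≤ T)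
    {u v x v' : ℕ → ℝ → H} {g : ∀ j, ℝ → G j}
    (hu : ∀ i ∈ Finset.Icc 1 (n + p), v' i = v i ∧ ∀ t ∈ Icc 0 T, u i t = realInvSqrt A (x i t))
    (hs : ∀ i ∈ Finset.Icc n (n + p), ∀ t ∈ Icc 0 T, -coupling n C (fun k => u k t) i
      = redSource (realInvSqrt A) (diagCoupling C) (fun i k => (C i k).restrictScalars ℝ) n
          (fun k => x k t) i) :
    IsMixedObservation A n p C B T u v g ↔
      RedMixedObservation (realInvSqrt A) (diagCoupling C)
        (fun i k => (C i k).restrictScalars ℝ) n p (fun j => redObs hA (B j)) T x v' g := by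
  refine forall_congr' fun j => ?_
  have hj := j.2
  obtain ⟨h1, h2⟩ := hu (n + j) (by simp only [Finset.mem_Icc]; omega)
  rw [h1]
  exact isObservation_iff hA hT (h2 0 (left_mem_Icc.2 hT))
    (hs (n + j) (by simp only [Finset.mem_Icc]; omega))

theorem IsPartiallyCoercive.diagCoupling_lower
    (hin : ∀ x y : H, ⟪x, y⟫ = RCLike.re (inner 𝕜 x y))
    (hC : ∀ i ∈ Finset.Icc 2 n, IsPartiallyCoercive A (n - i + 1) (C i (i - 1)) (P i)) :
    ∀ i ∈ Finset.Icc 2 n, ∃ α : ℝ, 0 < α ∧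
      ∀ x, α * ‖(P i).restrictScalars ℝ x‖ ^ 2 ≤ ⟪diagCoupling C i x, x⟫ := by
  intro i hi
  obtain ⟨α, hα, h⟩ := (hC i hi).lower
  simp only [Finset.mem_Icc] at hi
  refine ⟨α, hα, fun x => ?_⟩
  rw [hin, diagCoupling, if_neg (by omega)]
  exact h x

theorem exists_unique_isMixedObservation [∀ j, CompleteSpace (G j)] (hA : IsCoerciveSelfAdjoint A)
    (hin : ∀ x y : H, ⟪x, y⟫ = RCLike.re (inner 𝕜 x y)) (hn : 2 ≤ n)
    (hB : ∀ j, IsAdmissible A (B j)) {T : ℝ} (hT : 0 < T) {u v : ℕ → ℝ → H}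
    (h : IsMixedSolution A n p C T u v) :
    (∃ g : ∀ j, ℝ → G j, IsMixedObservation A n p C B T u v g) ∧
      ∀ g g' : ∀ j, ℝ → G j, IsMixedObservation A n p C B T u v g →
        IsMixedObservation A n p C B T u v g' → ∀ j, g j =ᵐ[volume.restrict (Icc 0 T)] g' j := by
  obtain ⟨x, v', hx, hu, hs⟩ := h.exists_redMixed hA hin hn
  simp only [isMixedObservation_iff hA hn hT.le hu hs]
  have hS := realInvSqrt_isPositive (A := A) hin
  have hinj := realInvSqrt_injective hA
  have hsol := hx.redSol_redSource (by omega)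
  refine ⟨?_, fun g g' hg hg' j =>
    (hg j).ae_eq hS hinj ((hB j).red hA) hT (hsol j).cont_f (hg' j)⟩
  have := fun j => (hsol j).exists_observation hS hinj ((hB j).red hA) hT
  choose g hg using this
  exact ⟨g, hg⟩

theorem energy_eq_of_reduction (hA : IsCoerciveSelfAdjoint A) {T : ℝ} (hT : 0 ≤ T)
    {u v x v' : ℕ → ℝ → H} (D : ℕ → H →L[ℝ] H)
    (hu : ∀ i ∈ Finset.Icc 1 (n + p), v' i = v i ∧ ∀ t ∈ Icc 0 T, u i t = realInvSqrt A (x i t)) :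
    (∀ i ∈ Finset.Icc 1 n, energy A (1 + (i : ℤ) - n) (u i 0) (v i 0)
      = weakEn (realInvSqrt A) D (fun j => x j 0) (fun j => v' j 0) n i) ∧
    ∀ j ∈ Finset.Icc 1 p, energy A 1 (u (n + j) 0) (v (n + j) 0)
      = en (x (n + j) 0) (v' (n + j) 0) := by
  have h0 : (0 : ℝ) ∈ Icc 0 T := left_mem_Icc.2 hT
  refine ⟨fun i hi => ?_, fun j hj => ?_⟩
  · simp only [Finset.mem_Icc] at hi
    obtain ⟨h1, h2⟩ := hu i (by simp only [Finset.mem_Icc]; omega)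
    rw [h2 0 h0, ← h1, ← energy_eq_weakEn hA D _ _ hi.2]
  · simp only [Finset.mem_Icc] at hj
    obtain ⟨h1, h2⟩ := hu (n + j) (by simp only [Finset.mem_Icc]; omega)
    rw [h2 0 h0, ← h1]
    exact hA.energy_one_apply _ _

theorem IsMixedSolution.exists_sum_integral_obs_le (hA : IsCoerciveSelfAdjoint A)
    (hin : ∀ x y : H, ⟪x, y⟫ = RCLike.re (inner 𝕜 x y)) (hn : 2 ≤ n)
    (hC : ∀ i ∈ Finset.Icc 2 n, IsPartiallyCoercive A (n - i + 1) (C i (i - 1)) (P i))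
    (hB : ∀ j, IsAdmissible A (B j)) {T : ℝ} (hT : 0 < T) :
    ∃ K : ℝ, 0 < K ∧ ∀ (u v : ℕ → ℝ → H) (g : ∀ j, ℝ → G j), IsMixedSolution A n p C T u v →
      IsMixedObservation A n p C B T u v g →
      ∑ j, ∫ t in (0 : ℝ)..T, ‖g j t‖ ^ 2 ≤
        K * (∑ i ∈ Finset.Icc 1 n, energy A (1 + (i : ℤ) - n) (u i 0) (v i 0)
          + ∑ j ∈ Finset.Icc 1 p, energy A 1 (u (n + j) 0) (v (n + j) 0)) := by
  obtain ⟨K, hK, hD⟩ := exists_norm_pow_diagCoupling_le hA hC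
  obtain ⟨c, hc, h⟩ := Cascade.exists_sum_integral_obs_le (p := p)
    (C := fun i k => (C i k).restrictScalars ℝ) (realInvSqrt_isPositive (A := A) hin)
    (realInvSqrt_injective hA) (show 1 ≤ n by omega) (fun j => (hB j).red hA) hT hK hD
  refine ⟨c, hc, fun u v g hu hg => ?_⟩
  obtain ⟨x, v', hx, hu', hs⟩ := hu.exists_redMixed hA hin hn
  obtain ⟨e1, e2⟩ := energy_eq_of_reduction hA hT.le (diagCoupling C) hu'
  rw [Finset.sum_congr rfl e1, Finset.sum_congr rfl e2]
  exact h x v' g hx ((isMixedObservation_iff hA hn hT.le hu' hs).1 hg)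

theorem IsMixedSolution.exists_energy_le_integral_obs (hA : IsCoerciveSelfAdjoint A)
    (hin : ∀ x y : H, ⟪x, y⟫ = RCLike.re (inner 𝕜 x y)) (hn : 2 ≤ n)
    (hC : ∀ i ∈ Finset.Icc 2 n, IsPartiallyCoercive A (n - i + 1) (C i (i - 1)) (P i))
    (hP : ∀ i ∈ Finset.Icc 2 n, ObservesVelocity A (P i))
    (hB : ∀ j, IsAdmissible A (B j)) (hB' : ∀ j, IsObserving A (B j)) :
    ∃ (Tstar : ℝ) (d : ℕ → ℝ → ℝ) (ρ : ℕ → ℝ → ℝ), 0 < Tstar ∧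
      (∀ T : ℝ, Tstar < T →
        (∀ i ∈ Finset.Icc 1 n, 0 < d i T) ∧ (∀ k ∈ Finset.Icc 1 p, 0 < ρ k T)) ∧
      (∃ K : ℝ, ∀ T : ℝ, Tstar < T →
        (∀ i ∈ Finset.Icc 1 (n - 1), d i T ≤ K / T ^ 3) ∧ d n T ≤ K / T) ∧
      ∀ T : ℝ, Tstar < T → ∀ (u v : ℕ → ℝ → H) (g : ∀ j, ℝ → G j),
        IsMixedSolution A n p C T u v → IsMixedObservation A n p C B T u v g →
        (∀ i ∈ Finset.Icc 1 n, energy A (1 + (i : ℤ) - n) (u i 0) (v i 0) ≤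
            d i T * ∫ t in (0 : ℝ)..T, ‖g 0 t‖ ^ 2) ∧
        (∀ k : Fin (p + 1), 1 ≤ (k : ℕ) →
          energy A 1 (u (n + k) 0) (v (n + k) 0) ≤
            ρ k T * ∑ l ∈ Finset.Iic k, ∫ t in (0 : ℝ)..T, ‖g l t‖ ^ 2) := by
  have hS := realInvSqrt_isPositive (A := A) hin
  have hinj := realInvSqrt_injective hA
  have hcp := isCompactOperator_realInvSqrt hA
  have hch := chainEstimate hS hinj hcp (show 1 ≤ n by omega)
    (IsPartiallyCoercive.diagCoupling_lower hin hC) (fun i hi => (hP i hi).red hA)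
  obtain ⟨K, hK, hD⟩ := exists_norm_pow_diagCoupling_le hA hC
  obtain ⟨Ts, d, ρ, hTs, hpos, hd, h⟩ := exists_en_le_integral_obs (p := p)
    (C := fun i k => (C i k).restrictScalars ℝ) hS hinj hcp hn hch
    (fun j => (hB j).red hA) (fun j => (hB' j).red hA) hK hD
  refine ⟨Ts, d, ρ, hTs, fun T hT => ⟨fun i _ => (hpos T hT).1 i, fun k _ => (hpos T hT).2 k⟩, hd,
    fun T hT u v g hu hg => ?_⟩
  have hT0 : 0 ≤ T := (hTs.trans hT).le
  obtain ⟨x, v', hx, hu', hs⟩ := hu.exists_redMixed hA hin hn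
  obtain ⟨e1, e2⟩ := energy_eq_of_reduction hA hT0 (diagCoupling C) hu'
  obtain ⟨h1, h2⟩ := h T hT x v' g hx ((isMixedObservation_iff hA hn hT0 hu' hs).1 hg)
  refine ⟨fun i hi => (e1 i hi).trans_le (h1 i hi), fun k hk => (e2 k ?_).trans_le (h2 k hk)⟩
  have := k.2
  simp only [Finset.mem_Icc]
  omega

end Transfer

end Cascade

theorem theorem3p2 {𝕜 : Type*} [RCLike 𝕜]
    {H : Type*} [NormedAddCommGroup H] [InnerProductSpace 𝕜 H] [CompleteSpace H]
    [NormedSpace ℝ H] [IsScalarTower ℝ 𝕜 H]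
    (A : H →ₗ.[𝕜] H) (hA : Cascade.IsCoerciveSelfAdjoint A)
    (n p : ℕ) (hn : 2 ≤ n) (hp : 1 ≤ p)
    (C : ℕ → ℕ → H →L[𝕜] H) (P : ℕ → H →L[𝕜] H)
    (hC : ∀ i ∈ Finset.Icc 2 n, Cascade.IsPartiallyCoercive A (n - i + 1) (C i (i - 1)) (P i))
    (hP : ∀ i ∈ Finset.Icc 2 n, Cascade.ObservesVelocity A (P i))
    (hC' : ∀ i ∈ Finset.Icc (n + 1) (n + p), ∀ j ∈ Finset.Icc (n - 1) (i - 1), ∀ k : ℕ, k ≤ 1 →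
      Cascade.BoundedOnScale A k (C i j) ∧
      Cascade.BoundedOnScale A k (ContinuousLinearMap.adjoint (C i j)))
    {G : Fin (p + 1) → Type*} [∀ j, NormedAddCommGroup (G j)]
    [∀ j, InnerProductSpace 𝕜 (G j)] [∀ j, CompleteSpace (G j)]
    (B : ∀ j, A.domain × H →ₗ[𝕜] G j)
    (hB : ∀ j, Cascade.IsAdmissible A (B j))
    (hB' : ∀ j, Cascade.IsObserving A (B j)) :
    -- the observations of every finite energy solution are well defined in `L²(0,T;G_{n+j})`
    (∀ T : ℝ, 0 < T → ∀ u v : ℕ → ℝ → H, Cascade.IsMixedSolution A n p C T u v →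
      (∃ g : ∀ j, ℝ → G j, Cascade.IsMixedObservation A n p C B T u v g) ∧
      ∀ g g' : ∀ j, ℝ → G j, Cascade.IsMixedObservation A n p C B T u v g →
        Cascade.IsMixedObservation A n p C B T u v g' →
        ∀ j, g j =ᵐ[volume.restrict (Icc 0 T)] g' j) ∧
    -- direct inequality
    (∀ T : ℝ, 0 < T → ∃ K : ℝ, 0 < K ∧
      ∀ (u v : ℕ → ℝ → H) (g : ∀ j, ℝ → G j), Cascade.IsMixedSolution A n p C T u v →
        Cascade.IsMixedObservation A n p C B T u v g →
        ∑ j, ∫ t in (0 : ℝ)..T, ‖g j t‖ ^ 2 ≤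
          K * (∑ i ∈ Finset.Icc 1 n, Cascade.energy A (1 + (i : ℤ) - n) (u i 0) (v i 0)
            + ∑ j ∈ Finset.Icc 1 p, Cascade.energy A 1 (u (n + j) 0) (v (n + j) 0))) ∧
    -- observability inequalities
    (∃ (Tstar : ℝ) (d : ℕ → ℝ → ℝ) (ρ : ℕ → ℝ → ℝ), 0 < Tstar ∧
      (∀ T : ℝ, Tstar < T →
        (∀ i ∈ Finset.Icc 1 n, 0 < d i T) ∧ (∀ k ∈ Finset.Icc 1 p, 0 < ρ k T)) ∧
      (∃ K : ℝ, ∀ T : ℝ, Tstar < T →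
        (∀ i ∈ Finset.Icc 1 (n - 1), d i T ≤ K / T ^ 3) ∧ d n T ≤ K / T) ∧
      ∀ T : ℝ, Tstar < T → ∀ (u v : ℕ → ℝ → H) (g : ∀ j, ℝ → G j),
        Cascade.IsMixedSolution A n p C T u v →
        Cascade.IsMixedObservation A n p C B T u v g →
        (∀ i ∈ Finset.Icc 1 n,
          Cascade.energy A (1 + (i : ℤ) - n) (u i 0) (v i 0) ≤
            d i T * ∫ t in (0 : ℝ)..T, ‖g 0 t‖ ^ 2) ∧
        (∀ k : Fin (p + 1), 1 ≤ (k : ℕ) →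
          Cascade.energy A 1 (u (n + k) 0) (v (n + k) 0) ≤
            ρ k T * ∑ l ∈ Finset.Iic k, ∫ t in (0 : ℝ)..T, ‖g l t‖ ^ 2)) := by
  -- The real part of the inner product induces the given norm and real scalar action, so
  -- derivatives and integrals in the statement keep their meaning, and `hin` holds by definition.
  let := Cascade.realInnerProductSpace 𝕜 H
  have hin : ∀ x y : H, inner ℝ x y = RCLike.re (inner 𝕜 x y) := fun _ _ => rfl
  exact ⟨fun T hT u v h => Cascade.exists_unique_isMixedObservation hA hin hn hB hT h,
    fun T hT => Cascade.IsMixedSolution.exists_sum_integral_obs_le hA hin hn hC hB hT,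
    Cascade.IsMixedSolution.exists_energy_le_integral_obs hA hin hn hC hP hB hB'⟩
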